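/- **Setting.** Let $\mathcal X$ be a finite set and $K$ an irreducible Markov kernel on $\mathcal X$ with steady state $\pi$ (a probability vector with $\pi(y)=\sum_x\pi(x)K(x,y)$), reversible: $\pi(x)K(x,y)=\pi(y)K(y,x)$. Let $\mathscr P(\mathcal X)$ be the set of $\rho:\mathcal X\to[0,\infty)$ with $\sum_x\pi(x)\rho(x)=1$, and $\mathscr P_*(\mathcal X)$ the subset of strictly positive ones. Let $\theta:[0,\infty)^2\to[0,\infty)$ satisfy * (A1) $\theta$ is continuous; (A2) $\theta$ is $C^1$ on $(0,\infty)^2$; (A3) $\theta(s,t)=\theta(t,s)$; (A4) $\theta(s,t)>0$ for $s,t>0$; (A5) $\theta(0,t)=0$ for $t\ge0$; (A6) $\theta(r,t)\le\theta(s,t)$ for $0\le r\le s$, $t\ge0$; (A7) for every $T>0$ there is $C_d>0$ with $\theta(2s,2t)\le 2C_d\,\theta(s,t)$ for $0\le s,t\le T$. Write $\rho(x,y):=\theta(\rho(x),\rho(y))$. For $\bar\rho_0,\bar\rho_1\in\mathscr P(\mathcal X)$ let $\mathcal W(\bar\rho_0,\bar\rho_1)\in[0,\infty]$ be defined by $$\mathcal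 W(\bar\rho_0,\bar\rho_1)^2=\inf_{(\rho,\psi)}\ \frac12\int_0^1\sum_{x,y}(\psi_t(x)-\psi_t(y))^2K(x,y)\rho_t(x,y)\pi(x)\,dt ,$$ where the infimum ($\infty$ if there is no such pair) is over all piecewise $C^1$ curves $\rho:[0,1]\to\mathscr P(\mathcal X)$ and measurable $\psi:[0,1]\to\mathbb R^{\mathcal X}$ with $\rho_0=\bar\rho_0$, $\rho_1=\bar\rho_1$ and, for a.e. $t$ and all $x$, $\dot\rho_t(x)+\sum_y(\psi_t(y)-\psi_t(x))K(x,y)\rho_t(x,y)=0$. Let $x\sim_\rho y$ mean that $x=y$ or that $x,y$ are joined by a chain of edges $(u,v)$ with $\rho(u,v)K(u,v)>0$. Put $C_\theta=\int_0^1\theta(1-r,1+r)^{-1/2}\,dr\in[0,\infty]$ and $\mathscr P_\sigma(\mathcal X)=\{\rho\in\mathscr P(\mathcal X):\mathcal W(\rho,\sigma)<\infty\}$. Let $(B(\rho)\psi)(x)=\sum_yK(x,y)\rho(x,y)(\psi(x)-\psi(y))$ and $\langle\nabla\phi,\nabla\psi\rangle_\rho=\frac12\sum_{x,y}(\phi(x)-\phi(y))(\psi(x)-\psi(y))K(x,y)\rho(x,y)\pi(x)$.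 **Theorem 1.1.** 1. $\mathcal W$ is a pseudo-metric on $\mathscr P(\mathcal X)$, in the sense of a metric that may take the value $+\infty$: it is symmetric, satisfies the triangle inequality, and $\mathcal W(\rho_0,\rho_1)=0$ if and only if $\rho_0=\rho_1$. 2. If $C_\theta<\infty$, then $\mathcal W(\rho_0,\rho_1)<\infty$ for all $\rho_0,\rho_1\in\mathscr P(\mathcal X)$. If $C_\theta=\infty$, then for all $\rho_0,\rho_1\in\mathscr P(\mathcal X)$, $\mathcal W(\rho_0,\rho_1)<\infty$ if and only if $\sum_{y\sim_{\rho_0}x}\rho_0(y)\pi(y)=\sum_{y\sim_{\rho_1}x}\rho_1(y)\pi(y)$ for all $x\in\mathcal X$. 3. For every $\sigma\in\mathscr P(\mathcal X)$, $\mathcal W$ metrizes the topology of weak convergence on $\mathscr P_\sigma(\mathcal X)$, which is also the topology of the total variation distance $d_{TV}(\rho_0,\rho_1)=\sum_x\pi(x)|\rho_0(x)-\rho_1(x)|$. 4. If $C_\theta<\infty$ and $\theta$ is concave on $[0,\infty)^2$, then $(\mathscr P_*(\mathcal X),\mathcal W)$ is a Riemannian manifold. If $C_\theta=\infty$, then $(\mathscr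 P_\sigma(\mathcal X),\mathcal W)$ is a complete Riemannian manifold for every $\sigma\in\mathscr P(\mathcal X)$. Here "Riemannian manifold" means, for the set $S$ in question ($S=\mathscr P_*(\mathcal X)$ with any $\sigma\in S$, resp. $S=\mathscr P_\sigma(\mathcal X)$): $\operatorname{Ran}B(\rho)=\operatorname{Ran}B(\sigma)$ for all $\rho\in S$; the map $\rho\mapsto\rho-\sigma$ is a homeomorphism of $(S,\mathcal W)$ onto an open subset of the vector space $\operatorname{Ran}B(\sigma)$, which makes $S$ a smooth manifold with tangent spaces $\operatorname{Ran}B(\sigma)$; the formula $g_\rho(B(\rho)\phi,B(\rho)\psi)=\langle\nabla\phi,\nabla\psi\rangle_\rho$ defines a Riemannian metric on $S$, of class $C^k$ whenever $\theta$ is $C^k$ on $(0,\infty)^2$, $1\le k\le\infty$ (so always at least $C^1$); and $\mathcal W$ is the Riemannian distance of $g$ on $S$, that is, the infimum of the $g$-lengths of $C^1$ paths in $S$. -/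

import Mathlib

open Set MeasureTheory Topology Manifold Bundle
open scoped ENNReal ContDiff

namespace DiscreteTransport

noncomputable section

/-- `K` is an irreducible Markov kernel on the finite set `X`, with steady state `μ`
(a probability vector, often called `π`), and `K` is reversible with respect to `μ`. -/
structure IsReversibleMarkov {X : Type*} [Fintype X] (K : Matrix X X ℝ) (μ : X → ℝ) : Prop where
  nonneg : ∀ x y, 0 ≤ K x y
  row_sum : ∀ x, ∑ y, K x y = 1
  irreducible : K.IsIrreducible
  steady_nonneg : ∀ x, 0 ≤ μ x
  steady_sum : ∑ x, μ x = 1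
  steady : ∀ y, μ y = ∑ x, μ x * K x y
  reversible : ∀ x y, μ x * K x y = μ y * K y x

/-- The standing assumptions on the weight function `θ : [0,∞) × [0,∞) → [0,∞)`.
The values of `θ` outside of the closed quadrant are irrelevant. -/
structure IsAdmissible (θ : ℝ → ℝ → ℝ) : Prop where
  nonneg : ∀ s t, 0 ≤ s → 0 ≤ t → 0 ≤ θ s t
  /-- continuity -/
  continuousOn : ContinuousOn (fun p : ℝ × ℝ => θ p.1 p.2) (Ici 0 ×ˢ Ici 0)
  /-- continuous differentiability in the open quadrant -/
  contDiffOn : ContDiffOn ℝ 1 (fun p : ℝ × ℝ => θ p.1 p.2) (Ioi 0 ×ˢ Ioi 0)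
  /-- symmetry -/
  symm : ∀ s t, 0 ≤ s → 0 ≤ t → θ s t = θ t s
  /-- positivity -/
  pos : ∀ s t, 0 < s → 0 < t → 0 < θ s t
  /-- zero at the boundary -/
  zero_left : ∀ t, 0 ≤ t → θ 0 t = 0
  /-- monotonicity -/
  mono : ∀ r s t, 0 ≤ r → r ≤ s → 0 ≤ t → θ r t ≤ θ s t
  /-- doubling property -/
  doubling : ∀ T > 0, ∃ C > 0, ∀ s t, 0 ≤ s → s ≤ T → 0 ≤ t → t ≤ T →
    θ (2 * s) (2 * t) ≤ 2 * C * θ s t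

/-- Concavity of `θ` on the closed quadrant. -/
def IsConcave (θ : ℝ → ℝ → ℝ) : Prop :=
  ConcaveOn ℝ (Ici (0 : ℝ) ×ˢ Ici (0 : ℝ)) (fun p : ℝ × ℝ => θ p.1 p.2)

/-- `C_θ = ∫₀¹ θ(1-r, 1+r)^(-1/2) dr ∈ [0, ∞]`. -/
def Cθ (θ : ℝ → ℝ → ℝ) : ℝ≥0∞ :=
  ∫⁻ r in Ioo (0 : ℝ) 1, ENNReal.ofReal (1 / √(θ (1 - r) (1 + r)))

variable {X : Type*} [Fintype X]

/-- `ρ : X → ℝ` is a probability density with respect to `μ`. -/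
def IsDensity (μ ρ : X → ℝ) : Prop :=
  (∀ x, 0 ≤ ρ x) ∧ ∑ x, μ x * ρ x = 1

/-- The space `𝒫(X)` of probability densities with respect to `μ`. It is a structure (and not a
subtype of `X → ℝ`), so that it carries no topology or metric by default. -/
structure Density (μ : X → ℝ) where
  val : X → ℝ
  isDensity : IsDensity μ val

instance (μ : X → ℝ) : CoeFun (Density μ) (fun _ => X → ℝ) := ⟨Density.val⟩

/-- The relation `x ∼_ρ y`: either `x = y`, or `x` and `y` are joined by a chain of edges `(u, v)`
with `ρ(u, v) K(u, v) > 0`, where `ρ(u, v) = θ(ρ(u), ρ(v))`. -/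
def Conn (K : Matrix X X ℝ) (θ : ℝ → ℝ → ℝ) (ρ : X → ℝ) : X → X → Prop :=
  Relation.ReflTransGen (fun u v => 0 < θ (ρ u) (ρ v) * K u v)

open Classical in
/-- The mass `∑_{y ∼_ρ x} ρ(y) μ(y)` of the `∼_ρ`-class of `x`. -/
def classMass (K : Matrix X X ℝ) (μ : X → ℝ) (θ : ℝ → ℝ → ℝ) (ρ : X → ℝ) (x : X) : ℝ :=
  ∑ y with Conn K θ ρ y x, ρ y * μ y

/-- A curve `ρ : [0,1] → ℝ^X` is piecewise `C¹`: there is a finite partition of `[0,1]` such that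
`ρ` is `C¹` on each of the closed subintervals (hence `ρ` is continuous on `[0,1]`). -/
def PiecewiseC1 (ρ : ℝ → X → ℝ) : Prop :=
  ∃ (n : ℕ) (τ : ℕ → ℝ), Monotone τ ∧ τ 0 = 0 ∧ τ n = 1 ∧
    ∀ i < n, ContDiffOn ℝ 1 ρ (Icc (τ i) (τ (i + 1)))

/-- The set of admissible pairs `(ρ, ψ)` joining `ρ₀` to `ρ₁`. Only the values at times in
`[0,1]` matter. -/
structure IsCE (K : Matrix X X ℝ) (μ : X → ℝ) (θ : ℝ → ℝ → ℝ) (ρ₀ ρ₁ : X → ℝ)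
    (ρ ψ : ℝ → X → ℝ) : Prop where
  piecewiseC1 : PiecewiseC1 ρ
  init : ρ 0 = ρ₀
  final : ρ 1 = ρ₁
  density : ∀ t ∈ Icc (0 : ℝ) 1, IsDensity μ (ρ t)
  measurable : Measurable ψ
  /-- the continuity equation -/
  continuity_eq : ∀ᵐ t ∂(volume.restrict (Ioo (0 : ℝ) 1)), ∀ x,
    HasDerivAt (fun s => ρ s x)
      (-∑ y, (ψ t y - ψ t x) * K x y * θ (ρ t x) (ρ t y)) t

/-- `⟨∇φ, ∇ψ⟩_ρ = ½ ∑_{x,y} (φ(x) - φ(y)) (ψ(x) - ψ(y)) K(x,y) ρ(x,y) μ(x)`. -/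
def gradInner (K : Matrix X X ℝ) (μ : X → ℝ) (θ : ℝ → ℝ → ℝ) (ρ φ ψ : X → ℝ) : ℝ :=
  1 / 2 * ∑ x, ∑ y, (φ x - φ y) * (ψ x - ψ y) * K x y * θ (ρ x) (ρ y) * μ x

/-- The action `∫₀¹ ‖∇ψ_t‖²_{ρ_t} dt ∈ [0, ∞]` of a pair `(ρ, ψ)`. -/
def action (K : Matrix X X ℝ) (μ : X → ℝ) (θ : ℝ → ℝ → ℝ) (ρ ψ : ℝ → X → ℝ) : ℝ≥0∞ :=
  ∫⁻ t in Icc (0 : ℝ) 1, ENNReal.ofReal (gradInner K μ θ (ρ t) (ψ t) (ψ t))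

/-- The transport distance `𝒲(ρ₀, ρ₁) ∈ [0, ∞]`: the square root of the infimum of the action
over all admissible pairs (`∞` if there are none). -/
def W (K : Matrix X X ℝ) (μ : X → ℝ) (θ : ℝ → ℝ → ℝ) (ρ₀ ρ₁ : Density μ) : ℝ≥0∞ :=
  (⨅ (ρ : ℝ → X → ℝ) (ψ : ℝ → X → ℝ) (_ : IsCE K μ θ ρ₀ ρ₁ ρ ψ), action K μ θ ρ ψ) ^ (1 / 2 : ℝ)

/-- The total variation distance `∑_x μ(x) |ρ₀(x) - ρ₁(x)|`. -/
def dTV (μ : X → ℝ) (ρ₀ ρ₁ : Density μ) : ℝ≥0∞ :=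
  ENNReal.ofReal (∑ x, μ x * |ρ₀ x - ρ₁ x|)

/-- The topology of weak convergence of the probability measures `ρ μ`: the coarsest topology for
which all the maps `ρ ↦ ∑_x φ(x) ρ(x) μ(x)`, with `φ : X → ℝ`, are continuous. -/
@[reducible] def weakTopology (μ : X → ℝ) : TopologicalSpace (Density μ) :=
  ⨅ φ : X → ℝ, TopologicalSpace.induced (fun ρ : Density μ => ∑ x, φ x * ρ x * μ x) inferInstance

/-- `d` satisfies the axioms of a metric, except that the value `∞` is allowed. -/
structure IsExtendedMetric {M : Type*} (d : M → M → ℝ≥0∞) : Prop where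
  eq_zero_iff : ∀ a b, d a b = 0 ↔ a = b
  symm : ∀ a b, d a b = d b a
  triangle : ∀ a b c, d a c ≤ d a b + d b c

/-- On the set `S`, the function `d` is an (extended) metric, and its metric topology is the
subspace topology induced by `t`. -/
def MetrizesOn {M : Type*} (d : M → M → ℝ≥0∞) (S : Set M) (t : TopologicalSpace M) : Prop :=
  ∃ m : EMetricSpace S, (∀ a b : S, edist a b = d a b) ∧
    m.toUniformSpace.toTopologicalSpace = TopologicalSpace.induced (Subtype.val : S → M) t

/-- `𝒫_*(X)`, the set of strictly positive densities. -/
def positiveDensities (μ : X → ℝ) : Set (Density μ) := {ρ | ∀ x, 0 < ρ x}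

/-- `𝒫_σ(X)`, the set of densities at finite distance from `σ`. -/
def finiteDist (K : Matrix X X ℝ) (μ : X → ℝ) (θ : ℝ → ℝ → ℝ) (σ : Density μ) :
    Set (Density μ) := {ρ | W K μ θ ρ σ < ⊤}

/-- The linear map `B(ρ)`, `(B(ρ)ψ)(x) = ∑_y K(x,y) ρ(x,y) (ψ(x) - ψ(y))`; the continuity equation
reads `∂ₜ ρ_t = B(ρ_t) ψ_t`. -/
def B (K : Matrix X X ℝ) (θ : ℝ → ℝ → ℝ) (ρ : X → ℝ) : (X → ℝ) →ₗ[ℝ] (X → ℝ) where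
  toFun ψ x := ∑ y, K x y * θ (ρ x) (ρ y) * (ψ x - ψ y)
  map_add' φ ψ := by
    funext x
    simp only [Pi.add_apply, ← Finset.sum_add_distrib]
    exact Finset.sum_congr rfl fun y _ => by ring
  map_smul' c ψ := by
    funext x
    simp only [Pi.smul_apply, smul_eq_mul, RingHom.id_apply, Finset.mul_sum]
    exact Finset.sum_congr rfl fun y _ => by ring

/-- The space `Ran B(ρ)` of tangent directions `∂ₜ ρ` at `ρ`. -/
abbrev tangentDirections (K : Matrix X X ℝ) (θ : ℝ → ℝ → ℝ) (ρ : X → ℝ) : Submodule ℝ (X → ℝ) :=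
  LinearMap.range (B K θ ρ)

/-- The set `S` of densities, with the extended metric `m`, is a Riemannian manifold with
metric tensor of class `C^k`:
* the tangent directions `Ran B(ρ)` are the same for all `ρ ∈ S` and for `σ`;
* the map `ρ ↦ ρ - σ` is a homeomorphism from `S` (with the topology of `m`) onto an open subset of
  the finite-dimensional vector space `Ran B(σ)`; used as a global chart, it makes `S` a smooth
  manifold whose tangent spaces are all `Ran B(σ)`;
* there is a `C^k` Riemannian metric `g` on `S`, which under the identification of the tangent
  vector `B(ρ)ψ` with the discrete gradient `∇ψ` is the inner product `⟨∇φ, ∇ψ⟩_ρ`;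
* the distance of `m` is the Riemannian distance of `g`, i.e. the infimum of the lengths of
  `C¹` paths in `S`. -/
def IsRiemannianOn (K : Matrix X X ℝ) (μ : X → ℝ) (θ : ℝ → ℝ → ℝ) (k : ℕ∞) (σ : Density μ)
    (S : Set (Density μ)) (m : EMetricSpace S) : Prop :=
  (∀ ρ ∈ S, tangentDirections K θ ρ = tangentDirections K θ σ) ∧
  ∃ chart : S → tangentDirections K θ σ,
    (∀ (ρ : S) (x : X), (chart ρ : X → ℝ) x = ρ.1 x - σ x) ∧
    ∃ (_ : Nonempty S) (h : IsOpenEmbedding chart),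
      letI : ChartedSpace (tangentDirections K θ σ) S := h.singletonChartedSpace
      ∃ (_ : IsManifold 𝓘(ℝ, tangentDirections K θ σ) ∞ S)
        (g : ContMDiffRiemannianMetric 𝓘(ℝ, tangentDirections K θ σ) k (tangentDirections K θ σ)
          (fun ρ : S => TangentSpace 𝓘(ℝ, tangentDirections K θ σ) ρ)),
        (∀ (ρ : S) (u v : tangentDirections K θ σ) (φ ψ : X → ℝ),
          B K θ ρ.1 φ = u → B K θ ρ.1 ψ = v →
            g.inner ρ u v = gradInner K μ θ ρ.1 φ ψ) ∧
        letI : RiemannianBundle (fun ρ : S => TangentSpace 𝓘(ℝ, tangentDirections K θ σ) ρ) :=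
          ⟨g.toRiemannianMetric⟩
        IsRiemannianManifold 𝓘(ℝ, tangentDirections K θ σ) S

end

end DiscreteTransport

open DiscreteTransport

namespace DiscreteTransport

noncomputable section

set_option linter.unusedSectionVars false

variable {X : Type*} [Fintype X] {K : Matrix X X ℝ} {μ : X → ℝ} {θ : ℝ → ℝ → ℝ}

/-! ### The Markov kernel and the weight function -/

/-! The norm of a velocity has a dual description: if `u = B(ρ)ψ`, then ‖∇ψ‖²_ρ is the least A with
⟨φ, u⟩² ≤ A ‖∇φ‖²_ρ for all φ (`pair_B_sq_le`, `gradInner_le_of_pair_sq_le`). Estimates are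
therefore tested against φ, and ψ hardly ever has to be computed. Moreover, kernel and range of
`B(ρ)` depend only on the support of ρ, and among functions with a fixed support the inverse of
`B(ρ)` on its range is as smooth as θ (`contDiffOn_invB`).

Lower bounds for 𝒲 come from observables: if the gradient of g is at most C in the dual sense, then
g varies by at most C times the root of the action (`IsCE.enorm_sub_le`). Coordinates show that 𝒲
dominates the Euclidean distance. A primitive of θ(·, M)^(-1/2) in one coordinate is a barrier
(`IsCE.cost_le`): if C_θ = ∞, no coordinate can reach or leave zero with finite action. Linear
functionals given by the kernel of `B` are conserved as long as the support does not change.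

Upper bounds come from curves (`W_le_of_curve`). Segments show that 𝒲 is finite and continuous on a
component, that is, among densities with the same support that differ by an element of Ran `B`. So
if C_θ = ∞ the sets of finite distance are the components, and these are told apart by the class
masses. If C_θ < ∞, mass m is poured into an empty vertex along one edge at the speed dm/dt = √θ(m,
c), which takes the finite time ∫ θ(r, c)^(-1/2) dr. Induction on the number of empty vertices then
gives 𝒲(σ, ρ) → 0 as ρ → σ for every σ (`eventually_W_lt`).

In the chart ρ ↦ ρ - σ a component is an open set with the metric ⟨B(ρ)⁻¹u, v⟩. Cutting a path into
short pieces bounds 𝒲 by its length (`le_lintegral_of_le_mul`). Conversely, almost optimal curves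
have to be placed inside the component (`HasNearCurves`): if C_θ = ∞ the barrier keeps them there,
and if θ is concave a slight contraction towards the constant density 1 makes them positive without
making them longer. Completeness holds since the barrier estimate survives a limit of densities. -/

theorem IsReversibleMarkov.reachable (hK : IsReversibleMarkov K μ) (x y : X) :
    Relation.ReflTransGen (fun u v => 0 < K u v) x y := by
  let : Quiver X := Matrix.toQuiver K
  obtain ⟨p, -⟩ := hK.irreducible.connected x y
  induction p with
  | nil => exact .refl
  | cons p e ih => exact ih.tail e.down

/-- Positivity spreads along edges by detailed balance, and irreducibility carries it to every
vertex. -/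
theorem IsReversibleMarkov.pos (hK : IsReversibleMarkov K μ) (x : X) : 0 < μ x := by
  obtain ⟨y, hy⟩ : ∃ y, 0 < μ y := by
    by_contra! h
    have := hK.steady_sum
    rw [Finset.sum_eq_zero fun y _ => le_antisymm (h y) (hK.steady_nonneg y)] at this
    exact zero_ne_one this
  induction hK.reachable y x with
  | refl => exact hy
  | @tail u v _ huv ih =>
    refine lt_of_le_of_ne (hK.steady_nonneg v) fun h => ?_
    have := hK.reversible u v
    rw [← h, zero_mul] at this
    exact (mul_pos ih huv).ne' this

theorem IsReversibleMarkov.kernel_pos_comm (hK : IsReversibleMarkov K μ) {x y : X} :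
    0 < K x y ↔ 0 < K y x := by
  have key : ∀ x y, 0 < K x y → 0 < K y x := fun x y h => by
    have h1 : 0 < μ y * K y x := hK.reversible x y ▸ mul_pos (hK.pos x) h
    exact (pos_iff_pos_of_mul_pos h1).1 (hK.pos y)
  exact ⟨key x y, key y x⟩

theorem IsReversibleMarkov.nonempty (hK : IsReversibleMarkov K μ) : Nonempty X := by
  by_contra h
  rw [not_nonempty_iff] at h
  simpa using hK.steady_sum

theorem IsAdmissible.zero_right (hθ : IsAdmissible θ) {s : ℝ} (hs : 0 ≤ s) : θ s 0 = 0 := by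
  rw [hθ.symm s 0 hs le_rfl, hθ.zero_left s hs]

theorem IsAdmissible.pos_iff (hθ : IsAdmissible θ) {s t : ℝ} (hs : 0 ≤ s) (ht : 0 ≤ t) :
    0 < θ s t ↔ 0 < s ∧ 0 < t := by
  refine ⟨fun h => ⟨hs.lt_of_ne ?_, ht.lt_of_ne ?_⟩, fun h => hθ.pos s t h.1 h.2⟩
  · rintro rfl; rw [hθ.zero_left t ht] at h; exact h.false
  · rintro rfl; rw [hθ.zero_right hs] at h; exact h.false

theorem IsAdmissible.mono₂ (hθ : IsAdmissible θ) {r s t u : ℝ} (hr : 0 ≤ r) (hrs : r ≤ s)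
    (ht : 0 ≤ t) (htu : t ≤ u) : θ r t ≤ θ s u := by
  refine (hθ.mono r s t hr hrs ht).trans ?_
  rw [hθ.symm s t (hr.trans hrs) ht, hθ.symm s u (hr.trans hrs) (ht.trans htu)]
  exact hθ.mono t u s ht htu (hr.trans hrs)

/-- The function `θ`, extended from the quadrant to the plane by clamping, is continuous. -/
theorem IsAdmissible.continuous_clamp (hθ : IsAdmissible θ) :
    Continuous fun p : ℝ × ℝ => θ (max p.1 0) (max p.2 0) := by
  refine hθ.continuousOn.comp_continuous (f := fun p : ℝ × ℝ => (max p.1 0, max p.2 0))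
    (by fun_prop) fun p => ⟨le_max_right p.1 0, le_max_right p.2 0⟩

/-! ### The pairing and the operator `B(ρ)` -/

/-- The pairing `⟨φ, u⟩_μ = ∑_x φ(x) u(x) μ(x)`. -/
def pair (μ φ u : X → ℝ) : ℝ := ∑ x, μ x * φ x * u x

theorem pair_self_eq_zero (hμ : ∀ x, 0 < μ x) {u : X → ℝ} (h : pair μ u u = 0) : u = 0 := by
  unfold pair at h
  rw [Finset.sum_eq_zero_iff_of_nonneg fun x _ => by
    rw [mul_assoc]; exact mul_nonneg (hμ x).le (mul_self_nonneg _)] at h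
  funext x
  have := h x (Finset.mem_univ x)
  simpa [(hμ x).ne'] using this

theorem pair_add_right (φ u v : X → ℝ) : pair μ φ (u + v) = pair μ φ u + pair μ φ v := by
  simp only [pair, Pi.add_apply, mul_add, Finset.sum_add_distrib]

theorem pair_sub_right (φ u v : X → ℝ) : pair μ φ (u - v) = pair μ φ u - pair μ φ v := by
  simp only [pair, Pi.sub_apply, mul_sub, Finset.sum_sub_distrib]

theorem pair_smul_right (c : ℝ) (φ u : X → ℝ) : pair μ φ (c • u) = c * pair μ φ u := by
  simp only [pair, Pi.smul_apply, smul_eq_mul, Finset.mul_sum]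
  exact Finset.sum_congr rfl fun x _ => by ring

theorem pair_zero_right (φ : X → ℝ) : pair μ φ 0 = 0 := by simp [pair]

theorem cond_symm (hK : IsReversibleMarkov K μ) (hθ : IsAdmissible θ) {ρ : X → ℝ}
    (hρ : ∀ x, 0 ≤ ρ x) (x y : X) :
    K x y * θ (ρ x) (ρ y) * μ x = K y x * θ (ρ y) (ρ x) * μ y := by
  rw [hθ.symm (ρ y) (ρ x) (hρ y) (hρ x)]
  linear_combination θ (ρ x) (ρ y) * hK.reversible x y

theorem cond_nonneg (hK : IsReversibleMarkov K μ) (hθ : IsAdmissible θ) {ρ : X → ℝ}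
    (hρ : ∀ x, 0 ≤ ρ x) (x y : X) : 0 ≤ K x y * θ (ρ x) (ρ y) * μ x :=
  mul_nonneg (mul_nonneg (hK.nonneg x y) (hθ.nonneg _ _ (hρ x) (hρ y))) (hK.steady_nonneg x)

/-- Summation by parts: the edge weights are symmetric by detailed balance, so exchanging x and y
and averaging the two double sums replaces φ(x) by half the difference. -/
theorem pair_B (hK : IsReversibleMarkov K μ) (hθ : IsAdmissible θ) {ρ : X → ℝ}
    (hρ : ∀ x, 0 ≤ ρ x) (φ ψ : X → ℝ) : pair μ φ (B K θ ρ ψ) = gradInner K μ θ ρ φ ψ := by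
  have h1 : pair μ φ (B K θ ρ ψ) =
      ∑ x, ∑ y, φ x * (ψ x - ψ y) * (K x y * θ (ρ x) (ρ y) * μ x) := by
    simp only [pair, B, LinearMap.coe_mk, AddHom.coe_mk, Finset.mul_sum]
    exact Finset.sum_congr rfl fun x _ => Finset.sum_congr rfl fun y _ => by ring
  have h2 : pair μ φ (B K θ ρ ψ) =
      ∑ x, ∑ y, -(φ y * (ψ x - ψ y)) * (K x y * θ (ρ x) (ρ y) * μ x) := by
    rw [h1, Finset.sum_comm]
    refine Finset.sum_congr rfl fun x _ => Finset.sum_congr rfl fun y _ => ?_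
    rw [cond_symm hK hθ hρ y x]; ring
  have h3 : 2 * pair μ φ (B K θ ρ ψ) =
      ∑ x, ∑ y, (φ x - φ y) * (ψ x - ψ y) * K x y * θ (ρ x) (ρ y) * μ x := by
    rw [two_mul]
    nth_rw 1 [h1]
    rw [h2, ← Finset.sum_add_distrib]
    refine Finset.sum_congr rfl fun x _ => ?_
    rw [← Finset.sum_add_distrib]
    exact Finset.sum_congr rfl fun y _ => by ring
  rw [gradInner, ← h3]; ring

theorem gradInner_comm (ρ φ ψ : X → ℝ) :
    gradInner K μ θ ρ φ ψ = gradInner K μ θ ρ ψ φ := by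
  unfold gradInner
  congr 1
  exact Finset.sum_congr rfl fun x _ => Finset.sum_congr rfl fun y _ => by ring

theorem gradInner_self_nonneg (hK : IsReversibleMarkov K μ) (hθ : IsAdmissible θ) {ρ : X → ℝ}
    (hρ : ∀ x, 0 ≤ ρ x) (φ : X → ℝ) : 0 ≤ gradInner K μ θ ρ φ φ := by
  unfold gradInner
  refine mul_nonneg (by norm_num) (Finset.sum_nonneg fun x _ => Finset.sum_nonneg fun y _ => ?_)
  have := mul_nonneg (mul_self_nonneg (φ x - φ y)) (cond_nonneg hK hθ hρ x y)
  linarith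

theorem gradInner_sq_le (hK : IsReversibleMarkov K μ) (hθ : IsAdmissible θ) {ρ : X → ℝ}
    (hρ : ∀ x, 0 ≤ ρ x) (φ ψ : X → ℝ) :
    gradInner K μ θ ρ φ ψ ^ 2 ≤ gradInner K μ θ ρ φ φ * gradInner K μ θ ρ ψ ψ := by
  have h := Finset.sum_sq_le_sum_mul_sum_of_sq_le_mul (Finset.univ : Finset (X × X))
    (r := fun p => (φ p.1 - φ p.2) * (ψ p.1 - ψ p.2) * K p.1 p.2 * θ (ρ p.1) (ρ p.2) * μ p.1)
    (f := fun p => (φ p.1 - φ p.2) * (φ p.1 - φ p.2) * K p.1 p.2 * θ (ρ p.1) (ρ p.2) * μ p.1)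
    (g := fun p => (ψ p.1 - ψ p.2) * (ψ p.1 - ψ p.2) * K p.1 p.2 * θ (ρ p.1) (ρ p.2) * μ p.1)
    (fun p _ => by
      have := mul_nonneg (mul_self_nonneg (φ p.1 - φ p.2)) (cond_nonneg hK hθ hρ p.1 p.2)
      linarith)
    (fun p _ => by
      have := mul_nonneg (mul_self_nonneg (ψ p.1 - ψ p.2)) (cond_nonneg hK hθ hρ p.1 p.2)
      linarith)
    (fun p _ => le_of_eq (by ring))
  simp only [Fintype.sum_prod_type] at h
  unfold gradInner
  nlinarith [h]

/-- If `u = B(ρ)ψ`, then `‖∇ψ‖²_ρ` is the smallest `A` with `⟨φ, u⟩² ≤ A ‖∇φ‖²_ρ`. -/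
theorem gradInner_le_of_pair_sq_le (hK : IsReversibleMarkov K μ) (hθ : IsAdmissible θ)
    {ρ : X → ℝ} (hρ : ∀ x, 0 ≤ ρ x) {ψ : X → ℝ} {A : ℝ} (hA : 0 ≤ A)
    (h : pair μ ψ (B K θ ρ ψ) ^ 2 ≤ A * gradInner K μ θ ρ ψ ψ) :
    gradInner K μ θ ρ ψ ψ ≤ A := by
  rw [pair_B hK hθ hρ] at h
  rcases (gradInner_self_nonneg hK hθ hρ ψ).eq_or_lt with h0 | h0
  · rwa [← h0]
  · rw [sq] at h; exact le_of_mul_le_mul_right h h0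

/-- One half of the duality: the energy of ψ is an admissible constant A for the velocity `B(ρ)ψ`.
-/
theorem pair_B_sq_le (hK : IsReversibleMarkov K μ) (hθ : IsAdmissible θ)
    {ρ : X → ℝ} (hρ : ∀ x, 0 ≤ ρ x) (φ ψ : X → ℝ) :
    pair μ φ (B K θ ρ ψ) ^ 2 ≤ gradInner K μ θ ρ ψ ψ * gradInner K μ θ ρ φ φ := by
  rw [pair_B hK hθ hρ, mul_comm]
  exact gradInner_sq_le hK hθ hρ φ ψ

/-- A sum of nonnegative terms vanishes only termwise. The resulting condition involves ρ only
through its support, which is why kernel and range are locally constant in the sequel. -/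
theorem B_eq_zero_iff (hK : IsReversibleMarkov K μ) (hθ : IsAdmissible θ)
    {ρ : X → ℝ} (hρ : ∀ x, 0 ≤ ρ x) (φ : X → ℝ) :
    B K θ ρ φ = 0 ↔ ∀ x y, 0 < ρ x → 0 < ρ y → 0 < K x y → φ x = φ y := by
  constructor
  · intro h x y hx hy hxy
    have h0 : gradInner K μ θ ρ φ φ = 0 := by rw [← pair_B hK hθ hρ, h, pair_zero_right]
    have hnn : ∀ x y, 0 ≤ (φ x - φ y) * (φ x - φ y) * K x y * θ (ρ x) (ρ y) * μ x := fun x y => by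
      have := mul_nonneg (mul_self_nonneg (φ x - φ y)) (cond_nonneg hK hθ hρ x y)
      linarith
    have h1 : ∑ x, ∑ y, (φ x - φ y) * (φ x - φ y) * K x y * θ (ρ x) (ρ y) * μ x = 0 := by
      unfold gradInner at h0; linarith
    rw [Finset.sum_eq_zero_iff_of_nonneg fun x _ => Finset.sum_nonneg fun y _ => hnn x y] at h1
    have h2 := h1 x (Finset.mem_univ x)
    rw [Finset.sum_eq_zero_iff_of_nonneg fun y _ => hnn x y] at h2
    have h3 := h2 y (Finset.mem_univ y)
    have := (hθ.pos _ _ hx hy).ne'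
    have := (hK.pos x).ne'
    have := hxy.ne'
    simp_all [sub_eq_zero]
  · intro h
    funext x
    simp only [B, LinearMap.coe_mk, AddHom.coe_mk, Pi.zero_apply]
    refine Finset.sum_eq_zero fun y _ => ?_
    by_cases hh : 0 < ρ x ∧ 0 < ρ y ∧ 0 < K x y
    · rw [h x y hh.1 hh.2.1 hh.2.2]; ring
    · rcases (hK.nonneg x y).eq_or_lt with hk | hk
      · rw [← hk]; ring
      · have : ¬ 0 < θ (ρ x) (ρ y) := fun h' => by
          have := (hθ.pos_iff (hρ x) (hρ y)).1 h'
          exact hh ⟨this.1, this.2, hk⟩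
        rw [le_antisymm (not_lt.1 this) (hθ.nonneg _ _ (hρ x) (hρ y))]; ring

theorem pair_B_of_ker (hK : IsReversibleMarkov K μ) (hθ : IsAdmissible θ)
    {ρ : X → ℝ} (hρ : ∀ x, 0 ≤ ρ x) {φ : X → ℝ} (hφ : B K θ ρ φ = 0) (ψ : X → ℝ) :
    pair μ φ (B K θ ρ ψ) = 0 := by
  rw [pair_B hK hθ hρ, gradInner_comm, ← pair_B hK hθ hρ, hφ, pair_zero_right]

/-- `B(ρ)` is symmetric for the pairing, which is positive definite; so kernel and range are
orthogonal, and a dimension count finishes. -/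
theorem isCompl_ker_range_B (hK : IsReversibleMarkov K μ) (hθ : IsAdmissible θ)
    {ρ : X → ℝ} (hρ : ∀ x, 0 ≤ ρ x) :
    IsCompl (LinearMap.ker (B K θ ρ)) (LinearMap.range (B K θ ρ)) := by
  have hd : Disjoint (LinearMap.ker (B K θ ρ)) (LinearMap.range (B K θ ρ)) := by
    rw [Submodule.disjoint_def]
    rintro _ hv ⟨ψ, rfl⟩
    exact pair_self_eq_zero hK.pos (pair_B_of_ker hK hθ hρ (LinearMap.mem_ker.1 hv) ψ)
  refine ⟨hd, codisjoint_iff.2 (Submodule.eq_top_of_disjoint _ _ ?_ hd)⟩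
  rw [add_comm]
  exact (LinearMap.finrank_range_add_finrank_ker (B K θ ρ)).ge

theorem mem_range_B_iff (hK : IsReversibleMarkov K μ) (hθ : IsAdmissible θ)
    {ρ : X → ℝ} (hρ : ∀ x, 0 ≤ ρ x) {u : X → ℝ} :
    u ∈ LinearMap.range (B K θ ρ) ↔ ∀ φ, B K θ ρ φ = 0 → pair μ φ u = 0 := by
  constructor
  · rintro ⟨ψ, rfl⟩ φ hφ
    exact pair_B_of_ker hK hθ hρ hφ ψ
  · intro h
    have hu : u ∈ LinearMap.ker (B K θ ρ) ⊔ LinearMap.range (B K θ ρ) := by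
      rw [(isCompl_ker_range_B hK hθ hρ).sup_eq_top]; trivial
    obtain ⟨k, hk, _, ⟨ψ, rfl⟩, rfl⟩ := Submodule.mem_sup.1 hu
    have h1 := h k (LinearMap.mem_ker.1 hk)
    rw [pair_add_right, pair_B_of_ker hK hθ hρ (LinearMap.mem_ker.1 hk), add_zero] at h1
    rw [pair_self_eq_zero hK.pos h1, zero_add]
    exact ⟨ψ, rfl⟩

theorem mem_range_B_of_pair_sq_le (hK : IsReversibleMarkov K μ) (hθ : IsAdmissible θ)
    {ρ : X → ℝ} (hρ : ∀ x, 0 ≤ ρ x) {u : X → ℝ} {A : ℝ}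
    (h : ∀ φ, pair μ φ u ^ 2 ≤ A * gradInner K μ θ ρ φ φ) :
    u ∈ LinearMap.range (B K θ ρ) := by
  rw [mem_range_B_iff hK hθ hρ]
  intro φ hφ
  have := h φ
  rw [← pair_B hK hθ hρ, hφ, pair_zero_right, mul_zero] at this
  exact pow_eq_zero_iff two_ne_zero |>.1 (le_antisymm this (sq_nonneg _))

/-! ### Functions with the same support -/

/-- The nonnegative functions with the same support as `σ`. -/
def sameSupport (σ : X → ℝ) : Set (X → ℝ) := {ρ | (∀ x, 0 ≤ ρ x) ∧ ∀ x, 0 < ρ x ↔ 0 < σ x}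

theorem sameSupport_self {σ : X → ℝ} (hσ : ∀ x, 0 ≤ σ x) : σ ∈ sameSupport σ :=
  ⟨hσ, fun _ => Iff.rfl⟩

theorem B_eq_zero_iff_of_sameSupport (hK : IsReversibleMarkov K μ) (hθ : IsAdmissible θ)
    {ρ σ : X → ℝ} (hσ : ∀ x, 0 ≤ σ x) (h : ρ ∈ sameSupport σ) (φ : X → ℝ) :
    B K θ ρ φ = 0 ↔ B K θ σ φ = 0 := by
  simp only [B_eq_zero_iff hK hθ h.1, B_eq_zero_iff hK hθ hσ, h.2]

theorem range_B_eq (hK : IsReversibleMarkov K μ) (hθ : IsAdmissible θ)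
    {ρ σ : X → ℝ} (hσ : ∀ x, 0 ≤ σ x) (h : ρ ∈ sameSupport σ) :
    LinearMap.range (B K θ ρ) = LinearMap.range (B K θ σ) := by
  ext u
  simp only [mem_range_B_iff hK hθ h.1, mem_range_B_iff hK hθ hσ,
    B_eq_zero_iff_of_sameSupport hK hθ hσ h]

theorem eq_zero_of_mem_range_B (hθ : IsAdmissible θ) {σ : X → ℝ} (hσ : ∀ x, 0 ≤ σ x)
    {u : X → ℝ} (hu : u ∈ LinearMap.range (B K θ σ)) {x : X} (hx : ¬ 0 < σ x) : u x = 0 := by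
  obtain ⟨ψ, rfl⟩ := hu
  have : σ x = 0 := le_antisymm (not_lt.1 hx) (hσ x)
  simp only [B, LinearMap.coe_mk, AddHom.coe_mk, this]
  exact Finset.sum_eq_zero fun y _ => by rw [hθ.zero_left _ (hσ y)]; ring

/-! ### Inverting `B(ρ)` on its range -/

/-- The projection onto the kernel of `B(σ)` along the range of `B(σ)`. -/
def kerProj (hK : IsReversibleMarkov K μ) (hθ : IsAdmissible θ) {σ : X → ℝ} (hσ : ∀ x, 0 ≤ σ x) :
    (X → ℝ) →ₗ[ℝ] (X → ℝ) :=
  Submodule.projection _ _ (isCompl_ker_range_B hK hθ hσ)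

/-- The inverse of `B(ρ) + P`, where `P` is the projection onto the kernel of `B(σ)`. -/
def invB (hK : IsReversibleMarkov K μ) (hθ : IsAdmissible θ) {σ : X → ℝ} (hσ : ∀ x, 0 ≤ σ x)
    (ρ : X → ℝ) : (X → ℝ) →L[ℝ] (X → ℝ) :=
  Ring.inverse (LinearMap.toContinuousLinearMap (B K θ ρ + kerProj hK hθ hσ))

/-- `B(ρ)` has the same range and kernel as `B(σ)`. If the two summands cancel, they lie in
complementary subspaces, so both vanish, and v lies in the kernel and in the range. Since the
projection is taken at the fixed σ, the operator depends on ρ only through `B(ρ)`. -/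
theorem isUnit_B_add_kerProj (hK : IsReversibleMarkov K μ) (hθ : IsAdmissible θ) {σ ρ : X → ℝ}
    (hσ : ∀ x, 0 ≤ σ x) (hρ : ρ ∈ sameSupport σ) :
    IsUnit (LinearMap.toContinuousLinearMap (B K θ ρ + kerProj hK hθ hσ)) := by
  have hinj : Function.Injective (B K θ ρ + kerProj hK hθ hσ) := by
    rw [← LinearMap.ker_eq_bot, LinearMap.ker_eq_bot']
    intro v hv
    rw [LinearMap.add_apply] at hv
    have hk : kerProj hK hθ hσ v ∈ LinearMap.ker (B K θ σ) := by
      unfold kerProj; exact Submodule.projection_apply_mem (isCompl_ker_range_B hK hθ hσ) _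
    have hr : B K θ ρ v ∈ LinearMap.range (B K θ σ) := by
      rw [← range_B_eq hK hθ hσ hρ]; exact ⟨v, rfl⟩
    have hk0 : B K θ ρ v = 0 := by
      refine Submodule.disjoint_def.1 (isCompl_ker_range_B hK hθ hσ).disjoint _ ?_ hr
      rw [eq_neg_of_add_eq_zero_left hv]
      exact neg_mem hk
    have hp0 : kerProj hK hθ hσ v = 0 := by simpa [hk0] using hv
    have hvr : v ∈ LinearMap.range (B K θ σ) := by
      unfold kerProj at hp0
      exact (Submodule.projection_apply_eq_zero_iff (isCompl_ker_range_B hK hθ hσ)).1 hp0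
    refine Submodule.disjoint_def.1 (isCompl_ker_range_B hK hθ hσ).disjoint _ ?_ hvr
    exact (B_eq_zero_iff_of_sameSupport hK hθ hσ hρ v).1 hk0
  let e := (LinearEquiv.ofInjectiveEndo _ hinj).toContinuousLinearEquiv
  refine ⟨ContinuousLinearEquiv.toUnit e, ?_⟩
  ext v x
  rfl

theorem B_invB (hK : IsReversibleMarkov K μ) (hθ : IsAdmissible θ) {σ ρ : X → ℝ}
    (hσ : ∀ x, 0 ≤ σ x) (hρ : ρ ∈ sameSupport σ) {u : X → ℝ}
    (hu : u ∈ LinearMap.range (B K θ σ)) : B K θ ρ (invB hK hθ hσ ρ u) = u := by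
  have h := Ring.mul_inverse_cancel _ (isUnit_B_add_kerProj hK hθ hσ hρ)
  have h1 := congrArg (fun f : (X → ℝ) →L[ℝ] (X → ℝ) => f u) h
  have h2 : B K θ ρ (invB hK hθ hσ ρ u) + kerProj hK hθ hσ (invB hK hθ hσ ρ u) = u := h1
  have hk : kerProj hK hθ hσ (invB hK hθ hσ ρ u) ∈ LinearMap.ker (B K θ σ) := by
    unfold kerProj; exact Submodule.projection_apply_mem (isCompl_ker_range_B hK hθ hσ) _
  have hr : kerProj hK hθ hσ (invB hK hθ hσ ρ u) ∈ LinearMap.range (B K θ σ) := by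
    rw [← eq_sub_iff_add_eq'] at h2
    rw [h2]
    refine sub_mem hu ?_
    rw [← range_B_eq hK hθ hσ hρ]; exact ⟨_, rfl⟩
  rw [Submodule.disjoint_def.1 (isCompl_ker_range_B hK hθ hσ).disjoint _ hk hr, add_zero] at h2
  exact h2

/-- Smoothness of θ is available only in the open quadrant, but for a fixed support the arguments
either stay in it or the value is identically zero. -/
theorem contDiffOn_theta_apply (hθ : IsAdmissible θ) {σ : X → ℝ} {n : WithTop ℕ∞}
    (h : ContDiffOn ℝ n (fun p : ℝ × ℝ => θ p.1 p.2) (Ioi 0 ×ˢ Ioi 0)) (x y : X) :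
    ContDiffOn ℝ n (fun ρ : X → ℝ => θ (ρ x) (ρ y)) (sameSupport σ) := by
  by_cases hxy : 0 < σ x ∧ 0 < σ y
  · refine h.comp (f := fun ρ : X → ℝ => (ρ x, ρ y)) ?_ fun ρ hρ => ?_
    · exact (ContDiff.prodMk (contDiff_apply ℝ ℝ x) (contDiff_apply ℝ ℝ y)).contDiffOn
    · exact ⟨(hρ.2 x).2 hxy.1, (hρ.2 y).2 hxy.2⟩
  · refine (contDiffOn_const (c := (0 : ℝ))).congr fun ρ hρ => ?_
    refine le_antisymm (not_lt.1 fun h' => hxy ?_) (hθ.nonneg _ _ (hρ.1 x) (hρ.1 y))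
    have := (hθ.pos_iff (hρ.1 x) (hρ.1 y)).1 h'
    exact ⟨(hρ.2 x).1 this.1, (hρ.2 y).1 this.2⟩

theorem contDiffOn_invB (hK : IsReversibleMarkov K μ) (hθ : IsAdmissible θ) {σ : X → ℝ}
    (hσ : ∀ x, 0 ≤ σ x) {n : WithTop ℕ∞}
    (h : ContDiffOn ℝ n (fun p : ℝ × ℝ => θ p.1 p.2) (Ioi 0 ×ˢ Ioi 0)) :
    ContDiffOn ℝ n (invB hK hθ hσ) (sameSupport σ) := by
  classical
  have hB : ContDiffOn ℝ n (fun ρ : X → ℝ =>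
      LinearMap.toContinuousLinearMap (B K θ ρ + kerProj hK hθ hσ)) (sameSupport σ) := by
    -- A linear combination of fixed rank-one operators, with the edge weights as coefficients.
    have : ContDiffOn ℝ n (fun ρ : X → ℝ => (∑ x, ∑ y, (K x y * θ (ρ x) (ρ y)) •
        ((ContinuousLinearMap.proj (R := ℝ) (φ := fun _ : X => ℝ) x -
          ContinuousLinearMap.proj (R := ℝ) (φ := fun _ : X => ℝ) y).smulRight
            (Pi.single x (1 : ℝ) : X → ℝ))) +
        LinearMap.toContinuousLinearMap (kerProj hK hθ hσ)) (sameSupport σ) := by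
      refine ContDiffOn.add (ContDiffOn.sum fun x _ => ContDiffOn.sum fun y _ => ?_)
        contDiffOn_const
      exact (contDiffOn_const.mul (contDiffOn_theta_apply hθ h x y)).smul contDiffOn_const
    refine this.congr fun ρ _ => ?_
    ext v z
    simp only [LinearMap.coe_toContinuousLinearMap', LinearMap.add_apply, Pi.add_apply, B,
      LinearMap.coe_mk, AddHom.coe_mk, add_apply, sum_apply,
      Finset.sum_apply, smul_apply, ContinuousLinearMap.smulRight_apply,
      sub_apply, ContinuousLinearMap.proj_apply, Pi.smul_apply, smul_eq_mul]
    congr 1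
    rw [eq_comm, Finset.sum_eq_single z]
    · exact Finset.sum_congr rfl fun y _ => by rw [Pi.single_eq_same, mul_one]
    · intro b _ hb
      exact Finset.sum_eq_zero fun y _ => by rw [Pi.single_eq_of_ne hb.symm]; ring
    · simp
  intro ρ hρ
  obtain ⟨u, hu⟩ := isUnit_B_add_kerProj hK hθ hσ hρ
  have h1 := contDiffAt_ringInverse (n := n) ℝ u
  rw [hu] at h1
  exact h1.comp_contDiffWithinAt ρ (hB ρ hρ)

/-! ### Upper bounds for `𝒲` along curves -/

theorem W_sq (ρ₀ ρ₁ : Density μ) : W K μ θ ρ₀ ρ₁ ^ 2 =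
    ⨅ (ρ : ℝ → X → ℝ) (ψ : ℝ → X → ℝ) (_ : IsCE K μ θ ρ₀ ρ₁ ρ ψ), action K μ θ ρ ψ := by
  rw [W, ← ENNReal.rpow_natCast, ← ENNReal.rpow_mul]
  norm_num

theorem W_le_of_isCE {ρ₀ ρ₁ : Density μ} {ρ ψ : ℝ → X → ℝ} (h : IsCE K μ θ ρ₀ ρ₁ ρ ψ) {c : ℝ≥0∞}
    (hc : action K μ θ ρ ψ ≤ c ^ 2) : W K μ θ ρ₀ ρ₁ ≤ c := by
  have h1 : W K μ θ ρ₀ ρ₁ ^ 2 ≤ c ^ 2 := by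
    rw [W_sq]
    exact le_trans (iInf_le_of_le ρ <| iInf_le_of_le ψ <| iInf_le_of_le h le_rfl) hc
  exact (ENNReal.pow_le_pow_left_iff two_ne_zero).1 h1

theorem exists_isCE_of_W_lt {ρ₀ ρ₁ : Density μ} {c : ℝ≥0∞} (h : W K μ θ ρ₀ ρ₁ < c) :
    ∃ ρ ψ, IsCE K μ θ ρ₀ ρ₁ ρ ψ ∧ action K μ θ ρ ψ < c ^ 2 := by
  have h1 : W K μ θ ρ₀ ρ₁ ^ 2 < c ^ 2 := (ENNReal.pow_lt_pow_left_iff two_ne_zero).2 h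
  rw [W_sq] at h1
  simpa only [iInf_lt_iff, exists_prop] using h1

theorem piecewiseC1_of_contDiffOn {ρ : ℝ → X → ℝ} (h : ContDiffOn ℝ 1 ρ (Icc 0 1)) :
    PiecewiseC1 ρ := by
  refine ⟨1, fun i => (min i 1 : ℕ), ?_, by simp, by simp, ?_⟩
  · intro i j hij
    simp only
    exact_mod_cast min_le_min_right 1 hij
  · intro i hi
    obtain rfl : i = 0 := by omega
    simpa using h

/-- The potential is recovered from the velocity by inverting `B`. The support has to be constant
only for times in the open interval, so the endpoints may have smaller support. -/
theorem exists_isCE_of_curve (hK : IsReversibleMarkov K μ) (hθ : IsAdmissible θ) {σ : X → ℝ}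
    (hσ : ∀ x, 0 ≤ σ x) {ρ : ℝ → X → ℝ} (h : ContDiffOn ℝ 1 ρ (Icc 0 1))
    (hd : ∀ t ∈ Icc (0 : ℝ) 1, IsDensity μ (ρ t)) (hs : ∀ t ∈ Ioo (0 : ℝ) 1, ρ t ∈ sameSupport σ)
    {A : ℝ} (bound : ∀ t ∈ Ioo (0 : ℝ) 1, ∀ φ,
      pair μ φ (deriv ρ t) ^ 2 ≤ A ^ 2 * gradInner K μ θ (ρ t) φ φ) :
    ∃ ψ, IsCE K μ θ (ρ 0) (ρ 1) ρ ψ ∧ action K μ θ ρ ψ ≤ ENNReal.ofReal (A ^ 2) := by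
  classical
  let ψ : ℝ → X → ℝ := (Ioo (0 : ℝ) 1).piecewise (fun t => invB hK hθ hσ (ρ t) (deriv ρ t)) 0
  have hψ : ∀ t ∈ Ioo (0 : ℝ) 1, B K θ (ρ t) (ψ t) = deriv ρ t := fun t ht => by
    simp only [ψ, piecewise_eq_of_mem _ _ _ ht]
    refine B_invB hK hθ hσ (hs t ht) ?_
    rw [← range_B_eq hK hθ hσ (hs t ht)]
    exact mem_range_B_of_pair_sq_le hK hθ (hs t ht).1 (bound t ht)
  have hcd : ContinuousOn (deriv ρ) (Ioo 0 1) :=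
    (h.mono Ioo_subset_Icc_self).continuousOn_deriv_of_isOpen isOpen_Ioo le_rfl
  have hcρ : ContinuousOn ρ (Ioo 0 1) := h.continuousOn.mono Ioo_subset_Icc_self
  -- On the open interval ψ is continuous, since `invB` is continuous on a fixed support; elsewhere
  -- it is zero.
  have hmeas : Measurable ψ := by
    refine ContinuousOn.measurable_piecewise ?_ continuousOn_const measurableSet_Ioo
    exact ((contDiffOn_invB hK hθ hσ hθ.contDiffOn).continuousOn.comp hcρ hs).clm_apply hcd
  refine ⟨ψ, ⟨piecewiseC1_of_contDiffOn h, rfl, rfl, hd, hmeas, ?_⟩, ?_⟩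
  · refine (ae_restrict_iff' measurableSet_Ioo).2 (Filter.Eventually.of_forall fun t ht x => ?_)
    have h1 : HasDerivAt ρ (deriv ρ t) t :=
      ((h.differentiableOn one_ne_zero).differentiableAt (Icc_mem_nhds ht.1 ht.2)).hasDerivAt
    have h2 := hasDerivAt_pi.1 h1 x
    rw [← hψ t ht] at h2
    refine h2.congr_deriv ?_
    simp only [B, LinearMap.coe_mk, AddHom.coe_mk]
    rw [← Finset.sum_neg_distrib]
    exact Finset.sum_congr rfl fun y _ => by ring
  · rw [action, ← restrict_Ioo_eq_restrict_Icc]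
    calc _ ≤ ∫⁻ t in Ioo (0 : ℝ) 1, ENNReal.ofReal (A ^ 2) := by
          refine setLIntegral_mono' measurableSet_Ioo fun t ht => ENNReal.ofReal_le_ofReal ?_
          refine gradInner_le_of_pair_sq_le hK hθ (hs t ht).1 (sq_nonneg A) ?_
          rw [hψ t ht]
          exact bound t ht _
      _ = _ := by simp

theorem W_le_of_curve (hK : IsReversibleMarkov K μ) (hθ : IsAdmissible θ) {σ : X → ℝ}
    (hσ : ∀ x, 0 ≤ σ x) {ρ₀ ρ₁ : Density μ} {ρ : ℝ → X → ℝ} {a b : ℝ} (hab : a ≤ b)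
    (h : ContDiffOn ℝ 1 ρ (Icc a b)) (ha : ρ a = ρ₀) (hb : ρ b = ρ₁)
    (hd : ∀ t ∈ Icc a b, IsDensity μ (ρ t)) (hs : ∀ t ∈ Ioo a b, ρ t ∈ sameSupport σ)
    {A : ℝ} (hA : 0 ≤ A) (bound : ∀ t ∈ Ioo a b, ∀ φ,
      pair μ φ (deriv ρ t) ^ 2 ≤ A ^ 2 * gradInner K μ θ (ρ t) φ φ) :
    W K μ θ ρ₀ ρ₁ ≤ ENNReal.ofReal ((b - a) * A) := by
  rcases hab.eq_or_lt with rfl | hab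
  · have h01 : ρ₀.val = ρ₁.val := ha.symm.trans hb
    obtain ⟨ψ, h1, h2⟩ := exists_isCE_of_curve (A := 0) hK hθ ρ₀.isDensity.1
      (ρ := fun _ => ρ₀.val) contDiffOn_const (fun _ _ => ρ₀.isDensity)
      (fun _ _ => sameSupport_self ρ₀.isDensity.1) (fun t _ φ => by simp [pair])
    have h1' : IsCE K μ θ ρ₀ ρ₁ (fun _ => ρ₀.val) ψ := by rw [← h01]; exact h1
    refine W_le_of_isCE h1' (h2.trans ?_)
    simp
  have hba : 0 < b - a := sub_pos.2 hab
  let f : ℝ → ℝ := fun s => a + (b - a) * s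
  have hf : ∀ s, HasDerivAt f (b - a) s := fun s => by
    have := ((hasDerivAt_id s).const_mul (b - a)).const_add a
    rwa [mul_one] at this
  have hf1 : ∀ s ∈ Icc (0 : ℝ) 1, f s ∈ Icc a b := fun s hs => by
    have h1 := mul_nonneg hba.le hs.1
    have h2 := mul_le_mul_of_nonneg_left hs.2 hba.le
    exact ⟨by simp only [f]; linarith, by simp only [f]; linarith⟩
  have hf2 : ∀ s ∈ Ioo (0 : ℝ) 1, f s ∈ Ioo a b := fun s hs => by
    have h1 := mul_pos hba hs.1
    have h2 := mul_lt_mul_of_pos_left hs.2 hba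
    exact ⟨by simp only [f]; linarith, by simp only [f]; linarith⟩
  have hderiv : ∀ s ∈ Ioo (0 : ℝ) 1, deriv (ρ ∘ f) s = (b - a) • deriv ρ (f s) := fun s hs => by
    have h1 : HasDerivAt ρ (deriv ρ (f s)) (f s) :=
      ((h.differentiableOn one_ne_zero).differentiableAt
        (Icc_mem_nhds (hf2 s hs).1 (hf2 s hs).2)).hasDerivAt
    exact (h1.scomp s (hf s)).deriv
  obtain ⟨ψ, h1, h2⟩ := exists_isCE_of_curve (A := (b - a) * A) hK hθ hσ (ρ := ρ ∘ f)
    (h.comp (by fun_prop) hf1) (fun s hs => hd _ (hf1 s hs)) (fun s h' => hs _ (hf2 s h'))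
    (fun s h' φ => by
      rw [hderiv s h', pair_smul_right, mul_pow, mul_pow, mul_assoc]
      exact mul_le_mul_of_nonneg_left (bound _ (hf2 s h') φ) (sq_nonneg _))
  have e0 : (ρ ∘ f) 0 = ρ₀ := by simp [f, ha]
  have e1 : (ρ ∘ f) 1 = ρ₁ := by simp [f, hb]
  rw [e0, e1] at h1
  refine W_le_of_isCE h1 (h2.trans_eq ?_)
  rw [ENNReal.ofReal_pow (mul_nonneg hba.le hA)]

theorem W_self (hK : IsReversibleMarkov K μ) (hθ : IsAdmissible θ) (ρ : Density μ) :
    W K μ θ ρ ρ = 0 := by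
  have := W_le_of_curve (a := 0) (b := 0) (A := 0) (ρ₀ := ρ) (ρ₁ := ρ) hK hθ ρ.isDensity.1 le_rfl
    (ρ := fun _ => ρ.val) contDiffOn_const rfl rfl (fun _ _ => ρ.isDensity)
    (fun _ _ => sameSupport_self ρ.isDensity.1) le_rfl (fun t _ φ => by simp [pair])
  simpa using this

/-! ### The integrals `∫₀ᶜ θ(r, M)^(-1/2) dr` -/

/-- The integral `∫_a^b θ(r, M)^(-1/2) dr`. -/
def cost (θ : ℝ → ℝ → ℝ) (M a b : ℝ) : ℝ≥0∞ :=
  ∫⁻ r in Ioc a b, ENNReal.ofReal (1 / √(θ r M))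

/-- Monotonicity replaces (r, M') by (2^k r, 2^k M), and the doubling property is then undone k
times. -/
theorem IsAdmissible.exists_le_mul (hθ : IsAdmissible θ) {M M' c : ℝ} (hM : 0 < M) (hc : 0 < c) :
    ∃ C > 0, ∀ r, 0 < r → r ≤ c → 0 ≤ M' → θ r M' ≤ C * θ r M := by
  obtain ⟨k, hk⟩ : ∃ k : ℕ, M' / M < 2 ^ k := pow_unbounded_of_one_lt _ one_lt_two
  have hk' : M' ≤ 2 ^ k * M := ((div_lt_iff₀ hM).1 hk).le
  -- The bound T is large enough for all the arguments 2^j r and 2^j M with j ≤ k.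
  obtain ⟨C, hC, h⟩ := hθ.doubling (2 ^ k * max c M) (by positivity)
  refine ⟨(2 * C) ^ k, by positivity, fun r hr hrc hM' => ?_⟩
  have key : ∀ j ≤ k, θ (2 ^ j * r) (2 ^ j * M) ≤ (2 * C) ^ j * θ r M := by
    intro j
    induction j with
    | zero => intro; simp
    | succ j ih =>
      intro hj
      have h2 : (2 : ℝ) ^ j ≤ 2 ^ k := pow_le_pow_right₀ one_le_two (by omega)
      have h1 := h (2 ^ j * r) (2 ^ j * M) (by positivity)
        (mul_le_mul h2 (hrc.trans (le_max_left _ _)) hr.le (by positivity)) (by positivity)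
        (mul_le_mul h2 (le_max_right _ _) hM.le (by positivity))
      calc θ (2 ^ (j + 1) * r) (2 ^ (j + 1) * M) = θ (2 * (2 ^ j * r)) (2 * (2 ^ j * M)) := by
            rw [pow_succ', mul_assoc, mul_assoc]
        _ ≤ 2 * C * θ (2 ^ j * r) (2 ^ j * M) := h1
        _ ≤ 2 * C * ((2 * C) ^ j * θ r M) :=
            mul_le_mul_of_nonneg_left (ih (by omega)) (by positivity)
        _ = _ := by ring
  refine (hθ.mono₂ hr.le ?_ hM' hk').trans (key k le_rfl)
  exact le_mul_of_one_le_left hr.le (one_le_pow₀ one_le_two)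

theorem one_div_sqrt_le {a b C : ℝ} (ha : 0 < a) (hb : 0 < b) (h : b ≤ C * a) :
    1 / √a ≤ √C * (1 / √b) := by
  have hC : 0 ≤ C := by
    by_contra hC
    exact absurd (hb.trans_le h) (not_lt.2 (mul_nonpos_of_nonpos_of_nonneg (not_le.1 hC).le ha.le))
  rw [mul_one_div, div_le_div_iff₀ (Real.sqrt_pos.2 ha) (Real.sqrt_pos.2 hb), one_mul,
    ← Real.sqrt_mul hC]
  exact Real.sqrt_le_sqrt h

/-- Near zero the two integrands are comparable by `exists_le_mul`; beyond c the integrand is at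
most θ(c, M')^(-1/2). Thus finiteness is a property of θ alone. -/
theorem cost_transfer (hθ : IsAdmissible θ) {M M' c c' : ℝ} (hM : 0 < M) (hM' : 0 < M')
    (hc : 0 < c) (h : cost θ M 0 c < ⊤) : cost θ M' 0 c' < ⊤ := by
  obtain ⟨C, hC, hle⟩ := hθ.exists_le_mul (M' := M) hM' hc
  have h1 : cost θ M' 0 c < ⊤ := by
    calc cost θ M' 0 c ≤ ∫⁻ r in Ioc 0 c, ENNReal.ofReal √C * ENNReal.ofReal (1 / √(θ r M)) := by
          refine setLIntegral_mono' measurableSet_Ioc fun r hr => ?_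
          rw [← ENNReal.ofReal_mul (Real.sqrt_nonneg _)]
          exact ENNReal.ofReal_le_ofReal (one_div_sqrt_le (hθ.pos _ _ hr.1 hM') (hθ.pos _ _ hr.1 hM)
            (hle r hr.1 hr.2 hM.le))
      _ = ENNReal.ofReal √C * cost θ M 0 c := lintegral_const_mul' _ _ ENNReal.ofReal_ne_top
      _ < ⊤ := ENNReal.mul_lt_top ENNReal.ofReal_lt_top h
  have h2 : cost θ M' c c' < ⊤ := by
    calc cost θ M' c c' ≤ ∫⁻ r in Ioc c c', ENNReal.ofReal (1 / √(θ c M')) := by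
          refine setLIntegral_mono' measurableSet_Ioc fun r hr => ENNReal.ofReal_le_ofReal ?_
          exact one_div_le_one_div_of_le (Real.sqrt_pos.2 (hθ.pos _ _ hc hM'))
            (Real.sqrt_le_sqrt (hθ.mono _ _ _ hc.le hr.1.le hM'.le))
      _ < ⊤ := by
          rw [setLIntegral_const]
          exact ENNReal.mul_lt_top ENNReal.ofReal_lt_top (by simp)
  calc cost θ M' 0 c' ≤ cost θ M' 0 c + cost θ M' c c' :=
        (lintegral_mono_set (fun r hr => (le_or_gt r c).imp (fun h => ⟨hr.1, h⟩)
          fun h => ⟨h, hr.2⟩)).trans (lintegral_union_le _ _ _)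
    _ < ⊤ := ENNReal.add_lt_top.2 ⟨h1, h2⟩

/-- Reflection r ↦ 1 - r. The second argument now lies between 1 and 2, so C_θ is squeezed between
the costs for M = 2 and M = 1. -/
theorem Cθ_eq (θ : ℝ → ℝ → ℝ) :
    Cθ θ = ∫⁻ r in Ioo (0 : ℝ) 1, ENNReal.ofReal (1 / √(θ r (2 - r))) := by
  rw [Cθ, ← lintegral_indicator measurableSet_Ioo, ← lintegral_indicator measurableSet_Ioo,
    ← lintegral_sub_left_eq_self _ 1]
  congr 1
  funext r
  by_cases hr : r ∈ Ioo (0 : ℝ) 1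
  · have hr' : 1 - r ∈ Ioo (0 : ℝ) 1 := ⟨by linarith [hr.2], by linarith [hr.1]⟩
    rw [indicator_of_mem hr', indicator_of_mem hr]
    rw [sub_sub_cancel, show 1 + (1 - r) = 2 - r by ring]
  · have hr' : 1 - r ∉ Ioo (0 : ℝ) 1 := fun h => hr ⟨by linarith [h.2], by linarith [h.1]⟩
    rw [indicator_of_notMem hr', indicator_of_notMem hr]

theorem cost_lt_top (hθ : IsAdmissible θ) (h : Cθ θ < ⊤) {M : ℝ} (hM : 0 < M) (c : ℝ) :
    cost θ M 0 c < ⊤ := by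
  refine cost_transfer hθ (M := 2) (c := 1) two_pos hM one_pos (lt_of_le_of_lt ?_ h)
  rw [Cθ_eq, cost, ← restrict_Ioo_eq_restrict_Ioc]
  refine setLIntegral_mono' measurableSet_Ioo fun r hr => ENNReal.ofReal_le_ofReal ?_
  have h2 : 0 < 2 - r := by linarith [hr.2]
  exact one_div_le_one_div_of_le (Real.sqrt_pos.2 (hθ.pos _ _ hr.1 h2)) (Real.sqrt_le_sqrt
    (hθ.mono₂ hr.1.le le_rfl h2.le (by linarith [hr.1])))

theorem cost_eq_top (hθ : IsAdmissible θ) (h : Cθ θ = ⊤) {M c : ℝ} (hM : 0 < M) (hc : 0 < c) :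
    cost θ M 0 c = ⊤ := by
  by_contra hne
  have h1 := cost_transfer hθ (M' := 1) (c' := 1) hM one_pos hc (lt_top_iff_ne_top.2 hne)
  refine (lt_of_le_of_lt ?_ h1).ne h
  rw [Cθ_eq, cost, ← restrict_Ioo_eq_restrict_Ioc]
  refine setLIntegral_mono' measurableSet_Ioo fun r hr => ENNReal.ofReal_le_ofReal ?_
  exact one_div_le_one_div_of_le (Real.sqrt_pos.2 (hθ.pos _ _ hr.1 one_pos)) (Real.sqrt_le_sqrt
    (hθ.mono₂ hr.1.le le_rfl zero_le_one (by linarith [hr.2])))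

/-! ### Lower bounds along solutions of the continuity equation -/

theorem lintegral_Icc_le_sqrt (f : ℝ → ℝ≥0∞) :
    ∫⁻ t in Icc (0 : ℝ) 1, f t ≤ (∫⁻ t in Icc (0 : ℝ) 1, f t ^ 2) ^ (1 / 2 : ℝ) := by
  -- The function f is not assumed measurable; a measurable minorant with the same integral suffices
  -- for Cauchy–Schwarz.
  obtain ⟨g, hg, hgf, hfg⟩ := exists_measurable_le_lintegral_eq (volume.restrict (Icc (0 : ℝ) 1)) f
  rw [hfg]
  have h := ENNReal.lintegral_mul_le_Lp_mul_Lq (volume.restrict (Icc (0 : ℝ) 1))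
    Real.HolderConjugate.two_two hg.aemeasurable (aemeasurable_const (b := (1 : ℝ≥0∞)))
  simp only [Pi.mul_apply, mul_one, ENNReal.one_rpow, lintegral_const, Measure.restrict_apply,
    MeasurableSet.univ, univ_inter, Real.volume_Icc, sub_zero, ENNReal.ofReal_one] at h
  refine h.trans (ENNReal.rpow_le_rpow (lintegral_mono fun t => ?_) (by norm_num))
  simp only [ENNReal.rpow_ofNat]
  exact pow_le_pow_left' (hgf t) 2

theorem PiecewiseC1.enorm_sub_le {ρ : ℝ → X → ℝ} (h : PiecewiseC1 ρ) {g : (X → ℝ) → ℝ}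
    (hg : ContDiff ℝ 1 g) {a b : ℝ} (ha : 0 ≤ a) (hab : a ≤ b) (hb : b ≤ 1) :
    ‖g (ρ b) - g (ρ a)‖ₑ ≤ ∫⁻ t in Icc a b, ‖deriv (fun t => g (ρ t)) t‖ₑ := by
  obtain ⟨n, τ, hτ, h0, h1, hρ⟩ := h
  -- The partition clipped to [a, b]. A clipped interval is either a single point, or is contained
  -- in the corresponding interval of the partition.
  let c : ℕ → ℝ := fun i => max a (min b (τ i))
  have hc : Monotone c := fun i j hij => max_le_max_left _ (min_le_min_left _ (hτ hij))
  have key : ∀ i ≤ n, ‖g (ρ (c i)) - g (ρ (c 0))‖ₑ ≤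
      ∫⁻ t in Icc (c 0) (c i), ‖deriv (fun t => g (ρ t)) t‖ₑ := by
    intro i
    induction i with
    | zero => simp
    | succ i ih =>
      intro hi
      have h2 : ‖g (ρ (c (i + 1))) - g (ρ (c i))‖ₑ ≤
          ∫⁻ t in Icc (c i) (c (i + 1)), ‖deriv (fun t => g (ρ t)) t‖ₑ := by
        rcases (hc (Nat.le_succ i)).eq_or_lt with he | hlt
        · rw [← Nat.succ_eq_add_one, ← he]; simp
        · refine enorm_sub_le_lintegral_deriv_of_contDiffOn_Icc ?_ hlt.le
          refine hg.comp_contDiffOn ((hρ i (by omega)).mono ?_)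
          have h3 : τ i ≤ c i := by
            by_contra h4
            push Not at h4
            have : c (i + 1) ≤ c i := by
              simp only [c] at h4 ⊢
              have : b < τ i := by
                by_contra h5
                rw [min_eq_right (not_lt.1 h5)] at h4
                exact absurd (le_max_right a (τ i)) (not_le.2 h4)
              rw [min_eq_left this.le]
              exact max_le (le_max_left _ _) ((min_le_left _ _).trans (le_max_right _ _))
            exact absurd this (not_le.2 hlt)
          have h3' : c (i + 1) ≤ τ (i + 1) := by
            by_contra h4
            push Not at h4
            have : c (i + 1) ≤ c i := by
              simp only [c] at h4 ⊢
              refine max_le (le_max_left _ _) ?_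
              rcases lt_max_iff.1 h4 with h5 | h5
              · exact (min_le_right _ _).trans (h5.le.trans (le_max_left _ _))
              · exact absurd (min_le_right b (τ (i + 1))) (not_le.2 h5)
            exact absurd this (not_le.2 hlt)
          exact Icc_subset_Icc h3 h3'
      calc ‖g (ρ (c (i + 1))) - g (ρ (c 0))‖ₑ
          = ‖(g (ρ (c (i + 1))) - g (ρ (c i))) + (g (ρ (c i)) - g (ρ (c 0)))‖ₑ := by
            rw [sub_add_sub_cancel]
        _ ≤ _ := enorm_add_le _ _
        _ ≤ _ := add_le_add h2 (ih (by omega))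
        _ = _ := by
            rw [← restrict_Ioc_eq_restrict_Icc, ← restrict_Ioc_eq_restrict_Icc,
              ← restrict_Ioc_eq_restrict_Icc, add_comm, ← lintegral_union measurableSet_Ioc
              (Ioc_disjoint_Ioc_of_le le_rfl), Ioc_union_Ioc_eq_Ioc (hc (Nat.zero_le i))
              (hc (Nat.le_succ i))]
  have e0 : c 0 = a := by simp only [c, h0]; rw [min_eq_right (ha.trans hab), max_eq_left ha]
  have e1 : c n = b := by simp only [c, h1]; rw [min_eq_left hb, max_eq_right hab]
  have := key n le_rfl
  rwa [e0, e1] at this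

theorem IsCE.ae_hasDerivAt {ρ₀ ρ₁ : X → ℝ} {ρ ψ : ℝ → X → ℝ} (h : IsCE K μ θ ρ₀ ρ₁ ρ ψ) :
    ∀ᵐ t ∂(volume.restrict (Ioo (0 : ℝ) 1)), HasDerivAt ρ (B K θ (ρ t) (ψ t)) t := by
  filter_upwards [h.continuity_eq] with t ht
  refine hasDerivAt_pi.2 fun x => (ht x).congr_deriv ?_
  simp only [B, LinearMap.coe_mk, AddHom.coe_mk]
  rw [← Finset.sum_neg_distrib]
  exact Finset.sum_congr rfl fun y _ => by ring

/-- The source of all lower bounds: the derivative of g along the curve is at most |C| ‖∇ψ‖_ρ, and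
Cauchy–Schwarz in time turns the length into the root of the action. -/
theorem IsCE.enorm_sub_le {ρ₀ ρ₁ : X → ℝ} {ρ ψ : ℝ → X → ℝ} (h : IsCE K μ θ ρ₀ ρ₁ ρ ψ)
    {g : (X → ℝ) → ℝ} (hg : ContDiff ℝ 1 g) {C : ℝ}
    (hbound : ∀ t ∈ Ioo (0 : ℝ) 1, ∀ ψ, fderiv ℝ g (ρ t) (B K θ (ρ t) ψ) ^ 2 ≤
      C ^ 2 * gradInner K μ θ (ρ t) ψ ψ)
    {a b : ℝ} (ha : 0 ≤ a) (hab : a ≤ b) (hb : b ≤ 1) :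
    ‖g (ρ b) - g (ρ a)‖ₑ ≤ ENNReal.ofReal |C| * action K μ θ ρ ψ ^ (1 / 2 : ℝ) := by
  refine (h.piecewiseC1.enorm_sub_le hg ha hab hb).trans ?_
  refine (lintegral_mono_set (Icc_subset_Icc ha hb)).trans ?_
  calc ∫⁻ t in Icc (0 : ℝ) 1, ‖deriv (fun t => g (ρ t)) t‖ₑ
      ≤ ∫⁻ t in Icc (0 : ℝ) 1, ENNReal.ofReal |C| *
          ENNReal.ofReal √(gradInner K μ θ (ρ t) (ψ t) (ψ t)) := by
        rw [← restrict_Ioo_eq_restrict_Icc]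
        refine lintegral_mono_ae ?_
        filter_upwards [h.ae_hasDerivAt, ae_restrict_mem measurableSet_Ioo] with t ht htm
        have h1 : deriv (fun t => g (ρ t)) t = fderiv ℝ g (ρ t) (B K θ (ρ t) (ψ t)) :=
          ((hg.differentiable one_ne_zero (ρ t)).hasFDerivAt.comp_hasDerivAt t ht).deriv
        rw [h1, ← ENNReal.ofReal_mul (abs_nonneg _), Real.enorm_eq_ofReal_abs]
        refine ENNReal.ofReal_le_ofReal ?_
        rw [← Real.sqrt_sq_eq_abs, ← Real.sqrt_sq_eq_abs, ← Real.sqrt_mul (sq_nonneg _)]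
        exact Real.sqrt_le_sqrt (hbound t htm _)
    _ = ENNReal.ofReal |C| * ∫⁻ t in Icc (0 : ℝ) 1,
          ENNReal.ofReal √(gradInner K μ θ (ρ t) (ψ t) (ψ t)) :=
        lintegral_const_mul' _ _ ENNReal.ofReal_ne_top
    _ ≤ _ := by
        gcongr
        refine (lintegral_Icc_le_sqrt _).trans (ENNReal.rpow_le_rpow ?_ (by norm_num))
        refine lintegral_mono fun t => ?_
        rw [← ENNReal.ofReal_pow (Real.sqrt_nonneg _)]
        rcases le_total 0 (gradInner K μ θ (ρ t) (ψ t) (ψ t)) with h0 | h0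
        · rw [Real.sq_sqrt h0]
        · rw [Real.sqrt_eq_zero_of_nonpos h0]; simp

/-- An upper bound for all probability densities. -/
def densityBound (μ : X → ℝ) : ℝ := ∑ x, (μ x)⁻¹

theorem densityBound_pos (hK : IsReversibleMarkov K μ) : 0 < densityBound μ :=
  have := hK.nonempty
  Finset.sum_pos (fun x _ => inv_pos.2 (hK.pos x)) Finset.univ_nonempty

theorem IsDensity.le_bound (hK : IsReversibleMarkov K μ) {ρ : X → ℝ} (h : IsDensity μ ρ) (x : X) :
    ρ x ≤ densityBound μ := by
  have h1 : μ x * ρ x ≤ 1 := h.2 ▸ Finset.single_le_sum (f := fun x => μ x * ρ x)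
    (fun y _ => mul_nonneg (hK.pos y).le (h.1 y)) (Finset.mem_univ x)
  have h2 : ρ x ≤ (μ x)⁻¹ := by
    rw [← one_div, le_div_iff₀ (hK.pos x)]; linarith
  exact h2.trans (Finset.single_le_sum (f := fun x => (μ x)⁻¹)
    (fun y _ => (inv_pos.2 (hK.pos y)).le) (Finset.mem_univ x))

/-- Test with the normalized indicator of x; its energy is small because all other values are at
most `densityBound μ` and the rows of K sum to 1. The factor θ(ρ(x), ·), which vanishes with ρ(x),
is what creates the barrier at zero. -/
theorem B_apply_sq_le (hK : IsReversibleMarkov K μ) (hθ : IsAdmissible θ) {ρ : X → ℝ}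
    (h : IsDensity μ ρ) (ψ : X → ℝ) (x : X) :
    B K θ ρ ψ x ^ 2 ≤ θ (ρ x) (densityBound μ) * (μ x)⁻¹ * gradInner K μ θ ρ ψ ψ := by
  classical
  let φ : X → ℝ := Pi.single x (μ x)⁻¹
  have hpair : ∀ u, pair μ φ u = u x := fun u => by
    rw [pair, Finset.sum_eq_single x]
    · simp [φ, (hK.pos x).ne']
    · intro b _ hb; simp [φ, hb]
    · simp
  have h1 := pair_B_sq_le hK hθ h.1 φ ψ
  rw [hpair, mul_comm] at h1
  refine h1.trans (mul_le_mul_of_nonneg_right ?_ (gradInner_self_nonneg hK hθ h.1 ψ))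
  rw [← pair_B hK hθ h.1, hpair]
  have hx := hK.pos x
  calc B K θ ρ φ x ≤ ∑ y, K x y * (θ (ρ x) (densityBound μ) * (μ x)⁻¹) := by
        simp only [B, LinearMap.coe_mk, AddHom.coe_mk]
        refine Finset.sum_le_sum fun y _ => ?_
        rw [mul_assoc]
        refine mul_le_mul_of_nonneg_left ?_ (hK.nonneg x y)
        have h2 : φ x - φ y ≤ (μ x)⁻¹ := by
          simp only [φ, Pi.single_eq_same, sub_le_self_iff]
          by_cases hy : y = x
          · subst hy; simp [hx.le]
          · simp [hy]
        exact (mul_le_mul_of_nonneg_left h2 (hθ.nonneg _ _ (h.1 x) (h.1 y))).trans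
          (mul_le_mul_of_nonneg_right (hθ.mono₂ (h.1 x) le_rfl (h.1 y) (h.le_bound hK y))
            (inv_pos.2 hx).le)
    _ = _ := by rw [← Finset.sum_mul, hK.row_sum, one_mul]

/-- The total variation of a coordinate is controlled by the action. -/
theorem IsCE.enorm_apply_sub_le (hK : IsReversibleMarkov K μ) (hθ : IsAdmissible θ)
    {ρ₀ ρ₁ : X → ℝ} {ρ ψ : ℝ → X → ℝ} (h : IsCE K μ θ ρ₀ ρ₁ ρ ψ) (x : X) :
    ‖ρ₁ x - ρ₀ x‖ₑ ≤ ENNReal.ofReal |√(θ (densityBound μ) (densityBound μ) * (μ x)⁻¹)| *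
      action K μ θ ρ ψ ^ (1 / 2 : ℝ) := by
  have hM := densityBound_pos hK
  have := h.enorm_sub_le (g := fun ρ => ρ x) (contDiff_apply ℝ ℝ x)
    (C := √(θ (densityBound μ) (densityBound μ) * (μ x)⁻¹)) ?_ le_rfl zero_le_one le_rfl
  · rwa [h.init, h.final] at this
  · intro t ht ψ
    have hd := h.density t (Ioo_subset_Icc_self ht)
    have h1 : fderiv ℝ (fun ρ : X → ℝ => ρ x) (ρ t) = ContinuousLinearMap.proj x :=
      (ContinuousLinearMap.proj (R := ℝ) (φ := fun _ : X => ℝ) x).fderiv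
    rw [h1, Real.sq_sqrt (mul_nonneg (hθ.nonneg _ _ hM.le hM.le) (inv_pos.2 (hK.pos x)).le)]
    refine (B_apply_sq_le hK hθ hd ψ x).trans ?_
    refine mul_le_mul_of_nonneg_right ?_ (gradInner_self_nonneg hK hθ hd.1 ψ)
    exact mul_le_mul_of_nonneg_right (hθ.mono _ _ _ (hd.1 x) (hd.le_bound hK x) hM.le)
      (inv_pos.2 (hK.pos x)).le

theorem exists_enorm_apply_sub_le_W (hK : IsReversibleMarkov K μ) (hθ : IsAdmissible θ) :
    ∃ C : ℝ≥0∞, C ≠ ⊤ ∧ ∀ (ρ₀ ρ₁ : Density μ) (x : X), ‖ρ₁ x - ρ₀ x‖ₑ ≤ C * W K μ θ ρ₀ ρ₁ := by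
  refine ⟨∑ x, ENNReal.ofReal |√(θ (densityBound μ) (densityBound μ) * (μ x)⁻¹)|,
    ENNReal.sum_ne_top.2 fun x _ => ENNReal.ofReal_ne_top, fun ρ₀ ρ₁ x => ?_⟩
  set C := ∑ x, ENNReal.ofReal |√(θ (densityBound μ) (densityBound μ) * (μ x)⁻¹)|
  have hCtop : C ≠ ⊤ := ENNReal.sum_ne_top.2 fun x _ => ENNReal.ofReal_ne_top
  refine le_of_forall_gt_imp_ge_of_dense fun r hr => ?_
  have hcases : ∀ c, W K μ θ ρ₀ ρ₁ < c → ‖ρ₁ x - ρ₀ x‖ₑ ≤ C * c := fun c hc => by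
    obtain ⟨ρ, ψ, h, ha⟩ := exists_isCE_of_W_lt hc
    refine (h.enorm_apply_sub_le hK hθ x).trans (mul_le_mul' ?_ ?_)
    · exact Finset.single_le_sum (f := fun x => ENNReal.ofReal
        |√(θ (densityBound μ) (densityBound μ) * (μ x)⁻¹)|) (fun _ _ => zero_le) (Finset.mem_univ x)
    · refine (ENNReal.rpow_le_rpow ha.le (by norm_num : (0 : ℝ) ≤ 1 / 2)).trans_eq ?_
      rw [← ENNReal.rpow_natCast, ← ENNReal.rpow_mul]; norm_num
  -- If 𝒲 = ∞, the right side is infinite since C ≠ 0; otherwise let c decrease to 𝒲.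
  rcases eq_or_ne (W K μ θ ρ₀ ρ₁) ⊤ with hW | hW
  · rcases eq_or_ne C 0 with h0 | h0
    · have : (∀ x, √(θ (densityBound μ) (densityBound μ) * (μ x)⁻¹) = 0) := fun x => by
        have := (Finset.sum_eq_zero_iff.1 h0) x (Finset.mem_univ x)
        simpa using this
      have h2 := hθ.pos _ _ (densityBound_pos hK) (densityBound_pos hK)
      have h3 := mul_pos h2 (inv_pos.2 (hK.pos x))
      exact absurd (this x) (Real.sqrt_pos.2 h3).ne'
    · rw [hW, ENNReal.mul_top h0] at hr
      exact absurd hr not_top_lt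
  · have hlim : Filter.Tendsto (fun c => C * c) (𝓝[>] (W K μ θ ρ₀ ρ₁))
        (𝓝 (C * W K μ θ ρ₀ ρ₁)) :=
      (ENNReal.Tendsto.const_mul Filter.tendsto_id (Or.inr hCtop)).mono_left nhdsWithin_le_nhds
    have hne : (𝓝[>] (W K μ θ ρ₀ ρ₁)).NeBot := nhdsGT_neBot_of_exists_gt ⟨⊤, lt_top_iff_ne_top.2 hW⟩
    obtain ⟨c, hc1, hc2⟩ := ((hlim.eventually (gt_mem_nhds hr)).and self_mem_nhdsWithin).exists
    exact (hcases c hc2).trans hc1.le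

/-! ### The barrier at the boundary, and conserved quantities -/

theorem continuous_barrier_integrand (hθ : IsAdmissible θ) {M : ℝ} (hM : 0 ≤ M) {δ : ℝ}
    (hδ : 0 < δ) : Continuous fun r => 1 / √(θ (max r 0) M + δ) := by
  have h1 : Continuous fun r => θ (max r 0) M := by
    have := hθ.continuous_clamp.comp (f := fun r : ℝ => (r, M)) (by fun_prop)
    simpa [Function.comp_def, max_eq_left hM] using this
  refine Continuous.div continuous_const
    (Real.continuous_sqrt.comp (h1.add continuous_const)) fun r => ?_
  have := hθ.nonneg (max r 0) M (le_max_right _ _) hM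
  exact (Real.sqrt_pos.2 (by linarith)).ne'

/-- The observable is a primitive of (θ(·, M) + δ)^(-1/2) in the coordinate x. Adding δ makes it C¹
up to zero, and the square of its derivative absorbs the factor θ(ρ(x), M) in `B_apply_sq_le`, so
the bound does not depend on δ. -/
theorem IsCE.barrier_aux (hK : IsReversibleMarkov K μ) (hθ : IsAdmissible θ)
    {ρ₀ ρ₁ : X → ℝ} {ρ ψ : ℝ → X → ℝ} (h : IsCE K μ θ ρ₀ ρ₁ ρ ψ) (x : X) {a b : ℝ} (ha : 0 ≤ a)
    (hab : a ≤ b) (hb : b ≤ 1) {δ : ℝ} (hδ : 0 < δ) :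
    ∫⁻ r in uIoc (ρ a x) (ρ b x), ENNReal.ofReal (1 / √(θ (max r 0) (densityBound μ) + δ)) ≤
      ENNReal.ofReal |√(μ x)⁻¹| * action K μ θ ρ ψ ^ (1 / 2 : ℝ) := by
  have hM := densityBound_pos hK
  set f : ℝ → ℝ := fun r => 1 / √(θ (max r 0) (densityBound μ) + δ) with hf
  have hfc : Continuous f := continuous_barrier_integrand hθ hM.le hδ
  have hf0 : ∀ r, 0 ≤ f r := fun r => one_div_nonneg.2 (Real.sqrt_nonneg _)
  let F : ℝ → ℝ := fun s => ∫ r in (0 : ℝ)..s, f r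
  have hF : ∀ s, HasDerivAt F (f s) s := fun s => hfc.integral_hasStrictDerivAt 0 s |>.hasDerivAt
  have hFc : ContDiff ℝ 1 F := contDiff_one_iff_deriv.2
    ⟨fun s => (hF s).differentiableAt, by simpa only [(funext fun s => (hF s).deriv)] using hfc⟩
  have key := h.enorm_sub_le (g := fun ρ => F (ρ x)) (hFc.comp (contDiff_apply ℝ ℝ x))
    (C := √(μ x)⁻¹) ?_ ha hab hb
  · refine le_trans (le_of_eq ?_) key
    rw [← ofReal_integral_eq_lintegral_ofReal
      (hfc.intervalIntegrable _ _).def' (Filter.Eventually.of_forall hf0),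
      Real.enorm_eq_ofReal_abs]
    congr 1
    simp only [F]
    rw [intervalIntegral.integral_interval_sub_left (hfc.intervalIntegrable _ _)
      (hfc.intervalIntegrable _ _), intervalIntegral.abs_integral_eq_abs_integral_uIoc,
      abs_of_nonneg (integral_nonneg hf0)]
  · intro t ht ψ
    have hd := h.density t (Ioo_subset_Icc_self ht)
    have h1 : HasFDerivAt (fun ρ : X → ℝ => F (ρ x))
        (f (ρ t x) • (ContinuousLinearMap.proj (R := ℝ) (φ := fun _ : X => ℝ) x)) (ρ t) :=
      (hF _).comp_hasFDerivAt (ρ t)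
        (ContinuousLinearMap.proj (R := ℝ) (φ := fun _ : X => ℝ) x).hasFDerivAt
    rw [h1.fderiv, Real.sq_sqrt (inv_pos.2 (hK.pos x)).le]
    simp only [smul_apply, ContinuousLinearMap.proj_apply, smul_eq_mul, mul_pow]
    have hθ0 := hθ.nonneg (ρ t x) (densityBound μ) (hd.1 x) hM.le
    have h2 : f (ρ t x) ^ 2 = 1 / (θ (ρ t x) (densityBound μ) + δ) := by
      simp only [hf]
      rw [div_pow, one_pow, Real.sq_sqrt (by rw [max_eq_left (hd.1 x)]; linarith),
        max_eq_left (hd.1 x)]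
    rw [h2]
    have hQ := gradInner_self_nonneg hK hθ hd.1 ψ
    have hμ := inv_pos.2 (hK.pos x)
    calc _ ≤ 1 / (θ (ρ t x) (densityBound μ) + δ) * (θ (ρ t x) (densityBound μ) * (μ x)⁻¹ *
          gradInner K μ θ (ρ t) ψ ψ) :=
          mul_le_mul_of_nonneg_left (B_apply_sq_le hK hθ hd ψ x) (by positivity)
      _ = (θ (ρ t x) (densityBound μ) / (θ (ρ t x) (densityBound μ) + δ)) *
          ((μ x)⁻¹ * gradInner K μ θ (ρ t) ψ ψ) := by ring
      _ ≤ 1 * ((μ x)⁻¹ * gradInner K μ θ (ρ t) ψ ψ) := by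
          refine mul_le_mul_of_nonneg_right ?_ (by positivity)
          rw [div_le_one (by linarith)]; linarith
      _ = _ := one_mul _

/-- Fatou's lemma as δ → 0 in `barrier_aux`. The times may come in either order, which gives the
estimate for leaving zero as well as for reaching it. -/
theorem IsCE.cost_le (hK : IsReversibleMarkov K μ) (hθ : IsAdmissible θ)
    {ρ₀ ρ₁ : X → ℝ} {ρ ψ : ℝ → X → ℝ} (h : IsCE K μ θ ρ₀ ρ₁ ρ ψ) (x : X) {a b : ℝ}
    (ha : a ∈ Icc (0 : ℝ) 1) (hb : b ∈ Icc (0 : ℝ) 1) :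
    cost θ (densityBound μ) (ρ a x) (ρ b x) ≤
      ENNReal.ofReal |√(μ x)⁻¹| * action K μ θ ρ ψ ^ (1 / 2 : ℝ) := by
  have hM := densityBound_pos hK
  set M := densityBound μ
  have key : ∀ n : ℕ, ∫⁻ r in Ioc (ρ a x) (ρ b x),
      ENNReal.ofReal (1 / √(θ (max r 0) M + 1 / ((n : ℝ) + 1))) ≤
      ENNReal.ofReal |√(μ x)⁻¹| * action K μ θ ρ ψ ^ (1 / 2 : ℝ) := fun n => by
    have hδ : 0 < 1 / ((n : ℝ) + 1) := by positivity
    rcases le_total a b with hab | hab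
    · exact (lintegral_mono_set Ioc_subset_uIoc).trans (h.barrier_aux hK hθ x ha.1 hab hb.2 hδ)
    · exact (lintegral_mono_set (uIoc_comm (ρ b x) (ρ a x) ▸ Ioc_subset_uIoc)).trans
        (h.barrier_aux hK hθ x hb.1 hab ha.2 hδ)
  have hlim : ∀ r ∈ Ioc (ρ a x) (ρ b x), Filter.Tendsto (fun n : ℕ =>
      ENNReal.ofReal (1 / √(θ (max r 0) M + 1 / ((n : ℝ) + 1)))) Filter.atTop
      (𝓝 (ENNReal.ofReal (1 / √(θ r M)))) := fun r hr => by
    have hr0 : 0 < r := ((h.density a ha).1 x).trans_lt hr.1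
    rw [max_eq_left hr0.le]
    refine ENNReal.tendsto_ofReal ?_
    refine Filter.Tendsto.div tendsto_const_nhds ?_ (Real.sqrt_pos.2 (hθ.pos _ _ hr0 hM)).ne'
    refine (Real.continuous_sqrt.tendsto _).comp ?_
    simpa using (tendsto_one_div_add_atTop_nhds_zero_nat (𝕜 := ℝ)).const_add (θ r M)
  calc cost θ M (ρ a x) (ρ b x)
      = ∫⁻ r in Ioc (ρ a x) (ρ b x), Filter.liminf (fun n : ℕ =>
          ENNReal.ofReal (1 / √(θ (max r 0) M + 1 / ((n : ℝ) + 1)))) Filter.atTop :=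
        setLIntegral_congr_fun measurableSet_Ioc fun r hr => (hlim r hr).liminf_eq.symm
    _ ≤ _ := lintegral_liminf_le fun n => by
        exact (ENNReal.continuous_ofReal.comp
          (continuous_barrier_integrand hθ hM.le (by positivity))).measurable
    _ ≤ _ := Filter.liminf_le_of_le (by isBoundedDefault) fun c hc => by
        obtain ⟨n, hn⟩ := hc.exists
        exact hn.trans (key n)

theorem IsCE.pos_of_pos (hK : IsReversibleMarkov K μ) (hθ : IsAdmissible θ) (hC : Cθ θ = ⊤)
    {ρ₀ ρ₁ : X → ℝ} {ρ ψ : ℝ → X → ℝ} (h : IsCE K μ θ ρ₀ ρ₁ ρ ψ) (hA : action K μ θ ρ ψ < ⊤)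
    (x : X) {a b : ℝ} (ha : a ∈ Icc (0 : ℝ) 1) (hb : b ∈ Icc (0 : ℝ) 1) (hbx : 0 < ρ b x) :
    0 < ρ a x := by
  by_contra hax
  have ha0 : ρ a x = 0 := le_antisymm (not_lt.1 hax) ((h.density a ha).1 x)
  have h1 := h.cost_le hK hθ x ha hb
  rw [ha0, cost_eq_top hθ hC (densityBound_pos hK) hbx, top_le_iff] at h1
  exact ENNReal.mul_ne_top ENNReal.ofReal_ne_top
    (ENNReal.rpow_ne_top_of_nonneg (by norm_num) hA.ne) h1

theorem IsCE.mem_sameSupport (hK : IsReversibleMarkov K μ) (hθ : IsAdmissible θ) (hC : Cθ θ = ⊤)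
    {ρ₀ ρ₁ : X → ℝ} {ρ ψ : ℝ → X → ℝ} (h : IsCE K μ θ ρ₀ ρ₁ ρ ψ) (hA : action K μ θ ρ ψ < ⊤)
    {a b : ℝ} (ha : a ∈ Icc (0 : ℝ) 1) (hb : b ∈ Icc (0 : ℝ) 1) : ρ a ∈ sameSupport (ρ b) :=
  ⟨(h.density a ha).1, fun x => ⟨h.pos_of_pos hK hθ hC hA x hb ha,
    h.pos_of_pos hK hθ hC hA x ha hb⟩⟩

/-- Conservation laws: for φ in the kernel, ρ ↦ ⟨φ, ρ⟩ is an observable with constant C = 0. -/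
theorem IsCE.sub_mem_range (hK : IsReversibleMarkov K μ) (hθ : IsAdmissible θ) {σ : X → ℝ}
    (hσ : ∀ x, 0 ≤ σ x)
    {ρ₀ ρ₁ : X → ℝ} {ρ ψ : ℝ → X → ℝ} (h : IsCE K μ θ ρ₀ ρ₁ ρ ψ)
    (hs : ∀ t ∈ Ioo (0 : ℝ) 1, ρ t ∈ sameSupport σ)
    {a b : ℝ} (ha : 0 ≤ a) (hab : a ≤ b) (hb : b ≤ 1) :
    ρ b - ρ a ∈ LinearMap.range (B K θ σ) := by
  rw [mem_range_B_iff hK hθ hσ]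
  intro φ hφ
  let L : (X → ℝ) →L[ℝ] ℝ := ∑ x, (μ x * φ x) • ContinuousLinearMap.proj x
  have hL : ∀ u, L u = pair μ φ u := fun u => by simp [L, pair]
  have h1 := h.enorm_sub_le (g := L) L.contDiff (C := 0) (fun t ht ψ => by
    rw [L.fderiv, hL, pair_B_of_ker hK hθ (hs t ht).1
      ((B_eq_zero_iff_of_sameSupport hK hθ hσ (hs t ht) φ).2 hφ)]
    simp) ha hab hb
  simp only [abs_zero, ENNReal.ofReal_zero, zero_mul, nonpos_iff_eq_zero, enorm_eq_zero] at h1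
  rw [← hL, map_sub, h1]

/-- The component of `σ`: all densities with the same support and the same conserved quantities. -/
def component (K : Matrix X X ℝ) (μ : X → ℝ) (θ : ℝ → ℝ → ℝ) (σ : X → ℝ) : Set (Density μ) :=
  {ρ | ρ.val ∈ sameSupport σ ∧ ρ.val - σ ∈ LinearMap.range (B K θ σ)}

theorem mem_component_of_W_lt_top (hK : IsReversibleMarkov K μ) (hθ : IsAdmissible θ)
    (hC : Cθ θ = ⊤) {ρ σ : Density μ} (h : W K μ θ ρ σ < ⊤) : ρ ∈ component K μ θ σ := by
  obtain ⟨γ, ψ, hCE, hA⟩ := exists_isCE_of_W_lt h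
  have hA' : action K μ θ γ ψ < ⊤ := hA.trans_le le_top
  have h0 : (0 : ℝ) ∈ Icc (0 : ℝ) 1 := ⟨le_rfl, zero_le_one⟩
  have h1 : (1 : ℝ) ∈ Icc (0 : ℝ) 1 := ⟨zero_le_one, le_rfl⟩
  have hs : ∀ t ∈ Icc (0 : ℝ) 1, γ t ∈ sameSupport σ := fun t ht =>
    hCE.final ▸ hCE.mem_sameSupport hK hθ hC hA' ht h1
  refine ⟨hCE.init ▸ hs 0 h0, ?_⟩
  have := hCE.sub_mem_range hK hθ σ.isDensity.1 (fun t ht => hs t (Ioo_subset_Icc_self ht))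
    le_rfl zero_le_one le_rfl
  rw [hCE.init, hCE.final] at this
  rw [← neg_sub]
  exact neg_mem this

/-! ### Symmetry and the triangle inequality -/

theorem gradInner_smul_smul (ρ : X → ℝ) (c : ℝ) (φ ψ : X → ℝ) :
    gradInner K μ θ ρ (c • φ) (c • ψ) = c ^ 2 * gradInner K μ θ ρ φ ψ := by
  simp only [gradInner, Pi.smul_apply, smul_eq_mul, Finset.mul_sum]
  exact Finset.sum_congr rfl fun x _ => Finset.sum_congr rfl fun y _ => by ring

theorem ae_restrict_comp_affine {P : ℝ → Prop} {c d α β : ℝ} (hc : c ≠ 0)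
    (hf : MapsTo (fun s => c * s + d) (Ioo α β) (Ioo 0 1))
    (h : ∀ᵐ t ∂(volume.restrict (Ioo (0 : ℝ) 1)), P t) :
    ∀ᵐ t ∂(volume.restrict (Ioo α β)), P (c * t + d) := by
  rw [ae_restrict_iff' measurableSet_Ioo] at h ⊢
  have h1 : ∀ᵐ t : ℝ, t + d ∈ Ioo (0 : ℝ) 1 → P (t + d) :=
    (measurePreserving_add_right volume d).quasiMeasurePreserving.ae h
  have h2 : volume ((c * ·) ⁻¹' {t : ℝ | ¬ (t + d ∈ Ioo (0 : ℝ) 1 → P (t + d))}) = 0 := by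
    rw [Real.volume_preimage_mul_left hc, ae_iff.1 h1, mul_zero]
  have h3 : ∀ᵐ t : ℝ, c * t + d ∈ Ioo (0 : ℝ) 1 → P (c * t + d) := ae_iff.2 h2
  filter_upwards [h3] with t ht htm using ht (hf htm)

theorem hasDerivAt_affine (c d s : ℝ) : HasDerivAt (fun s => c * s + d) c s := by
  have := ((hasDerivAt_id s).const_mul c).add_const d
  rwa [mul_one] at this

theorem IsCE.ae_hasDerivAt_comp_affine {ρ₀ ρ₁ : X → ℝ} {ρ ψ : ℝ → X → ℝ}
    (h : IsCE K μ θ ρ₀ ρ₁ ρ ψ) {c d α β : ℝ} (hc : c ≠ 0)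
    (hf : MapsTo (fun s => c * s + d) (Ioo α β) (Ioo 0 1)) :
    ∀ᵐ t ∂(volume.restrict (Ioo α β)), HasDerivAt (fun s => ρ (c * s + d))
      (B K θ (ρ (c * t + d)) (c • ψ (c * t + d))) t := by
  filter_upwards [ae_restrict_comp_affine hc hf h.ae_hasDerivAt] with t ht
  rw [map_smul]
  exact ht.scomp t (hasDerivAt_affine c d t)

theorem lintegral_gradInner_comp_affine (ρ ψ : ℝ → X → ℝ) {c d α β : ℝ} (hc : c ≠ 0)
    (hf : (fun s => c * s + d) '' (Ioo α β) = Ioo 0 1) :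
    ∫⁻ t in Ioo α β, ENNReal.ofReal (gradInner K μ θ (ρ (c * t + d)) (c • ψ (c * t + d))
      (c • ψ (c * t + d))) = ENNReal.ofReal |c| * action K μ θ ρ ψ := by
  rw [action, ← restrict_Ioo_eq_restrict_Icc, ← hf,
    lintegral_image_eq_lintegral_abs_deriv_mul measurableSet_Ioo
      (fun s _ => (hasDerivAt_affine c d s).hasDerivWithinAt)
      (fun s _ t _ hst => mul_left_cancel₀ hc (add_right_cancel hst)),
    ← lintegral_const_mul' _ _ ENNReal.ofReal_ne_top]
  refine lintegral_congr fun t => ?_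
  rw [gradInner_smul_smul, ← mul_assoc, ← ENNReal.ofReal_mul (abs_nonneg _), abs_mul_abs_self,
    sq, ENNReal.ofReal_mul (mul_self_nonneg c)]

theorem measurable_smul_comp_affine {ψ : ℝ → X → ℝ} (h : Measurable ψ) (c d : ℝ) :
    Measurable fun t => c • ψ (c * t + d) :=
  (h.comp (by fun_prop : Measurable fun t : ℝ => c * t + d)).const_smul c

theorem isCE_mk {ρ₀ ρ₁ : X → ℝ} {ρ ψ : ℝ → X → ℝ} (h1 : PiecewiseC1 ρ) (h2 : ρ 0 = ρ₀)
    (h3 : ρ 1 = ρ₁) (h4 : ∀ t ∈ Icc (0 : ℝ) 1, IsDensity μ (ρ t)) (h5 : Measurable ψ)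
    (h6 : ∀ᵐ t ∂(volume.restrict (Ioo (0 : ℝ) 1)), HasDerivAt ρ (B K θ (ρ t) (ψ t)) t) :
    IsCE K μ θ ρ₀ ρ₁ ρ ψ := by
  refine ⟨h1, h2, h3, h4, h5, ?_⟩
  filter_upwards [h6] with t ht x
  refine (hasDerivAt_pi.1 ht x).congr_deriv ?_
  simp only [B, LinearMap.coe_mk, AddHom.coe_mk]
  rw [← Finset.sum_neg_distrib]
  exact Finset.sum_congr rfl fun y _ => by ring

theorem PiecewiseC1.reverse {ρ : ℝ → X → ℝ} (h : PiecewiseC1 ρ) :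
    PiecewiseC1 (fun t => ρ (-1 * t + 1)) := by
  obtain ⟨n, τ, hτ, h0, h1, hρ⟩ := h
  refine ⟨n, fun i => 1 - τ (n - i), fun i j hij => ?_, by simp [h1], by simp [h0], fun i hi => ?_⟩
  · exact sub_le_sub_left (hτ (by omega)) 1
  · refine (hρ (n - (i + 1)) (by omega)).comp (by fun_prop) fun t ht => ?_
    have : n - (i + 1) + 1 = n - i := by omega
    rw [this]
    exact ⟨by linarith [ht.2], by linarith [ht.1]⟩

theorem PiecewiseC1.concat {ρ ρ' : ℝ → X → ℝ} (h : PiecewiseC1 ρ) (h' : PiecewiseC1 ρ')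
    (he : ρ 1 = ρ' 0) {l : ℝ} (hl0 : 0 < l) (hl1 : l < 1) :
    PiecewiseC1 (fun t => if t ≤ l then ρ (l⁻¹ * t + 0) else ρ' ((1 - l)⁻¹ * t + -(l / (1 - l))))
    := by
  obtain ⟨n, τ, hτ, h0, h1, hρ⟩ := h
  obtain ⟨n', τ', hτ', h0', h1', hρ'⟩ := h'
  have hl2 : 0 < 1 - l := by linarith
  let T : ℕ → ℝ := fun i => if i ≤ n then l * τ i else l + (1 - l) * τ' (i - n)
  have hT1 : ∀ i ≤ n, T i = l * τ i := fun i hi => if_pos hi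
  have hT2 : ∀ i, n ≤ i → T i = l + (1 - l) * τ' (i - n) := fun i hi => by
    rcases hi.eq_or_lt with rfl | hi
    · rw [hT1 _ le_rfl, h1, Nat.sub_self, h0']; ring
    · exact if_neg (by omega)
  refine ⟨n + n', T, monotone_nat_of_le_succ fun i => ?_, ?_, ?_, fun i hi => ?_⟩
  · rcases lt_or_ge i n with hin | hin
    · rw [hT1 i hin.le, hT1 (i + 1) hin]
      exact mul_le_mul_of_nonneg_left (hτ (Nat.le_succ i)) hl0.le
    · rw [hT2 i hin, hT2 (i + 1) (by omega)]
      have := mul_le_mul_of_nonneg_left (hτ' (show i - n ≤ i + 1 - n by omega)) hl2.le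
      linarith
  · rw [hT1 0 (Nat.zero_le n), h0, mul_zero]
  · rw [hT2 _ (by omega), Nat.add_sub_cancel_left, h1']; ring
  · rcases lt_or_ge i n with hin | hin
    · rw [hT1 i hin.le, hT1 (i + 1) hin]
      have hle : ∀ t ∈ Icc (l * τ i) (l * τ (i + 1)), t ≤ l := fun t ht => by
        have := mul_le_mul_of_nonneg_left (hτ (show i + 1 ≤ n from hin)) hl0.le
        rw [h1] at this
        linarith [ht.2]
      refine ContDiffOn.congr (f := fun t => ρ (l⁻¹ * t + 0)) ?_ fun t ht => if_pos (hle t ht)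
      refine (hρ i hin).comp (by fun_prop) fun t ht => ?_
      rw [add_zero, inv_mul_eq_div]
      exact ⟨by rw [le_div_iff₀ hl0, mul_comm]; exact ht.1,
        by rw [div_le_iff₀ hl0, mul_comm]; exact ht.2⟩
    · rw [hT2 i hin, hT2 (i + 1) (by omega)]
      have hle : ∀ t ∈ Icc (l + (1 - l) * τ' (i - n)) (l + (1 - l) * τ' (i + 1 - n)), l ≤ t :=
        fun t ht => by
          have := mul_nonneg hl2.le (h0' ▸ hτ' (Nat.zero_le (i - n)))
          linarith [ht.1]
      have haff : ∀ t, (1 - l)⁻¹ * t + -(l / (1 - l)) = (t - l) / (1 - l) := fun t => by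
        field_simp; ring
      refine ContDiffOn.congr (f := fun t => ρ' ((1 - l)⁻¹ * t + -(l / (1 - l)))) ?_
        fun t ht => ?_
      · refine (hρ' (i - n) (by omega)).comp (by fun_prop) fun t ht => ?_
        rw [haff, show i - n + 1 = i + 1 - n by omega]
        exact ⟨by rw [le_div_iff₀ hl2]; linarith [ht.1],
          by rw [div_le_iff₀ hl2]; linarith [ht.2]⟩
      -- At the junction t = l the first formula is in force; it agrees with the second one by `he`.
      · rcases (hle t ht).eq_or_lt with rfl | hlt
        · rw [if_pos le_rfl, haff, sub_self, zero_div, add_zero, inv_mul_cancel₀ hl0.ne', he]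
        · rw [if_neg (not_le.2 hlt)]

theorem W_symm_le (ρ₀ ρ₁ : Density μ) : W K μ θ ρ₁ ρ₀ ≤ W K μ θ ρ₀ ρ₁ := by
  refine le_of_forall_gt_imp_ge_of_dense fun c hc => ?_
  obtain ⟨ρ, ψ, h, hA⟩ := exists_isCE_of_W_lt hc
  have himg : (fun s : ℝ => -1 * s + 1) '' (Ioo 0 1) = Ioo 0 1 := by
    ext t
    refine ⟨?_, fun ht => ⟨1 - t, ⟨by linarith [ht.2], by linarith [ht.1]⟩, by ring⟩⟩
    rintro ⟨s, hs, rfl⟩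
    exact ⟨by linarith [hs.2], by linarith [hs.1]⟩
  have hneg : (-1 : ℝ) ≠ 0 := by norm_num
  refine W_le_of_isCE (ρ := fun t => ρ (-1 * t + 1)) (ψ := fun t => (-1 : ℝ) • ψ (-1 * t + 1))
    (isCE_mk h.piecewiseC1.reverse (by simp [h.final]) (by simp [h.init])
      (fun t ht => h.density _ ⟨by linarith [ht.2], by linarith [ht.1]⟩)
      (measurable_smul_comp_affine h.measurable _ _)
      (h.ae_hasDerivAt_comp_affine hneg (mapsTo_iff_image_subset.2 himg.le))) ?_
  rw [action, ← restrict_Ioo_eq_restrict_Icc, lintegral_gradInner_comp_affine ρ ψ hneg himg]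
  simpa using hA.le

theorem W_comm (ρ₀ ρ₁ : Density μ) : W K μ θ ρ₀ ρ₁ = W K μ θ ρ₁ ρ₀ :=
  le_antisymm (W_symm_le _ _) (W_symm_le _ _)

theorem W_triangle (ρ₀ ρ₁ ρ₂ : Density μ) :
    W K μ θ ρ₀ ρ₂ ≤ W K μ θ ρ₀ ρ₁ + W K μ θ ρ₁ ρ₂ := by
  refine le_of_forall_gt_imp_ge_of_dense fun r hr => ?_
  obtain ⟨u, hu, v, hv, huv⟩ := ENNReal.exists_add_lt_of_add_lt hr
  refine le_trans ?_ huv.le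
  have hut : u ≠ ⊤ := fun h => by simp [h] at huv
  have hvt : v ≠ ⊤ := fun h => by simp [h] at huv
  obtain ⟨a, rfl⟩ : ∃ a : ℝ, ENNReal.ofReal a = u := ⟨u.toReal, ENNReal.ofReal_toReal hut⟩
  obtain ⟨b, rfl⟩ : ∃ b : ℝ, ENNReal.ofReal b = v := ⟨v.toReal, ENNReal.ofReal_toReal hvt⟩
  have ha : 0 < a := ENNReal.ofReal_pos.1 (pos_of_gt hu)
  have hb : 0 < b := ENNReal.ofReal_pos.1 (pos_of_gt hv)
  obtain ⟨ρ, ψ, h, hA⟩ := exists_isCE_of_W_lt hu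
  obtain ⟨ρ', ψ', h', hA'⟩ := exists_isCE_of_W_lt hv
  -- Time is shared in proportion to the two distances; this makes a²/l + b²/(1 - l) equal to (a +
  -- b)².
  set l := a / (a + b) with hl
  have hl0 : 0 < l := by positivity
  have hl1 : 1 - l = b / (a + b) := by rw [hl]; field_simp; ring
  have hl2 : 0 < 1 - l := by rw [hl1]; positivity
  have haff : ∀ t, (1 - l)⁻¹ * t + -(l / (1 - l)) = (t - l) / (1 - l) := fun t => by
    field_simp; ring
  have himg : (fun s : ℝ => l⁻¹ * s + 0) '' (Ioo 0 l) = Ioo 0 1 := by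
    ext t
    simp only [add_zero, inv_mul_eq_div]
    constructor
    · rintro ⟨s, hs, rfl⟩
      exact ⟨div_pos hs.1 hl0, (div_lt_one hl0).2 hs.2⟩
    · exact fun ht => ⟨t * l, ⟨mul_pos ht.1 hl0, by nlinarith [ht.2]⟩,
        mul_div_cancel_right₀ _ hl0.ne'⟩
  have himg' : (fun s : ℝ => (1 - l)⁻¹ * s + -(l / (1 - l))) '' (Ioo l 1) = Ioo 0 1 := by
    ext t
    simp only [haff]
    constructor
    · rintro ⟨s, hs, rfl⟩
      exact ⟨div_pos (sub_pos.2 hs.1) hl2, (div_lt_one hl2).2 (by linarith [hs.2])⟩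
    · exact fun ht => ⟨l + t * (1 - l), ⟨by nlinarith [ht.1], by nlinarith [ht.2]⟩, by
        simp only [add_sub_cancel_left, mul_div_cancel_right₀ _ hl2.ne']⟩
  let γ : ℝ → X → ℝ := fun t =>
    if t ≤ l then ρ (l⁻¹ * t + 0) else ρ' ((1 - l)⁻¹ * t + -(l / (1 - l)))
  let χ : ℝ → X → ℝ := fun t => if t ≤ l then l⁻¹ • ψ (l⁻¹ * t + 0) else
    (1 - l)⁻¹ • ψ' ((1 - l)⁻¹ * t + -(l / (1 - l)))
  have hunion : Ioo (0 : ℝ) 1 =ᵐ[volume] (Ioo 0 l ∪ Ioo l 1 : Set ℝ) := by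
    have h1 : Ioo (0 : ℝ) 1 = Ioc 0 l ∪ Ioo l 1 :=
      (Ioc_union_Ioo_eq_Ioo hl0.le (by linarith)).symm
    rw [h1]
    exact ae_eq_set_union Ioo_ae_eq_Ioc.symm (ae_eq_refl _)
  have hCE : IsCE K μ θ ρ₀ ρ₂ γ χ := by
    refine isCE_mk (h.piecewiseC1.concat h'.piecewiseC1 (h.final.trans h'.init.symm) hl0
      (by linarith)) ?_ ?_ ?_ ?_ ?_
    · simp [γ, hl0.le, h.init]
    · have : ¬ (1 : ℝ) ≤ l := by linarith
      simp only [γ, if_neg this, haff, div_self hl2.ne', h'.final]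
    · intro t ht
      simp only [γ]
      split_ifs with htl
      · refine h.density _ ?_
        rw [add_zero, inv_mul_eq_div]
        exact ⟨div_nonneg ht.1 hl0.le, (div_le_one hl0).2 htl⟩
      · refine h'.density _ ?_
        rw [haff]
        exact ⟨div_nonneg (by linarith) hl2.le, (div_le_one hl2).2 (by linarith [ht.2])⟩
    · exact Measurable.ite measurableSet_Iic (measurable_smul_comp_affine h.measurable _ _)
        (measurable_smul_comp_affine h'.measurable _ _)
    · rw [Measure.restrict_congr_set hunion, ae_restrict_union_iff]
      constructor
      · filter_upwards [h.ae_hasDerivAt_comp_affine (inv_pos.2 hl0).ne'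
          (mapsTo_iff_image_subset.2 himg.le), ae_restrict_mem measurableSet_Ioo] with t ht htm
        have e1 : γ t = ρ (l⁻¹ * t + 0) := if_pos htm.2.le
        have e2 : χ t = l⁻¹ • ψ (l⁻¹ * t + 0) := if_pos htm.2.le
        rw [e1, e2]
        refine ht.congr_of_eventuallyEq ?_
        filter_upwards [Iio_mem_nhds htm.2] with s hs using if_pos (le_of_lt hs)
      · filter_upwards [h'.ae_hasDerivAt_comp_affine (inv_pos.2 hl2).ne'
          (mapsTo_iff_image_subset.2 himg'.le), ae_restrict_mem measurableSet_Ioo] with t ht htm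
        have e1 : γ t = ρ' ((1 - l)⁻¹ * t + -(l / (1 - l))) := if_neg (not_le.2 htm.1)
        have e2 : χ t = (1 - l)⁻¹ • ψ' ((1 - l)⁻¹ * t + -(l / (1 - l))) :=
          if_neg (not_le.2 htm.1)
        rw [e1, e2]
        refine ht.congr_of_eventuallyEq ?_
        filter_upwards [Ioi_mem_nhds htm.1] with s hs using if_neg (not_le.2 hs)
  refine W_le_of_isCE hCE ?_
  have hdisj : Disjoint (Ioo 0 l) (Ioo l 1) := by
    rw [Set.disjoint_left]; exact fun t h1 h2 => absurd h1.2 (not_lt.2 h2.1.le)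
  have e1 : ∫⁻ t in Ioo 0 l, ENNReal.ofReal (gradInner K μ θ (γ t) (χ t) (χ t)) =
      ENNReal.ofReal |l⁻¹| * action K μ θ ρ ψ := by
    rw [← lintegral_gradInner_comp_affine ρ ψ (inv_pos.2 hl0).ne' himg]
    refine setLIntegral_congr_fun measurableSet_Ioo fun t ht => ?_
    simp only [γ, χ, if_pos ht.2.le]
  have e2 : ∫⁻ t in Ioo l 1, ENNReal.ofReal (gradInner K μ θ (γ t) (χ t) (χ t)) =
      ENNReal.ofReal |(1 - l)⁻¹| * action K μ θ ρ' ψ' := by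
    rw [← lintegral_gradInner_comp_affine ρ' ψ' (inv_pos.2 hl2).ne' himg']
    refine setLIntegral_congr_fun measurableSet_Ioo fun t ht => ?_
    simp only [γ, χ, if_neg (not_le.2 ht.1)]
  rw [action, ← restrict_Ioo_eq_restrict_Icc, Measure.restrict_congr_set hunion,
    lintegral_union measurableSet_Ioo hdisj, e1, e2]
  calc _ ≤ ENNReal.ofReal |l⁻¹| * ENNReal.ofReal a ^ 2 +
        ENNReal.ofReal |(1 - l)⁻¹| * ENNReal.ofReal b ^ 2 := by gcongr
    _ = ENNReal.ofReal ((a + b) * a + (a + b) * b) := by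
        rw [ENNReal.ofReal_add (by positivity) (by positivity), ← ENNReal.ofReal_pow ha.le,
          ← ENNReal.ofReal_pow hb.le, ← ENNReal.ofReal_mul (abs_nonneg _),
          ← ENNReal.ofReal_mul (abs_nonneg _), abs_of_pos (inv_pos.2 hl0),
          abs_of_pos (inv_pos.2 hl2), hl1, hl]
        congr 2 <;> field_simp
    _ = _ := by
        rw [← ENNReal.ofReal_add ha.le hb.le, ← ENNReal.ofReal_pow (by positivity)]
        congr 1; ring

theorem isExtendedMetric_W (hK : IsReversibleMarkov K μ) (hθ : IsAdmissible θ) :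
    IsExtendedMetric (W K μ θ) where
  eq_zero_iff a b := by
    constructor
    · intro h
      obtain ⟨C, -, hC⟩ := exists_enorm_apply_sub_le_W hK hθ
      have : a.val = b.val := funext fun x => by
        have := hC a b x
        rw [h, mul_zero, nonpos_iff_eq_zero, enorm_eq_zero, sub_eq_zero] at this
        exact this.symm
      cases a; cases b; simp_all
    · rintro rfl; exact W_self hK hθ a
  symm := W_comm
  triangle := W_triangle

/-! ### Linear interpolation -/

theorem gradInner_le_mul (hK : IsReversibleMarkov K μ) {ρ ρ' : X → ℝ} {C : ℝ}
    (h : ∀ x y, θ (ρ x) (ρ y) ≤ C * θ (ρ' x) (ρ' y)) (φ : X → ℝ) :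
    gradInner K μ θ ρ φ φ ≤ C * gradInner K μ θ ρ' φ φ := by
  unfold gradInner
  rw [mul_left_comm, Finset.mul_sum (a := C)]
  refine mul_le_mul_of_nonneg_left (Finset.sum_le_sum fun x _ => ?_) (by norm_num : (0 : ℝ) ≤ 1 / 2)
  rw [Finset.mul_sum]
  refine Finset.sum_le_sum fun y _ => ?_
  have := mul_le_mul_of_nonneg_left (h x y) (mul_nonneg (mul_nonneg
    (mul_self_nonneg (φ x - φ y)) (hK.nonneg x y)) (hK.steady_nonneg x))
  linarith

theorem abs_pair_le (hK : IsReversibleMarkov K μ) (φ u : X → ℝ) : |pair μ φ u| ≤ ‖φ‖ * ‖u‖ := by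
  calc |pair μ φ u| ≤ ∑ x, |μ x * φ x * u x| := Finset.abs_sum_le_sum_abs _ _
    _ ≤ ∑ x, μ x * (‖φ‖ * ‖u‖) := Finset.sum_le_sum fun x _ => by
        rw [abs_mul, abs_mul, abs_of_pos (hK.pos x), mul_assoc]
        exact mul_le_mul_of_nonneg_left (mul_le_mul (norm_le_pi_norm φ x) (norm_le_pi_norm u x)
          (abs_nonneg _) (norm_nonneg _)) (hK.pos x).le
    _ = _ := by rw [← Finset.sum_mul, hK.steady_sum, one_mul]

theorem IsDensity.convex {ρ₀ ρ₁ : X → ℝ} (h₀ : IsDensity μ ρ₀) (h₁ : IsDensity μ ρ₁) {t : ℝ}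
    (ht : t ∈ Icc (0 : ℝ) 1) : IsDensity μ (ρ₀ + t • (ρ₁ - ρ₀)) := by
  refine ⟨fun x => ?_, ?_⟩
  · simp only [Pi.add_apply, Pi.smul_apply, Pi.sub_apply, smul_eq_mul]
    nlinarith [mul_nonneg ht.1 (h₁.1 x), mul_nonneg (sub_nonneg.2 ht.2) (h₀.1 x)]
  · have : ∀ x, μ x * (ρ₀ + t • (ρ₁ - ρ₀)) x = (1 - t) * (μ x * ρ₀ x) + t * (μ x * ρ₁ x) :=
      fun x => by simp only [Pi.add_apply, Pi.smul_apply, Pi.sub_apply, smul_eq_mul]; ring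
    simp only [this]
    rw [Finset.sum_add_distrib, ← Finset.mul_sum, ← Finset.mul_sum, h₀.2, h₁.2]
    ring

/-- There are finitely many ratios, and a pair with vanishing denominator has vanishing numerator
too. The constant depends on ρ, so no uniform doubling is needed. -/
theorem exists_theta_le_mul (hθ : IsAdmissible θ) {ρ : X → ℝ} (hρ : ∀ x, 0 ≤ ρ x) {κ : ℝ}
    (hκ : 0 < κ) : ∃ C > 0, ∀ x y, θ (ρ x) (ρ y) ≤ C * θ (κ * ρ x) (κ * ρ y) := by
  have h0 : ∀ x y, 0 ≤ θ (κ * ρ x) (κ * ρ y) := fun x y =>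
    hθ.nonneg _ _ (mul_nonneg hκ.le (hρ x)) (mul_nonneg hκ.le (hρ y))
  let r : X × X → ℝ := fun p => θ (ρ p.1) (ρ p.2) / θ (κ * ρ p.1) (κ * ρ p.2)
  have hr : ∀ p, 0 ≤ r p := fun p => div_nonneg (hθ.nonneg _ _ (hρ _) (hρ _)) (h0 _ _)
  refine ⟨1 + ∑ p, r p, add_pos_of_pos_of_nonneg one_pos (Finset.sum_nonneg fun p _ => hr p),
    fun x y => ?_⟩
  rcases (h0 x y).eq_or_lt with h | h
  · rw [← h, mul_zero]
    by_contra hne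
    have h1 := (hθ.pos_iff (hρ x) (hρ y)).1 (not_le.1 hne)
    exact (hθ.pos _ _ (mul_pos hκ h1.1) (mul_pos hκ h1.2)).ne h
  · rw [← div_le_iff₀ h]
    have := Finset.single_le_sum (f := r) (fun p _ => hr p) (Finset.mem_univ (x, y))
    linarith

/-- Along the segment the density stays above κρ₀, so its edge weights are at least a fixed fraction
of those at ρ₀. As C depends only on ρ₀ and κ, this also gives continuity at ρ₀. -/
theorem exists_W_le_linear (hK : IsReversibleMarkov K μ) (hθ : IsAdmissible θ) (ρ₀ : Density μ)
    {κ : ℝ} (hκ : 0 < κ) (hκ1 : κ ≤ 1) : ∃ C : ℝ, 0 ≤ C ∧ ∀ ρ₁ : Density μ,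
      (∀ x, κ * ρ₀ x ≤ ρ₁ x) → ρ₁.val - ρ₀.val ∈ LinearMap.range (B K θ ρ₀) →
        W K μ θ ρ₀ ρ₁ ≤ ENNReal.ofReal (C * ‖ρ₁.val - ρ₀.val‖) := by
  have hd0 := ρ₀.isDensity.1
  obtain ⟨C, hC, hCle⟩ := exists_theta_le_mul hθ hd0 hκ
  have hs0 := sameSupport_self hd0
  set G := invB hK hθ hd0 ρ₀
  -- The factor C compares the energies along the segment with those at ρ₀, and ‖G‖ bounds the
  -- energy ⟨Gu, u⟩ of the potential of u.
  refine ⟨√(C * ‖G‖), Real.sqrt_nonneg _, fun ρ₁ h1 hu => ?_⟩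
  set u := ρ₁.val - ρ₀.val with hudef
  have hBG : B K θ ρ₀ (G u) = u := B_invB hK hθ hd0 hs0 hu
  have hle : ∀ t ∈ Icc (0 : ℝ) 1, ∀ x, κ * ρ₀ x ≤ (ρ₀.val + t • u) x := fun t ht x => by
    simp only [hudef, Pi.add_apply, Pi.smul_apply, Pi.sub_apply, smul_eq_mul]
    nlinarith [mul_le_mul_of_nonneg_left (h1 x) ht.1, mul_nonneg (sub_nonneg.2 ht.2) (hd0 x),
      mul_nonneg (mul_nonneg (sub_nonneg.2 ht.2) (hd0 x)) (sub_nonneg.2 hκ1)]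
  have hd : ∀ t ∈ Icc (0 : ℝ) 1, IsDensity μ (ρ₀.val + t • u) := fun t ht =>
    ρ₀.isDensity.convex ρ₁.isDensity ht
  have hs : ∀ t ∈ Icc (0 : ℝ) 1, ρ₀.val + t • u ∈ sameSupport ρ₀ := fun t ht =>
    ⟨(hd t ht).1, fun x => ⟨fun h => by
      by_contra hx
      have hx0 : ρ₀ x = 0 := le_antisymm (not_lt.1 hx) (hd0 x)
      rw [Pi.add_apply, Pi.smul_apply, eq_zero_of_mem_range_B hθ hd0 hu hx, hx0] at h
      simp at h, fun h => (mul_pos hκ h).trans_le (hle t ht x)⟩⟩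
  have hderiv : ∀ t, HasDerivAt (fun t : ℝ => ρ₀.val + t • u) u t := fun t => by
    have := ((hasDerivAt_id t).smul_const u).const_add ρ₀.val
    rwa [one_smul] at this
  have hQ : gradInner K μ θ ρ₀ (G u) (G u) ≤ ‖G‖ * ‖u‖ ^ 2 := by
    rw [← pair_B hK hθ hd0, hBG]
    refine (le_abs_self _).trans ((abs_pair_le hK _ _).trans ?_)
    rw [sq, ← mul_assoc]
    exact mul_le_mul_of_nonneg_right (G.le_opNorm u) (norm_nonneg _)
  have := W_le_of_curve hK hθ hd0 (ρ₀ := ρ₀) (ρ₁ := ρ₁) (ρ := fun t => ρ₀.val + t • u)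
    (A := √(C * ‖G‖) * ‖u‖) zero_le_one (by fun_prop) (by simp) (by simp [hudef]) hd
    (fun t ht => hs t (Ioo_subset_Icc_self ht)) (by positivity) (fun t ht φ => by
      have ht' := Ioo_subset_Icc_self ht
      rw [(hderiv t).deriv, mul_pow, Real.sq_sqrt (by positivity)]
      have h2 := pair_B_sq_le hK hθ hd0 φ (G u)
      rw [hBG] at h2
      have h3 : gradInner K μ θ ρ₀ φ φ ≤ C * gradInner K μ θ (ρ₀.val + t • u) φ φ :=
        gradInner_le_mul hK (fun x y => (hCle x y).trans (mul_le_mul_of_nonneg_left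
          (hθ.mono₂ (mul_nonneg hκ.le (hd0 x)) (hle t ht' x) (mul_nonneg hκ.le (hd0 y))
            (hle t ht' y)) hC.le)) φ
      calc pair μ φ u ^ 2 ≤ _ := h2
        _ ≤ (‖G‖ * ‖u‖ ^ 2) * (C * gradInner K μ θ (ρ₀.val + t • u) φ φ) :=
            mul_le_mul hQ h3 (gradInner_self_nonneg hK hθ hd0 φ) (by positivity)
        _ = _ := by ring)
  simpa using this

theorem W_lt_top_of_mem_component (hK : IsReversibleMarkov K μ) (hθ : IsAdmissible θ)
    {ρ σ : Density μ} (h : ρ ∈ component K μ θ σ) : W K μ θ σ ρ < ⊤ := by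
  have hr : ∀ x, 0 ≤ σ x / ρ x := fun x => div_nonneg (σ.isDensity.1 x) (ρ.isDensity.1 x)
  -- Then κ = 1/S satisfies κσ ≤ ρ: where ρ vanishes the quotient is 0 by convention, and σ vanishes
  -- as well.
  set S := 1 + ∑ x, σ x / ρ x with hS
  have hS1 : 1 ≤ S := le_add_of_nonneg_right (Finset.sum_nonneg fun x _ => hr x)
  obtain ⟨C, -, hC⟩ := exists_W_le_linear hK hθ σ (inv_pos.2 (by linarith : 0 < S))
    (inv_le_one_of_one_le₀ hS1)
  refine (hC ρ (fun x => ?_) h.2).trans_lt ENNReal.ofReal_lt_top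
  rw [inv_mul_le_iff₀ (by linarith)]
  rcases (ρ.isDensity.1 x).eq_or_lt with h0 | h0
  · rw [← h0, mul_zero]
    exact not_lt.1 fun hx => ((h.1.2 x).2 hx).ne h0
  · rw [← div_le_iff₀ h0]
    have := Finset.single_le_sum (f := fun x => σ x / ρ x) (fun p _ => hr p) (Finset.mem_univ x)
    linarith

theorem eventually_W_lt_of_mem_component (hK : IsReversibleMarkov K μ) (hθ : IsAdmissible θ)
    (σ : Density μ) {ε : ℝ≥0∞} (hε : 0 < ε) :
    ∀ᶠ v in 𝓝 σ.val, ∀ ρ : Density μ, ρ.val = v → ρ ∈ component K μ θ σ → W K μ θ σ ρ < ε := by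
  obtain ⟨C, -, hC⟩ := exists_W_le_linear hK hθ σ (κ := 1 / 2) (by norm_num) (by norm_num)
  have h1 : ∀ᶠ v in 𝓝 σ.val, ∀ x, 0 < σ x → 1 / 2 * σ x < v x := by
    rw [Filter.eventually_all]
    intro x
    by_cases hx : 0 < σ x
    · have : ∀ᶠ v in 𝓝 σ.val, 1 / 2 * σ x < v x :=
        (continuous_apply x).continuousAt.eventually (lt_mem_nhds (by linarith))
      exact this.mono fun v hv _ => hv
    · exact Filter.Eventually.of_forall fun v h => absurd h hx
  have h2 : ∀ᶠ v in 𝓝 σ.val, ENNReal.ofReal (C * ‖v - σ.val‖) < ε := by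
    have hc : Continuous fun v => ENNReal.ofReal (C * ‖v - σ.val‖) :=
      ENNReal.continuous_ofReal.comp (by fun_prop)
    refine hc.continuousAt.eventually (gt_mem_nhds ?_)
    simpa using hε
  filter_upwards [h1, h2] with v hv1 hv2 ρ hρ hcomp
  subst hρ
  refine (hC ρ (fun x => ?_) hcomp.2).trans_lt hv2
  by_cases hx : 0 < σ x
  · exact (hv1 x hx).le
  · rw [le_antisymm (not_lt.1 hx) (σ.isDensity.1 x), mul_zero]
    exact ρ.isDensity.1 x

theorem eq_of_B_eq_zero_of_pos (hK : IsReversibleMarkov K μ) (hθ : IsAdmissible θ) {σ : X → ℝ}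
    (hσ : ∀ x, 0 < σ x) {φ : X → ℝ} (hφ : B K θ σ φ = 0) (x y : X) : φ x = φ y := by
  have h := (B_eq_zero_iff hK hθ (fun x => (hσ x).le) φ).1 hφ
  induction hK.reachable x y with
  | refl => rfl
  | tail _ huv ih => exact ih.trans (h _ _ (hσ _) (hσ _) huv)

/-- For positive σ irreducibility leaves only the constants in the kernel, and all densities have
the same integral. -/
theorem mem_component_of_pos (hK : IsReversibleMarkov K μ) (hθ : IsAdmissible θ) {ρ σ : Density μ}
    (hρ : ∀ x, 0 < ρ x) (hσ : ∀ x, 0 < σ x) : ρ ∈ component K μ θ σ := by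
  refine ⟨⟨ρ.isDensity.1, fun x => ⟨fun _ => hσ x, fun _ => hρ x⟩⟩, ?_⟩
  rw [mem_range_B_iff hK hθ σ.isDensity.1]
  intro φ hφ
  obtain ⟨x₀⟩ := hK.nonempty
  have h1 : ∀ ρ : Density μ, pair μ φ ρ = φ x₀ := fun ρ => by
    rw [← mul_one (φ x₀), ← ρ.isDensity.2, Finset.mul_sum]
    refine Finset.sum_congr rfl fun x _ => ?_
    rw [eq_of_B_eq_zero_of_pos hK hθ hσ hφ x₀ x]; ring
  rw [pair_sub_right, h1, h1, sub_self]

/-! ### Moving mass along one edge -/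

/-- The speed of the optimal reparametrization of the motion along one edge. -/
def edgeSpeed (θ : ℝ → ℝ → ℝ) (c r : ℝ) : ℝ := √(θ (min |r| 1) c)

theorem continuous_edgeSpeed (hθ : IsAdmissible θ) {c : ℝ} (hc : 0 < c) :
    Continuous (edgeSpeed θ c) := by
  refine Real.continuous_sqrt.comp ?_
  have := hθ.continuous_clamp.comp (f := fun r : ℝ => (min |r| 1, c)) (by fun_prop)
  refine this.congr fun r => ?_
  simp [max_eq_left hc.le]

theorem edgeSpeed_pos (hθ : IsAdmissible θ) {c : ℝ} (hc : 0 < c) {r : ℝ} (hr : r ≠ 0) :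
    0 < edgeSpeed θ c r :=
  Real.sqrt_pos.2 (hθ.pos _ _ (lt_min (abs_pos.2 hr) one_pos) hc)

theorem edgeSpeed_le (hθ : IsAdmissible θ) {c : ℝ} (hc : 0 < c) (r : ℝ) :
    edgeSpeed θ c r ≤ √(θ 1 c) :=
  Real.sqrt_le_sqrt (hθ.mono _ _ _ (le_min (abs_nonneg r) zero_le_one) (min_le_right _ _) hc.le)

theorem intervalIntegrable_edgeSpeed_inv (hθ : IsAdmissible θ) (h : Cθ θ < ⊤) {c : ℝ} (hc : 0 < c)
    (a b : ℝ) : IntervalIntegrable (fun r => (edgeSpeed θ c r)⁻¹) volume a b := by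
  have hm : Measurable fun r => (edgeSpeed θ c r)⁻¹ := (continuous_edgeSpeed hθ hc).measurable.inv
  have h01 : IntegrableOn (fun r => (edgeSpeed θ c r)⁻¹) (Ioc 0 1) := by
    refine ⟨hm.aestronglyMeasurable, ?_⟩
    rw [HasFiniteIntegral]
    refine lt_of_le_of_lt (le_of_eq ?_) (cost_lt_top hθ h hc 1)
    refine setLIntegral_congr_fun measurableSet_Ioc fun r hr => ?_
    rw [edgeSpeed, Real.enorm_eq_ofReal (inv_nonneg.2 (Real.sqrt_nonneg _)), abs_of_pos hr.1,
      min_eq_left hr.2, one_div]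
  have hpos : ∀ b, 0 ≤ b → IntervalIntegrable (fun r => (edgeSpeed θ c r)⁻¹) volume 0 b := by
    intro b hb
    refine IntervalIntegrable.trans (b := 1) ?_ ?_
    · rwa [intervalIntegrable_iff_integrableOn_Ioc_of_le zero_le_one]
    · have hcont : IntervalIntegrable (fun _ => (√(θ 1 c))⁻¹) volume 1 b := intervalIntegrable_const
      rcases le_total 1 b with h1 | h1
      · refine hcont.congr fun r hr => ?_
        rw [uIoc_of_le h1] at hr
        simp only [edgeSpeed]
        rw [abs_of_pos (by linarith [hr.1]), min_eq_right hr.1.le]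
      · refine IntervalIntegrable.symm ?_
        rw [intervalIntegrable_iff_integrableOn_Ioc_of_le h1]
        exact h01.mono_set (Ioc_subset_Ioc_left hb)
  have hall : ∀ b, IntervalIntegrable (fun r => (edgeSpeed θ c r)⁻¹) volume 0 b := by
    intro b
    rcases le_total 0 b with hb | hb
    · exact hpos b hb
    · have := (IntervalIntegrable.iff_comp_neg).1 (hpos (-b) (by linarith))
      simpa [edgeSpeed] using this
  exact (hall a).symm.trans (hall b)

/-- `T(s)` is the time that m' = `edgeSpeed θ c m` needs to reach level s from 0; it is finite
because C_θ is. The even extension and the cutoff at 1 in `edgeSpeed` make T an order isomorphism of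
the whole line; the cutoff only slows the motion, hence an inequality. -/
theorem exists_edge_reparametrization (hθ : IsAdmissible θ) (h : Cθ θ < ⊤) {c : ℝ} (hc : 0 < c) :
    ∃ T : ℝ ≃o ℝ, T 0 = 0 ∧ ContDiff ℝ 1 T.symm ∧
      ∀ t > 0, deriv T.symm t ^ 2 ≤ θ (T.symm t) c := by
  set k : ℝ → ℝ := fun r => (edgeSpeed θ c r)⁻¹ with hk
  have hint := intervalIntegrable_edgeSpeed_inv hθ h hc
  set F : ℝ → ℝ := fun s => ∫ r in (0 : ℝ)..s, k r with hF
  have hFc : Continuous F := intervalIntegral.continuous_primitive hint 0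
  set k₀ := (√(θ 1 c))⁻¹ with hk₀
  have hk₀pos : 0 < k₀ := inv_pos.2 (Real.sqrt_pos.2 (hθ.pos _ _ one_pos hc))
  have hkle : ∀ r, r ≠ 0 → k₀ ≤ k r := fun r hr =>
    inv_anti₀ (edgeSpeed_pos hθ hc hr) (edgeSpeed_le hθ hc r)
  have hgrow : ∀ a b, a ≤ b → k₀ * (b - a) ≤ F b - F a := fun a b hab => by
    simp only [hF]
    rw [intervalIntegral.integral_interval_sub_left (hint _ _) (hint _ _)]
    have h1 : ∫ _ in a..b, k₀ = k₀ * (b - a) := by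
      rw [intervalIntegral.integral_const, smul_eq_mul, mul_comm]
    rw [← h1]
    refine intervalIntegral.integral_mono_ae hab intervalIntegrable_const (hint _ _) ?_
    have : ∀ᵐ r : ℝ, r ≠ 0 := by simp [ae_iff]
    filter_upwards [this] with r hr using hkle r hr
  have hmono : StrictMono F := fun a b hab => by
    have h1 := hgrow a b hab.le
    have h2 := mul_pos hk₀pos (sub_pos.2 hab)
    linarith
  have hF0 : F 0 = 0 := by simp [hF]
  have hsurj : Function.Surjective F := by
    refine hFc.surjective ?_ ?_
    · refine Filter.tendsto_atTop_mono' _ ?_ (Filter.tendsto_id.const_mul_atTop hk₀pos)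
      filter_upwards [Filter.eventually_ge_atTop 0] with s hs
      have := hgrow 0 s hs
      simp only [id]; linarith
    · refine Filter.tendsto_atBot_mono' _ ?_ (Filter.tendsto_id.const_mul_atBot hk₀pos)
      filter_upwards [Filter.eventually_le_atBot 0] with s hs
      have := hgrow s 0 hs
      simp only [id]; linarith
  let T : ℝ ≃o ℝ := hmono.orderIsoOfSurjective F hsurj
  have hT : ∀ s, T s = F s := fun s => rfl
  have hT0 : T 0 = 0 := hF0
  have hTs0 : T.symm 0 = 0 := (T.symm_apply_eq).2 hT0.symm
  have hdF : ∀ s, s ≠ 0 → HasDerivAt F (k s) s := fun s hs => by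
    refine intervalIntegral.integral_hasDerivAt_right (hint _ _) ?_ ?_
    · exact ((continuous_edgeSpeed hθ hc).measurable.inv).stronglyMeasurable
        |>.stronglyMeasurableAtFilter
    · exact (continuous_edgeSpeed hθ hc).continuousAt.inv₀ (edgeSpeed_pos hθ hc hs).ne'
  have hcont : Continuous fun t => edgeSpeed θ c (T.symm t) :=
    (continuous_edgeSpeed hθ hc).comp T.symm.continuous
  have hne : ∀ t, t ≠ 0 → HasDerivAt T.symm (edgeSpeed θ c (T.symm t)) t := fun t ht => by
    have h0 : T.symm t ≠ 0 := fun h' => ht (by rw [← T.apply_symm_apply t, h', hT0])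
    have := HasDerivAt.of_local_left_inverse (f := F) (g := T.symm) (a := t)
      T.symm.continuous.continuousAt (hdF _ h0) (inv_ne_zero (edgeSpeed_pos hθ hc h0).ne')
      (Filter.Eventually.of_forall fun y => T.apply_symm_apply y)
    rwa [inv_inv] at this
  have hderiv : ∀ t, HasDerivAt T.symm (edgeSpeed θ c (T.symm t)) t := fun t => by
    by_cases ht : t = 0
    · subst ht
      -- At time 0 the inverse function theorem fails since the speed vanishes; the derivative is
      -- the limit of the derivatives nearby.
      exact hasDerivAt_of_hasDerivAt_of_ne (g := fun t => edgeSpeed θ c (T.symm t)) (x := 0)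
        (fun y hy => hne y hy) T.symm.continuous.continuousAt hcont.continuousAt
    · exact hne t ht
  refine ⟨T, hT0, contDiff_one_iff_deriv.2 ⟨fun t => (hderiv t).differentiableAt, ?_⟩,
    fun t ht => ?_⟩
  · rwa [funext fun t => (hderiv t).deriv]
  · have h0 : 0 < T.symm t := by rw [← hTs0]; exact T.symm.strictMono ht
    have h1 : 0 ≤ min |T.symm t| 1 := le_min (abs_nonneg _) zero_le_one
    rw [(hderiv t).deriv, edgeSpeed, Real.sq_sqrt (hθ.nonneg _ _ h1 hc.le)]
    refine hθ.mono _ _ _ h1 ?_ hc.le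
    rw [abs_of_pos h0]; exact min_le_left _ _

open Classical in
/-- The direction of the motion of mass along the edge from `x` to `z`. -/
def edgeDir (μ : X → ℝ) (x z : X) : X → ℝ := Pi.single z 1 - Pi.single x (μ z / μ x)

theorem edgeDir_right {x z : X} (h : x ≠ z) : edgeDir μ x z z = 1 := by
  simp [edgeDir, h.symm]

theorem edgeDir_left {x z : X} (h : x ≠ z) : edgeDir μ x z x = -(μ z / μ x) := by
  simp [edgeDir, h]

theorem edgeDir_of_ne {x z w : X} (hx : w ≠ x) (hz : w ≠ z) : edgeDir μ x z w = 0 := by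
  simp [edgeDir, hx, hz]

theorem pair_edgeDir (hK : IsReversibleMarkov K μ) (x z : X) (φ : X → ℝ) :
    pair μ φ (edgeDir μ x z) = μ z * (φ z - φ x) := by
  classical
  have h1 : ∀ (w : X) (a : ℝ), pair μ φ (Pi.single w a) = μ w * φ w * a := fun w a => by
    rw [pair, Finset.sum_eq_single w]
    · simp
    · intro b _ hb; simp [hb]
    · simp
  have := (hK.pos x).ne'
  rw [edgeDir, pair_sub_right, h1, h1]
  field_simp

theorem edge_le_gradInner (hK : IsReversibleMarkov K μ) (hθ : IsAdmissible θ) {ρ : X → ℝ}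
    (hρ : ∀ x, 0 ≤ ρ x) (φ : X → ℝ) (x y : X) :
    (φ x - φ y) ^ 2 * (K x y * θ (ρ x) (ρ y) * μ x) ≤ 2 * gradInner K μ θ ρ φ φ := by
  have hnn : ∀ x y, 0 ≤ (φ x - φ y) * (φ x - φ y) * K x y * θ (ρ x) (ρ y) * μ x := fun x y => by
    have := mul_nonneg (mul_self_nonneg (φ x - φ y)) (cond_nonneg hK hθ hρ x y)
    linarith
  have h1 := Finset.single_le_sum (f := fun y => (φ x - φ y) * (φ x - φ y) * K x y *
    θ (ρ x) (ρ y) * μ x) (fun y _ => hnn x y) (Finset.mem_univ y)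
  have h2 := Finset.single_le_sum (f := fun x => ∑ y, (φ x - φ y) * (φ x - φ y) * K x y *
    θ (ρ x) (ρ y) * μ x) (fun x _ => Finset.sum_nonneg fun y _ => hnn x y) (Finset.mem_univ x)
  have h3 : (φ x - φ y) * (φ x - φ y) * K x y * θ (ρ x) (ρ y) * μ x ≤
      ∑ x, ∑ y, (φ x - φ y) * (φ x - φ y) * K x y * θ (ρ x) (ρ y) * μ x := h1.trans h2
  unfold gradInner
  linarith

/-- Vertex z is filled up to the level η from x, which retains at least c, so the edge weight is at
least θ(m, c) at level m of z. Starting at time T(ρ(z)) instead of 0 gives a bound that is uniform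
in ρ. -/
theorem W_le_of_edge (hK : IsReversibleMarkov K μ) (hθ : IsAdmissible θ) {x z : X} (hxz : x ≠ z)
    (hKxz : 0 < K x z) {c : ℝ} (hc : 0 < c) (T : ℝ ≃o ℝ) (hT0 : T 0 = 0)
    (hT1 : ContDiff ℝ 1 T.symm) (hT2 : ∀ t > 0, deriv T.symm t ^ 2 ≤ θ (T.symm t) c)
    {η : ℝ} (hη : 0 < η) (ρ : Density μ) (hρz : ρ z ≤ η) (hρx : c + η * (μ z / μ x) ≤ ρ x) :
    ∃ ρ' : Density μ, ρ'.val = ρ.val + (η - ρ z) • edgeDir μ x z ∧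
      W K μ θ ρ ρ' ≤ ENNReal.ofReal (T η * √(2 * μ z ^ 2 / (K x z * μ x))) := by
  have hμ := hK.pos x
  have hμz := hK.pos z
  set v := edgeDir μ x z with hv
  have hvz : v z = 1 := edgeDir_right hxz
  have hvx : v x = -(μ z / μ x) := edgeDir_left hxz
  have hvw : ∀ w, w ≠ x → w ≠ z → v w = 0 := fun w h1 h2 => edgeDir_of_ne h1 h2
  have hgx : ∀ r ∈ Icc (ρ z) η, c ≤ (ρ.val + (r - ρ z) • v) x := fun r hr => by
    simp only [Pi.add_apply, Pi.smul_apply, smul_eq_mul, hvx]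
    have : (r - ρ z) * (μ z / μ x) ≤ η * (μ z / μ x) :=
      mul_le_mul_of_nonneg_right (by linarith [hr.2, ρ.isDensity.1 z]) (by positivity)
    linarith
  have hgz : ∀ r, (ρ.val + (r - ρ z) • v) z = r := fun r => by simp [hvz]
  have hgw : ∀ r w, w ≠ x → w ≠ z → (ρ.val + (r - ρ z) • v) w = ρ w := fun r w h1 h2 => by
    simp [hvw w h1 h2]
  have hden : ∀ r ∈ Icc (ρ z) η, IsDensity μ (ρ.val + (r - ρ z) • v) := fun r hr => by
    refine ⟨fun w => ?_, ?_⟩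
    · by_cases h1 : w = x
      · rw [h1]; exact hc.le.trans (hgx r hr)
      by_cases h2 : w = z
      · rw [h2, hgz]; exact (ρ.isDensity.1 z).trans hr.1
      · rw [hgw r w h1 h2]; exact ρ.isDensity.1 w
    · have h1 : pair μ 1 v = 0 := by rw [hv, pair_edgeDir hK]; simp
      have h2 : ∀ u : X → ℝ, ∑ w, μ w * u w = pair μ 1 u := fun u => by simp [pair]
      rw [h2, pair_add_right, pair_smul_right, h1, mul_zero, add_zero, ← h2, ρ.isDensity.2]
  refine ⟨⟨ρ.val + (η - ρ z) • v, hden η ⟨hρz, le_rfl⟩⟩, rfl, ?_⟩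
  have hTz : 0 ≤ T (ρ z) := by rw [← hT0]; exact T.monotone (ρ.isDensity.1 z)
  set A := √(2 * μ z ^ 2 / (K x z * μ x)) with hA
  have hmem : ∀ t ∈ Icc (T (ρ z)) (T η), T.symm t ∈ Icc (ρ z) η := fun t ht =>
    ⟨(T.le_symm_apply).2 ht.1, (T.symm_apply_le).2 ht.2⟩
  have hmono : T (ρ z) ≤ T η := T.monotone hρz
  have hcd : ContDiff ℝ 1 fun t => ρ.val + (T.symm t - ρ z) • v := by fun_prop
  have hderiv : ∀ t, deriv (fun t => ρ.val + (T.symm t - ρ z) • v) t = deriv T.symm t • v :=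
    fun t => by
      have h1 := (hT1.differentiable one_ne_zero t).hasDerivAt
      exact (((h1.sub_const (ρ z)).smul_const v).const_add ρ.val).deriv
  -- The reference support is that of the final density: z can be empty at the initial time only.
  have key := W_le_of_curve hK hθ (hden η ⟨hρz, le_rfl⟩).1 (ρ₀ := ρ)
    (ρ₁ := ⟨ρ.val + (η - ρ z) • v, hden η ⟨hρz, le_rfl⟩⟩)
    (ρ := fun t => ρ.val + (T.symm t - ρ z) • v) (A := A) hmono hcd.contDiffOn
    (by simp) (by simp) (fun t ht => hden _ (hmem t ht)) (fun t ht => ?_) (Real.sqrt_nonneg _)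
    (fun t ht φ => ?_)
  · refine key.trans (ENNReal.ofReal_le_ofReal (mul_le_mul_of_nonneg_right ?_
      (Real.sqrt_nonneg _)))
    linarith
  · have hr := hmem t (Ioo_subset_Icc_self ht)
    refine ⟨(hden _ hr).1, fun w => ?_⟩
    by_cases h1 : w = x
    · rw [h1]
      exact ⟨fun _ => hc.trans_le (hgx η ⟨hρz, le_rfl⟩), fun _ => hc.trans_le (hgx _ hr)⟩
    by_cases h2 : w = z
    · rw [h2, hgz, hgz]
      refine ⟨fun _ => hη, fun _ => (ρ.isDensity.1 z).trans_lt ?_⟩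
      rw [← T.symm_apply_apply (ρ z)]
      exact T.symm.strictMono ht.1
    · rw [hgw _ w h1 h2, hgw _ w h1 h2]
  · have hr := hmem t (Ioo_subset_Icc_self ht)
    have hd := hden _ hr
    have ht0 : 0 < t := hTz.trans_lt ht.1
    rw [hderiv, pair_smul_right, hv, pair_edgeDir hK, ← hv]
    have hedge := edge_le_gradInner hK hθ hd.1 φ x z
    have hm : 0 ≤ T.symm t := (ρ.isDensity.1 z).trans hr.1
    have hle : deriv T.symm t ^ 2 ≤ θ ((ρ.val + (T.symm t - ρ z) • v) x)
        ((ρ.val + (T.symm t - ρ z) • v) z) := by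
      refine (hT2 t ht0).trans ?_
      rw [hgz, hθ.symm _ _ hm hc.le]
      exact hθ.mono _ _ _ hc.le (hgx _ hr) hm
    set w := θ ((ρ.val + (T.symm t - ρ z) • v) x) ((ρ.val + (T.symm t - ρ z) • v) z)
    rw [Real.sq_sqrt (by positivity), div_mul_eq_mul_div, le_div_iff₀ (by positivity)]
    calc (deriv T.symm t * (μ z * (φ z - φ x))) ^ 2 * (K x z * μ x)
        = deriv T.symm t ^ 2 * (μ z ^ 2 * (φ x - φ z) ^ 2 * (K x z * μ x)) := by ring
      _ ≤ w * (μ z ^ 2 * (φ x - φ z) ^ 2 * (K x z * μ x)) :=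
          mul_le_mul_of_nonneg_right hle (by positivity)
      _ = μ z ^ 2 * ((φ x - φ z) ^ 2 * (K x z * w * μ x)) := by ring
      _ ≤ μ z ^ 2 * (2 * gradInner K μ θ (ρ.val + (T.symm t - ρ z) • v) φ φ) :=
          mul_le_mul_of_nonneg_left hedge (by positivity)
      _ = _ := by ring

/-- Otherwise the support would be closed under taking neighbours, hence everything. -/
theorem exists_boundary_edge (hK : IsReversibleMarkov K μ) (ρ : Density μ) {z₀ : X}
    (hz₀ : ρ z₀ = 0) : ∃ x z, 0 < ρ x ∧ ρ z = 0 ∧ 0 < K x z := by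
  obtain ⟨p, hp⟩ : ∃ p, 0 < ρ p := by
    by_contra! h
    have := ρ.isDensity.2
    rw [Finset.sum_eq_zero fun y _ => by
      rw [le_antisymm (h y) (ρ.isDensity.1 y), mul_zero]] at this
    exact zero_ne_one this
  by_contra! hno
  have key : ∀ w, Relation.ReflTransGen (fun u v => 0 < K u v) p w → 0 < ρ w := fun w hw => by
    induction hw with
    | refl => exact hp
    | @tail u w _ huw ih =>
      refine lt_of_le_of_ne (ρ.isDensity.1 w) fun h => ?_
      exact absurd huw (not_lt.2 (hno u w ih h.symm))
  exact (key z₀ (hK.reachable p z₀)).ne' hz₀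

/-- If `C_θ < ∞`, then `𝒲` is continuous, also at the boundary of `𝒫(X)`. -/
theorem eventually_W_lt (hK : IsReversibleMarkov K μ) (hθ : IsAdmissible θ) (hC : Cθ θ < ⊤) :
    ∀ (n : ℕ) (σ : Density μ), {x | σ x = 0}.ncard = n → ∀ ε : ℝ≥0∞, 0 < ε →
      ∀ᶠ v in 𝓝 σ.val, ∀ ρ : Density μ, ρ.val = v → W K μ θ σ ρ < ε := by
  intro n
  -- Filling one empty vertex of σ gives σ' with fewer zeros. Nearby ρ undergo the same operation,
  -- and σ, ρ are joined through σ' and the resulting ρ'.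
  induction n using Nat.strong_induction_on with
  | _ n ih =>
  intro σ hn ε hε
  by_cases hpos : ∀ x, 0 < σ x
  · have h1 : ∀ᶠ v in 𝓝 σ.val, ∀ x, 0 < v x := by
      rw [Filter.eventually_all]
      exact fun x => (continuous_apply x).continuousAt.eventually (lt_mem_nhds (hpos x))
    filter_upwards [h1, eventually_W_lt_of_mem_component hK hθ σ hε] with v hv hv' ρ hρ
    subst hρ
    exact hv' ρ rfl (mem_component_of_pos hK hθ hv hpos)
  · push Not at hpos
    obtain ⟨z₀, hz₀⟩ := hpos
    obtain ⟨x, z, hx, hz, hxz⟩ := exists_boundary_edge hK σ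
      (le_antisymm hz₀ (σ.isDensity.1 z₀))
    have hne : x ≠ z := by rintro rfl; exact hx.ne' hz
    -- Nearby densities have at least 2c at x; one c is retained, and the other one pays for raising
    -- z to η.
    set c := σ x / 4 with hc
    have hc0 : 0 < c := by positivity
    obtain ⟨T, hT0, hT1, hT2⟩ := exists_edge_reparametrization hθ hC hc0
    have hε3 : 0 < ε / 3 := ENNReal.div_pos hε.ne' (by norm_num)
    obtain ⟨η, hη0, hη1, hη2⟩ : ∃ η, 0 < η ∧ η * (μ z / μ x) < c ∧
        ENNReal.ofReal (T η * √(2 * μ z ^ 2 / (K x z * μ x))) < ε / 3 := by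
      have e1 : ∀ᶠ η in 𝓝 (0 : ℝ), η * (μ z / μ x) < c := by
        have : Continuous fun η : ℝ => η * (μ z / μ x) := by fun_prop
        exact this.continuousAt.eventually (gt_mem_nhds (by simpa using hc0))
      have e2 : ∀ᶠ η in 𝓝 (0 : ℝ),
          ENNReal.ofReal (T η * √(2 * μ z ^ 2 / (K x z * μ x))) < ε / 3 := by
        have : Continuous fun η : ℝ => ENNReal.ofReal (T η * √(2 * μ z ^ 2 / (K x z * μ x))) :=
          ENNReal.continuous_ofReal.comp (T.continuous.mul continuous_const)
        exact this.continuousAt.eventually (gt_mem_nhds (by simpa [hT0] using hε3))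
      have e3 : ∃ᶠ η in 𝓝 (0 : ℝ), 0 < η := by
        have : ∃ᶠ η in 𝓝[>] (0 : ℝ), 0 < η :=
          Filter.Eventually.frequently (f := 𝓝[>] (0 : ℝ)) self_mem_nhdsWithin
        exact this.filter_mono nhdsWithin_le_nhds
      obtain ⟨η, h1, h2, h3⟩ := (e3.and_eventually (e1.and e2)).exists
      exact ⟨η, h1, h2, h3⟩
    have hmove : ∀ ρ : Density μ, ρ z ≤ η → 2 * c ≤ ρ x → ∃ ρ' : Density μ,
        ρ'.val = ρ.val + (η - ρ z) • edgeDir μ x z ∧ W K μ θ ρ ρ' < ε / 3 := fun ρ h1 h2 => by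
      obtain ⟨ρ', h3, h4⟩ := W_le_of_edge hK hθ hne hxz hc0 T hT0 hT1 hT2 hη0 ρ h1 (by linarith)
      exact ⟨ρ', h3, h4.trans_lt hη2⟩
    obtain ⟨σ', hσ', hWσ⟩ := hmove σ (by rw [hz]; exact hη0.le) (by rw [hc]; linarith)
    have hlt : {w | σ' w = 0}.ncard < n := by
      rw [← hn]
      refine Set.ncard_lt_ncard ⟨fun w hw => ?_, fun hsub => ?_⟩ (Set.toFinite _)
      · simp only [Set.mem_ofPred_eq] at hw ⊢
        rw [hσ'] at hw
        by_cases h1 : w = x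
        · rw [h1, Pi.add_apply, Pi.smul_apply, edgeDir_left hne, hz, smul_eq_mul] at hw
          linarith
        · by_cases h2 : w = z
          · rw [h2, hz]
          · simpa [edgeDir_of_ne h1 h2] using hw
      · have : σ' z = 0 := hsub hz
        rw [hσ', Pi.add_apply, Pi.smul_apply, edgeDir_right hne, hz, smul_eq_mul] at this
        linarith
    have hR : Continuous fun v : X → ℝ => v + (η - v z) • edgeDir μ x z := by fun_prop
    -- The induction hypothesis at σ', pulled back along the continuous filling map, which sends σ
    -- to σ'.
    have e1 : ∀ᶠ v in 𝓝 σ.val, ∀ ρ : Density μ, ρ.val = v + (η - v z) • edgeDir μ x z →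
        W K μ θ σ' ρ < ε / 3 := by
      have := ih _ hlt σ' rfl (ε / 3) hε3
      rw [hσ'] at this
      exact hR.continuousAt.eventually this
    have e2 : ∀ᶠ v in 𝓝 σ.val, v z < η :=
      (continuous_apply z).continuousAt.eventually (gt_mem_nhds (hz.trans_lt hη0))
    have e3 : ∀ᶠ v in 𝓝 σ.val, 2 * c < v x :=
      (continuous_apply x).continuousAt.eventually
        (lt_mem_nhds (show 2 * c < σ x by rw [hc]; linarith))
    filter_upwards [e1, e2, e3] with v h1 h2 h3 ρ hρ
    subst hρ
    obtain ⟨ρ', hρ', hWρ⟩ := hmove ρ h2.le h3.le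
    calc W K μ θ σ ρ ≤ W K μ θ σ ρ' + W K μ θ ρ' ρ := W_triangle _ _ _
      _ ≤ W K μ θ σ σ' + W K μ θ σ' ρ' + W K μ θ ρ' ρ := by gcongr; exact W_triangle _ _ _
      _ < ε / 3 + ε / 3 + ε / 3 := by
          rw [W_comm ρ' ρ]
          exact ENNReal.add_lt_add (ENNReal.add_lt_add hWσ (h1 ρ' hρ')) hWρ
      _ = ε := ENNReal.add_thirds ε

/-! ### Finiteness of `𝒲` -/

/-- The density of the steady state with respect to itself. -/
def unitDensity (hK : IsReversibleMarkov K μ) : Density μ :=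
  ⟨1, fun _ => zero_le_one, by simpa using hK.steady_sum⟩

theorem W_lt_top_of_Cθ_lt_top (hK : IsReversibleMarkov K μ) (hθ : IsAdmissible θ) (hC : Cθ θ < ⊤)
    (ρ₀ ρ₁ : Density μ) : W K μ θ ρ₀ ρ₁ < ⊤ := by
  -- A small step towards the constant density has finite cost by continuity at σ, and leads to the
  -- positive densities, which form one component.
  have key : ∀ σ : Density μ, W K μ θ σ (unitDensity hK) < ⊤ := fun σ => by
    have h1 := eventually_W_lt hK hθ hC _ σ rfl 1 one_pos
    have hc : Continuous fun t : ℝ => σ.val + t • ((unitDensity hK).val - σ.val) := by fun_prop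
    have h2 : ∀ᶠ t in 𝓝[>] (0 : ℝ), ∀ ρ : Density μ,
        ρ.val = σ.val + t • ((unitDensity hK).val - σ.val) → W K μ θ σ ρ < 1 := by
      have h3 := hc.tendsto 0
      rw [zero_smul, add_zero] at h3
      exact (h3.mono_left nhdsWithin_le_nhds).eventually h1
    obtain ⟨t, h3, ht⟩ := (h2.and (Ioo_mem_nhdsGT one_pos)).exists
    let ρ : Density μ := ⟨_, σ.isDensity.convex (unitDensity hK).isDensity
      (Ioo_subset_Icc_self ht)⟩
    have hρ : ∀ x, 0 < ρ x := fun x => by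
      simp only [ρ, unitDensity, Pi.add_apply, Pi.smul_apply, Pi.sub_apply, Pi.one_apply,
        smul_eq_mul]
      nlinarith [mul_nonneg (sub_nonneg.2 ht.2.le) (σ.isDensity.1 x), ht.1]
    refine (W_triangle σ ρ _).trans_lt (ENNReal.add_lt_top.2 ⟨(h3 ρ rfl).trans ENNReal.one_lt_top,
      ?_⟩)
    exact W_lt_top_of_mem_component hK hθ (mem_component_of_pos hK hθ (fun _ => one_pos) hρ)
  refine (W_triangle ρ₀ (unitDensity hK) ρ₁).trans_lt (ENNReal.add_lt_top.2 ⟨key ρ₀, ?_⟩)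
  rw [W_comm]
  exact key ρ₁

theorem edge_pos_iff (hθ : IsAdmissible θ) {ρ : X → ℝ}
    (hρ : ∀ x, 0 ≤ ρ x) (u v : X) :
    0 < θ (ρ u) (ρ v) * K u v ↔ 0 < ρ u ∧ 0 < ρ v ∧ 0 < K u v := by
  rw [← and_assoc, ← hθ.pos_iff (hρ u) (hρ v)]
  refine ⟨fun h => ?_, fun h => mul_pos h.1 h.2⟩
  have h1 := (hθ.nonneg _ _ (hρ u) (hρ v)).lt_of_ne fun h' => by
    rw [← h', zero_mul] at h; exact h.false
  exact ⟨h1, (pos_iff_pos_of_mul_pos h).1 h1⟩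

theorem Conn.symm (hK : IsReversibleMarkov K μ) (hθ : IsAdmissible θ) {ρ : X → ℝ}
    (hρ : ∀ x, 0 ≤ ρ x) {x y : X} (h : Conn K θ ρ x y) : Conn K θ ρ y x := by
  induction h with
  | refl => exact .refl
  | @tail u v _ huv ih =>
    refine Relation.ReflTransGen.head ?_ ih
    rw [edge_pos_iff hθ hρ] at huv ⊢
    exact ⟨huv.2.1, huv.1, hK.kernel_pos_comm.1 huv.2.2⟩

theorem conn_congr (hθ : IsAdmissible θ) {ρ σ : X → ℝ}
    (hσ : ∀ x, 0 ≤ σ x) (h : ρ ∈ sameSupport σ) : Conn K θ ρ = Conn K θ σ := by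
  unfold Conn
  congr 1
  funext u v
  rw [edge_pos_iff hθ h.1, edge_pos_iff hθ hσ, h.2, h.2]

theorem Conn.eq_of_B_eq_zero (hK : IsReversibleMarkov K μ) (hθ : IsAdmissible θ) {σ φ : X → ℝ}
    (hσ : ∀ x, 0 ≤ σ x) (hφ : B K θ σ φ = 0) {x y : X} (h : Conn K θ σ x y) : φ x = φ y := by
  induction h with
  | refl => rfl
  | @tail u v _ huv ih =>
    have := (edge_pos_iff hθ hσ u v).1 huv
    exact ih.trans ((B_eq_zero_iff hK hθ hσ φ).1 hφ u v this.1 this.2.1 this.2.2)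

/-- The indicator of a class lies in the kernel of `B(σ)`, so its pairing with ρ - σ vanishes. -/
theorem classMass_eq_of_mem_component (hK : IsReversibleMarkov K μ) (hθ : IsAdmissible θ)
    {ρ σ : Density μ} (h : ρ ∈ component K μ θ σ) (x : X) :
    classMass K μ θ ρ x = classMass K μ θ σ x := by
  classical
  have hσ := σ.isDensity.1
  let φ : X → ℝ := fun y => if Conn K θ σ y x then 1 else 0
  have hφ : B K θ σ φ = 0 := by
    rw [B_eq_zero_iff hK hθ hσ]
    intro u v hu hv huv
    have h1 : Conn K θ σ u v := .single ((edge_pos_iff hθ hσ u v).2 ⟨hu, hv, huv⟩)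
    have h2 : Conn K θ σ u x ↔ Conn K θ σ v x :=
      ⟨fun h => (h1.symm hK hθ hσ).trans h, fun h => h1.trans h⟩
    simp only [φ, h2]
  have h1 := (mem_range_B_iff hK hθ hσ).1 h.2 φ hφ
  have h2 : ∀ τ : X → ℝ, pair μ φ τ = ∑ y with Conn K θ σ y x, τ y * μ y := fun τ => by
    rw [pair, Finset.sum_filter]
    refine Finset.sum_congr rfl fun y _ => ?_
    simp only [φ]
    split_ifs <;> ring
  rw [pair_sub_right, sub_eq_zero, h2, h2] at h1
  unfold classMass
  rw [conn_congr hθ hσ h.1]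
  convert h1

/-- An empty vertex is alone in its class, so its class mass is zero. Equal class masses thus force
equal supports. -/
theorem pos_of_classMass_eq (hK : IsReversibleMarkov K μ) (hθ : IsAdmissible θ)
    {ρ σ : Density μ} {x : X} (h : classMass K μ θ ρ x = classMass K μ θ σ x) (hx : 0 < σ x) :
    0 < ρ x := by
  classical
  by_contra hne
  have h0 : ρ x = 0 := le_antisymm (not_lt.1 hne) (ρ.isDensity.1 x)
  have h1 : classMass K μ θ ρ x = 0 := by
    unfold classMass
    refine Finset.sum_eq_zero fun y hy => ?_
    have hc : Conn K θ ρ y x := (Finset.mem_filter.1 hy).2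
    rcases Relation.ReflTransGen.cases_tail hc with rfl | ⟨u, -, hu⟩
    · rw [h0, zero_mul]
    · exact absurd ((edge_pos_iff hθ ρ.isDensity.1 u x).1 hu).2.1 hne
  have h2 : σ x * μ x ≤ classMass K μ θ σ x :=
    Finset.single_le_sum (f := fun y => σ y * μ y)
      (fun y _ => mul_nonneg (σ.isDensity.1 y) (hK.pos y).le)
      (Finset.mem_filter.2 ⟨Finset.mem_univ x, Relation.ReflTransGen.refl⟩)
  have := mul_pos hx (hK.pos x)
  linarith

/-- A function in the kernel is constant on each class, so its pairing with ρ - σ splits into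
differences of class masses. -/
theorem mem_component_of_classMass_eq (hK : IsReversibleMarkov K μ) (hθ : IsAdmissible θ)
    {ρ σ : Density μ} (h : ∀ x, classMass K μ θ ρ x = classMass K μ θ σ x) :
    ρ ∈ component K μ θ σ := by
  classical
  have hσ := σ.isDensity.1
  have hs : ρ.val ∈ sameSupport σ := ⟨ρ.isDensity.1, fun x =>
    ⟨pos_of_classMass_eq hK hθ (h x).symm, pos_of_classMass_eq hK hθ (h x)⟩⟩
  refine ⟨hs, (mem_range_B_iff hK hθ hσ).2 fun φ hφ => ?_⟩
  let s : Setoid X := ⟨Conn K θ σ, fun _ => .refl, fun h => h.symm hK hθ hσ, fun h h' => h.trans h'⟩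
  rw [pair, ← Finset.sum_fiberwise Finset.univ (fun x => (Quotient.mk s x))]
  refine Finset.sum_eq_zero fun j _ => ?_
  induction j using Quotient.inductionOn with
  | _ x =>
  have h1 : ∀ y, Quotient.mk s y = Quotient.mk s x ↔ Conn K θ σ y x := fun y =>
    ⟨fun h => Quotient.exact h, fun h => Quotient.sound h⟩
  simp only [h1]
  have h2 := h x
  unfold classMass at h2
  rw [conn_congr hθ hσ hs] at h2
  calc ∑ y with Conn K θ σ y x, μ y * φ y * (ρ.val - σ.val) y
      = ∑ y with Conn K θ σ y x, φ x * (ρ y * μ y - σ y * μ y) := by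
        refine Finset.sum_congr rfl fun y hy => ?_
        have hc : Conn K θ σ y x := (Finset.mem_filter.1 hy).2
        rw [hc.eq_of_B_eq_zero hK hθ hσ hφ, Pi.sub_apply]
        ring
    _ = 0 := by
        rw [← Finset.mul_sum, Finset.sum_sub_distrib]
        have : ∑ y with Conn K θ σ y x, ρ y * μ y = ∑ y with Conn K θ σ y x, σ y * μ y := by
          convert h2
        rw [this, sub_self, mul_zero]

theorem W_lt_top_iff_mem_component (hK : IsReversibleMarkov K μ) (hθ : IsAdmissible θ)
    (hC : Cθ θ = ⊤) {ρ σ : Density μ} : W K μ θ ρ σ < ⊤ ↔ ρ ∈ component K μ θ σ :=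
  ⟨mem_component_of_W_lt_top hK hθ hC, fun h =>
    (W_comm ρ σ).trans_lt (W_lt_top_of_mem_component hK hθ h)⟩

theorem W_lt_top_iff_classMass (hK : IsReversibleMarkov K μ) (hθ : IsAdmissible θ)
    (hC : Cθ θ = ⊤) (ρ σ : Density μ) :
    W K μ θ ρ σ < ⊤ ↔ ∀ x, classMass K μ θ ρ x = classMass K μ θ σ x := by
  rw [W_lt_top_iff_mem_component hK hθ hC]
  exact ⟨classMass_eq_of_mem_component hK hθ, mem_component_of_classMass_eq hK hθ⟩

/-! ### Topologies on the space of densities -/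

theorem weakTopology_eq (hμ : ∀ x, 0 < μ x) :
    weakTopology μ = TopologicalSpace.induced Density.val inferInstance := by
  classical
  refine le_antisymm ?_ (le_iInf fun φ => ?_)
  · rw [show (inferInstance : TopologicalSpace (X → ℝ)) =
      ⨅ x, TopologicalSpace.induced (fun v : X → ℝ => v x) inferInstance from rfl, induced_iInf]
    refine le_iInf fun x => ?_
    rw [induced_compose]
    have h1 : (fun v : X → ℝ => v x) ∘ Density.val = fun ρ : Density μ =>
        ∑ y, (Pi.single x (μ x)⁻¹ : X → ℝ) y * ρ.val y * μ y := by
      funext ρ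
      rw [Finset.sum_eq_single x]
      · have := (hμ x).ne'
        rw [Pi.single_eq_same, Function.comp_apply]; field_simp
      · intro y _ hy; simp [hy]
      · simp
    rw [h1]
    exact iInf_le (fun φ : X → ℝ => TopologicalSpace.induced
      (fun ρ : Density μ => ∑ x, φ x * ρ.val x * μ x) inferInstance) (Pi.single x (μ x)⁻¹)
  · let _ : TopologicalSpace (Density μ) := TopologicalSpace.induced Density.val inferInstance
    have hval : Continuous (Density.val : Density μ → X → ℝ) := continuous_induced_dom
    refine continuous_iff_le_induced.1 (continuous_finsetSum _ fun x _ => ?_)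
    exact (continuous_const.mul ((continuous_apply x).comp hval)).mul continuous_const

/-- The extended metric space structure on a subset defined by an extended metric. -/
@[reducible] def IsExtendedMetric.toEMetricSpace {M : Type*} {d : M → M → ℝ≥0∞}
    (h : IsExtendedMetric d) (S : Set M) : EMetricSpace S where
  edist a b := d a b
  edist_self a := (h.eq_zero_iff a a).2 rfl
  edist_comm a b := h.symm a b
  edist_triangle a b c := h.triangle a b c
  eq_of_edist_eq_zero {a b} hab := Subtype.ext ((h.eq_zero_iff a b).1 hab)

theorem topology_eq_induced {M Y : Type*} [TopologicalSpace Y] {d : M → M → ℝ≥0∞} {S : Set M}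
    (m : EMetricSpace S) (hm : ∀ a b : S, edist a b = d a b) (f : M → Y)
    (h1 : ∀ a ∈ S, ∀ ε > 0, ∀ᶠ v in 𝓝 (f a), ∀ b ∈ S, f b = v → d a b < ε)
    (h2 : ∀ a ∈ S, ∀ U ∈ 𝓝 (f a), ∃ ε > 0, ∀ b ∈ S, d a b < ε → f b ∈ U) :
    m.toUniformSpace.toTopologicalSpace =
      TopologicalSpace.induced (Subtype.val : S → M)
        (TopologicalSpace.induced f inferInstance) := by
  rw [induced_compose]
  refine TopologicalSpace.ext_nhds fun a => ?_
  rw [nhds_induced]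
  ext U
  rw [EMetric.mem_nhds_iff, Filter.mem_comap]
  constructor
  · rintro ⟨ε, hε, hU⟩
    refine ⟨_, h1 a a.2 ε hε, fun b hb => hU ?_⟩
    rw [Metric.mem_eball', hm]
    exact hb b b.2 rfl
  · rintro ⟨V, hV, hVU⟩
    obtain ⟨ε, hε, h⟩ := h2 a a.2 V hV
    refine ⟨ε, hε, fun b hb => hVU (h b b.2 ?_)⟩
    rwa [Metric.mem_eball', hm] at hb

theorem eventually_W_lt_of_W_lt_top (hK : IsReversibleMarkov K μ) (hθ : IsAdmissible θ)
    (σ : Density μ) {ε : ℝ≥0∞} (hε : 0 < ε) :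
    ∀ᶠ v in 𝓝 σ.val, ∀ ρ : Density μ, W K μ θ ρ σ < ⊤ → ρ.val = v → W K μ θ σ ρ < ε := by
  rcases eq_or_ne (Cθ θ) ⊤ with hC | hC
  · filter_upwards [eventually_W_lt_of_mem_component hK hθ σ hε] with v hv ρ hW hρ
    exact hv ρ hρ (mem_component_of_W_lt_top hK hθ hC hW)
  · filter_upwards [eventually_W_lt hK hθ (lt_top_iff_ne_top.2 hC) _ σ rfl ε hε] with v hv ρ _ hρ
    exact hv ρ hρ

/-- Shared by 𝒲 and `dTV`, both of which control every coordinate linearly. -/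
theorem exists_pos_forall_mem_of_enorm_le {C : ℝ≥0∞} (hC : C ≠ ⊤) (v : X → ℝ) {U : Set (X → ℝ)}
    (hU : U ∈ 𝓝 v) : ∃ ε > (0 : ℝ≥0∞), ∀ w : X → ℝ,
      (∃ d < ε, ∀ x, ‖w x - v x‖ₑ ≤ C * d) → w ∈ U := by
  obtain ⟨δ, hδ, hball⟩ := EMetric.mem_nhds_iff.1 hU
  have hlim : Filter.Tendsto (fun d => C * d) (𝓝 0) (𝓝 0) := by
    simpa using ENNReal.Tendsto.const_mul (Filter.tendsto_id (x := 𝓝 (0 : ℝ≥0∞))) (Or.inr hC)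
  obtain ⟨ε, hε, hεδ⟩ : ∃ ε > (0 : ℝ≥0∞), C * ε < δ := by
    obtain ⟨ε, h1, h2⟩ := (((hlim.mono_left nhdsWithin_le_nhds).eventually
      (gt_mem_nhds hδ)).and (self_mem_nhdsWithin (s := Ioi (0 : ℝ≥0∞)))).exists
    exact ⟨ε, h2, h1⟩
  refine ⟨ε, hε, fun w ⟨d, hd, hw⟩ => hball ?_⟩
  rw [Metric.mem_eball, edist_pi_def]
  refine (Finset.sup_le fun x _ => ?_).trans_lt hεδ
  rw [edist_eq_enorm_sub]
  exact (hw x).trans (mul_le_mul' le_rfl hd.le)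

theorem W_topology_eq (hK : IsReversibleMarkov K μ) (hθ : IsAdmissible θ) {S : Set (Density μ)}
    (hS : ∀ a ∈ S, ∀ b ∈ S, W K μ θ a b < ⊤) (m : EMetricSpace S)
    (hm : ∀ a b : S, edist a b = W K μ θ a b) :
    m.toUniformSpace.toTopologicalSpace = TopologicalSpace.induced (Subtype.val : S → Density μ)
      (TopologicalSpace.induced Density.val inferInstance) := by
  refine topology_eq_induced m hm Density.val (fun a ha ε hε => ?_) (fun a ha U hU => ?_)
  · filter_upwards [eventually_W_lt_of_W_lt_top hK hθ a hε] with v hv b hb hbv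
    exact hv b (hS b hb a ha) hbv
  · obtain ⟨C, hCtop, hC⟩ := exists_enorm_apply_sub_le_W hK hθ
    obtain ⟨ε, hε, h⟩ := exists_pos_forall_mem_of_enorm_le hCtop a.val hU
    exact ⟨ε, hε, fun b _ hab => h b.val ⟨_, hab, hC a b⟩⟩

theorem finiteDist_lt_top {σ : Density μ} : ∀ a ∈ finiteDist K μ θ σ, ∀ b ∈ finiteDist K μ θ σ,
    W K μ θ a b < ⊤ := fun a ha b hb =>
  (W_triangle a σ b).trans_lt (ENNReal.add_lt_top.2 ⟨ha, (W_comm σ b).trans_lt hb⟩)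

theorem metrizesOn_W (hK : IsReversibleMarkov K μ) (hθ : IsAdmissible θ) (σ : Density μ) :
    MetrizesOn (W K μ θ) (finiteDist K μ θ σ) (weakTopology μ) := by
  refine ⟨(isExtendedMetric_W hK hθ).toEMetricSpace _, fun a b => rfl, ?_⟩
  rw [weakTopology_eq hK.pos]
  exact W_topology_eq hK hθ finiteDist_lt_top _ fun _ _ => rfl

theorem isExtendedMetric_dTV (hμ : ∀ x, 0 < μ x) : IsExtendedMetric (dTV μ) where
  eq_zero_iff a b := by
    have hnn : ∀ x ∈ Finset.univ, 0 ≤ μ x * |a x - b x| := fun x _ =>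
      mul_nonneg (hμ x).le (abs_nonneg _)
    constructor
    · intro h
      have h1 := le_antisymm (ENNReal.ofReal_eq_zero.1 h) (Finset.sum_nonneg hnn)
      have : a.val = b.val := funext fun x => by
        have := (Finset.sum_eq_zero_iff_of_nonneg hnn).1 h1 x (Finset.mem_univ x)
        simpa [(hμ x).ne', sub_eq_zero] using this
      cases a; cases b; simp_all
    · rintro rfl; simp [dTV]
  symm a b := by simp only [dTV, abs_sub_comm]
  triangle a b c := by
    rw [dTV, dTV, dTV, ← ENNReal.ofReal_add
      (Finset.sum_nonneg fun x _ => mul_nonneg (hμ x).le (abs_nonneg _))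
      (Finset.sum_nonneg fun x _ => mul_nonneg (hμ x).le (abs_nonneg _)), ← Finset.sum_add_distrib]
    refine ENNReal.ofReal_le_ofReal (Finset.sum_le_sum fun x _ => ?_)
    rw [← mul_add]
    exact mul_le_mul_of_nonneg_left (abs_sub_le _ _ _) (hμ x).le

theorem metrizesOn_dTV (hK : IsReversibleMarkov K μ) (S : Set (Density μ)) :
    MetrizesOn (dTV μ) S (weakTopology μ) := by
  refine ⟨(isExtendedMetric_dTV hK.pos).toEMetricSpace _, fun a b => rfl, ?_⟩
  rw [weakTopology_eq hK.pos]
  refine topology_eq_induced (d := dTV μ) _ (fun _ _ => rfl) Density.val (fun a ha ε hε => ?_)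
    (fun a ha U hU => ?_)
  · have hc : Continuous fun v : X → ℝ => ENNReal.ofReal (∑ x, μ x * |a x - v x|) :=
      ENNReal.continuous_ofReal.comp (by fun_prop)
    have h1 : ∀ᶠ v in 𝓝 a.val, ENNReal.ofReal (∑ x, μ x * |a x - v x|) < ε :=
      hc.continuousAt.eventually (gt_mem_nhds (by simpa using hε))
    filter_upwards [h1] with v hv b _ hb
    subst hb
    exact hv
  · have hCtop : (∑ x, ENNReal.ofReal (μ x)⁻¹) ≠ ⊤ :=
      ENNReal.sum_ne_top.2 fun x _ => ENNReal.ofReal_ne_top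
    obtain ⟨ε, hε, h⟩ := exists_pos_forall_mem_of_enorm_le hCtop a.val hU
    refine ⟨ε, hε, fun b _ hab => h b.val ⟨_, hab, fun x => ?_⟩⟩
    have h1 : ENNReal.ofReal (μ x)⁻¹ ≤ ∑ x, ENNReal.ofReal (μ x)⁻¹ :=
      Finset.single_le_sum (f := fun x => ENNReal.ofReal (μ x)⁻¹) (fun _ _ => zero_le)
        (Finset.mem_univ x)
    refine le_trans ?_ (mul_le_mul' h1 le_rfl)
    rw [dTV, ← ENNReal.ofReal_mul (inv_pos.2 (hK.pos x)).le, Real.enorm_eq_ofReal_abs, abs_sub_comm]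
    refine ENNReal.ofReal_le_ofReal ?_
    rw [← div_eq_inv_mul, le_div_iff₀ (hK.pos x), mul_comm]
    exact Finset.single_le_sum (f := fun x => μ x * |a x - b x|)
      (fun x _ => mul_nonneg (hK.pos x).le (abs_nonneg _)) (Finset.mem_univ x)

/-! ### Riemannian metrics in a global chart -/

section GlobalChart

variable {E : Type*} [NormedAddCommGroup E] [NormedSpace ℝ E]
  {M : Type*} [TopologicalSpace M] [Nonempty M] {e : M → E}

theorem contMDiffOn_singleton_iff (h : IsOpenEmbedding e) {n : ℕ∞ω} {γ : ℝ → M} {s : Set ℝ} :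
    letI := h.singletonChartedSpace
    ContMDiffOn 𝓘(ℝ) 𝓘(ℝ, E) n γ s ↔ ContDiffOn ℝ n (e ∘ γ) s := by
  let _ := h.singletonChartedSpace
  refine ⟨fun hγ => ?_, fun hγ => ?_⟩
  · exact contMDiffOn_iff_contDiffOn.1
      ((contMDiff_isOpenEmbedding (I := 𝓘(ℝ, E)) (n := n) h).comp_contMDiffOn hγ)
  · have h1 := (contMDiffOn_isOpenEmbedding_symm (I := 𝓘(ℝ, E)) (n := n) h).comp
      (contMDiffOn_iff_contDiffOn.2 hγ) (fun t _ => mem_range_self (γ t))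
    refine h1.congr fun t _ => ?_
    exact (h.toOpenPartialHomeomorph_left_inv e).symm

theorem mfderivWithin_singleton_apply_one (h : IsOpenEmbedding e) {γ : ℝ → M} {s : Set ℝ} {t : ℝ} :
    letI := h.singletonChartedSpace
    MDifferentiableWithinAt 𝓘(ℝ) 𝓘(ℝ, E) γ s t →
      (mfderivWithin 𝓘(ℝ) 𝓘(ℝ, E) γ s t (1 : ℝ) : E) = derivWithin (e ∘ γ) s t := by
  let _ := h.singletonChartedSpace
  intro hd
  have h1 : (mfderivWithin 𝓘(ℝ) 𝓘(ℝ, E) γ s t : ℝ →L[ℝ] E) =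
      fderivWithin ℝ (writtenInExtChartAt 𝓘(ℝ) 𝓘(ℝ, E) t γ)
        ((extChartAt 𝓘(ℝ) t).symm ⁻¹' s ∩ range 𝓘(ℝ)) ((extChartAt 𝓘(ℝ) t) t) := if_pos hd
  have h2 : writtenInExtChartAt 𝓘(ℝ) 𝓘(ℝ, E) t γ = e ∘ γ := by
    ext; rfl
  rw [h2] at h1
  refine (congrArg (fun L : ℝ →L[ℝ] E => L 1) h1).trans ?_
  simp [derivWithin, chartAt_self_eq]

/-- With a single chart, the only coordinate change is the one from the chart to itself. -/
theorem symmL_singleton (h : IsOpenEmbedding e) (a b : M) :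
    letI := h.singletonChartedSpace
    ∀ [IsManifold 𝓘(ℝ, E) 1 M],
    (trivializationAt E (TangentSpace 𝓘(ℝ, E)) a).symmL ℝ b = ContinuousLinearMap.id ℝ E := by
  let _ := h.singletonChartedSpace
  intro _
  rw [TangentBundle.symmL_trivializationAt_eq_core (by exact mem_univ b)]
  ext v
  exact (tangentBundleCore 𝓘(ℝ, E) M).coordChange_self (achart E b) b (mem_chart_source E b) v

/-- The Riemannian metric on a manifold with a single global chart which is given, in this chart,
by `G`. -/
def metricOfChart (h : IsOpenEmbedding e) (G : E → E →L[ℝ] E →L[ℝ] ℝ)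
    (symm : ∀ x v w, G (e x) v w = G (e x) w v) (pos : ∀ x v, v ≠ 0 → 0 < G (e x) v v)
    (bdd : ∀ x, Bornology.IsVonNBounded ℝ {v : E | G (e x) v v < 1})
    {k : ℕ∞ω} (smooth : ContDiffOn ℝ k G (range e)) :
    letI := h.singletonChartedSpace
    letI : IsManifold 𝓘(ℝ, E) ∞ M := h.isManifold_singleton
    ContMDiffRiemannianMetric 𝓘(ℝ, E) k E (fun x : M => TangentSpace 𝓘(ℝ, E) x) :=
  letI := h.singletonChartedSpace
  letI : IsManifold 𝓘(ℝ, E) ∞ M := h.isManifold_singleton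
  { inner := fun x => G (e x)
    symm := symm
    pos := pos
    isVonNBounded := bdd
    contMDiff := by
      intro x
      have h1 : ContMDiff 𝓘(ℝ, E) 𝓘(ℝ, E →L[ℝ] E →L[ℝ] ℝ) k (fun y : M => G (e y)) := by
        rw [← contMDiffOn_univ]
        exact (contMDiffOn_iff_contDiffOn.2 smooth).comp
          (contMDiff_isOpenEmbedding (I := 𝓘(ℝ, E)) (n := k) h).contMDiffOn
          (fun y _ => mem_range_self y)
      refine (contMDiffAt_section x).2 ((h1 x).congr_of_eventuallyEq (.of_eq ?_))
      funext y
      ext v w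
      have hs : ∀ u : E, ((trivializationAt E (TangentSpace 𝓘(ℝ, E)) x).symm y u : E) = u := by
        intro u
        rw [← Trivialization.symmL_apply (R := ℝ) _ (by exact mem_univ y)]
        exact congrArg (fun L : E →L[ℝ] E => L u) (symmL_singleton h x y)
      rw [hom_trivializationAt_apply]
      refine (inCoordinates_apply_eq₂ (F₃ := ℝ) (E₃ := Bundle.Trivial M ℝ) (by exact mem_univ y)
        (by exact mem_univ y) (by exact mem_univ y)).trans ?_
      simp only [Bundle.Trivial.linearMapAt_trivialization, Bundle.Trivial.eq_trivialization]
      exact congrArg₂ (fun u u' => G (e y) u u') (hs v) (hs w) }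

theorem enorm_metricOfChart (h : IsOpenEmbedding e) {G : E → E →L[ℝ] E →L[ℝ] ℝ}
    {symm : ∀ x v w, G (e x) v w = G (e x) w v} {pos : ∀ x v, v ≠ 0 → 0 < G (e x) v v}
    {bdd : ∀ x, Bornology.IsVonNBounded ℝ {v : E | G (e x) v v < 1}}
    {k : ℕ∞ω} {smooth : ContDiffOn ℝ k G (range e)} (x : M) :
    letI := h.singletonChartedSpace
    letI : IsManifold 𝓘(ℝ, E) ∞ M := h.isManifold_singleton
    letI : RiemannianBundle (fun x : M => TangentSpace 𝓘(ℝ, E) x) :=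
      ⟨(metricOfChart h G symm pos bdd smooth).toRiemannianMetric⟩
    ∀ v : TangentSpace 𝓘(ℝ, E) x,
      ‖v‖ₑ = ENNReal.ofReal √(G (e x) v v) := by
  let _ := h.singletonChartedSpace
  have _ : IsManifold 𝓘(ℝ, E) ∞ M := h.isManifold_singleton
  let _ : RiemannianBundle (fun x : M => TangentSpace 𝓘(ℝ, E) x) :=
      ⟨(metricOfChart h G symm pos bdd smooth).toRiemannianMetric⟩
  intro v
  rw [← ofReal_norm, norm_eq_sqrt_real_inner]
  rfl

end GlobalChart

section Distance

variable {E : Type*} [NormedAddCommGroup E] [NormedSpace ℝ E]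
  {M : Type*} [EMetricSpace M] [Nonempty M] {e : M → E}

/-- Reduction to the chart. Approximating curves may be piecewise C¹ and need only end near a and b:
the triangle inequality for the Riemannian distance joins the pieces and closes the gaps. -/
theorem isRiemannianManifold_metricOfChart (h : IsOpenEmbedding e) {G : E → E →L[ℝ] E →L[ℝ] ℝ}
    {symm : ∀ x v w, G (e x) v w = G (e x) w v} {pos : ∀ x v, v ≠ 0 → 0 < G (e x) v v}
    {bdd : ∀ x, Bornology.IsVonNBounded ℝ {v : E | G (e x) v v < 1}}
    {k : ℕ∞} {smooth : ContDiffOn ℝ k G (range e)}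
    (edist_le : ∀ γ : ℝ → M, ContDiffOn ℝ 1 (e ∘ γ) (Icc 0 1) →
      edist (γ 0) (γ 1) ≤ ∫⁻ t in Icc (0 : ℝ) 1, ENNReal.ofReal
        √(G (e (γ t)) (derivWithin (e ∘ γ) (Icc 0 1) t) (derivWithin (e ∘ γ) (Icc 0 1) t)))
    (exists_lt : ∀ (a b : M) (c : ℝ≥0∞), edist a b < c → ∀ U ∈ 𝓝 a, ∀ V ∈ 𝓝 b, ∃ γ : ℝ → M,
      γ 0 ∈ U ∧ γ 1 ∈ V ∧
      (∃ (n : ℕ) (τ : ℕ → ℝ), Monotone τ ∧ τ 0 = 0 ∧ τ n = 1 ∧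
        ∀ i < n, ContDiffOn ℝ 1 (e ∘ γ) (Icc (τ i) (τ (i + 1)))) ∧
      ∫⁻ t in Icc (0 : ℝ) 1,
        ENNReal.ofReal √(G (e (γ t)) (deriv (e ∘ γ) t) (deriv (e ∘ γ) t)) < c) :
    letI := h.singletonChartedSpace
    letI : IsManifold 𝓘(ℝ, E) ∞ M := h.isManifold_singleton
    letI : RiemannianBundle (fun x : M => TangentSpace 𝓘(ℝ, E) x) :=
      ⟨(metricOfChart h G symm pos bdd smooth).toRiemannianMetric⟩
    IsRiemannianManifold 𝓘(ℝ, E) M := by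
  let _ := h.singletonChartedSpace
  have _ : IsManifold 𝓘(ℝ, E) ∞ M := h.isManifold_singleton
  have _ : IsManifold 𝓘(ℝ, E) 1 M := h.isManifold_singleton
  let g := metricOfChart h G symm pos bdd smooth
  let _ : RiemannianBundle (fun x : M => TangentSpace 𝓘(ℝ, E) x) := ⟨g.toRiemannianMetric⟩
  have _ : IsContinuousRiemannianBundle E (fun x : M => TangentSpace 𝓘(ℝ, E) x) :=
    ⟨g.inner, g.contMDiff.continuous, fun _ _ _ => rfl⟩
  have hN := enorm_metricOfChart h (symm := symm) (pos := pos) (bdd := bdd) (smooth := smooth)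
  refine ⟨fun x y => le_antisymm ?_ ?_⟩
  · refine le_of_forall_gt fun r hr => ?_
    obtain ⟨γ, rfl, rfl, hγ, hr⟩ := exists_lt_of_riemannianEDist_lt hr
    refine lt_of_le_of_lt ?_ hr
    refine (edist_le γ ((contMDiffOn_singleton_iff h).1 hγ)).trans_eq ?_
    rw [pathELength_eq_lintegral_mfderivWithin_Icc]
    refine setLIntegral_congr_fun measurableSet_Icc fun t ht => ?_
    refine Eq.trans ?_ (hN (γ t) _).symm
    have h1 := mfderivWithin_singleton_apply_one h
      ((hγ.mdifferentiableOn one_ne_zero) t ht)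
    exact congrArg (fun v : E => ENNReal.ofReal √(G (e (γ t)) v v)) h1.symm
  · have key : ∀ γ : ℝ → M, (∃ (n : ℕ) (τ : ℕ → ℝ), Monotone τ ∧ τ 0 = 0 ∧ τ n = 1 ∧
        ∀ i < n, ContDiffOn ℝ 1 (e ∘ γ) (Icc (τ i) (τ (i + 1)))) →
        riemannianEDist 𝓘(ℝ, E) (γ 0) (γ 1) ≤ ∫⁻ t in Icc (0 : ℝ) 1,
          ENNReal.ofReal √(G (e (γ t)) (deriv (e ∘ γ) t) (deriv (e ∘ γ) t)) := by
      rintro γ ⟨n, τ, hτ, h0, h1, hγ⟩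
      have hind : ∀ i ≤ n, riemannianEDist 𝓘(ℝ, E) (γ (τ 0)) (γ (τ i)) ≤
          pathELength 𝓘(ℝ, E) γ (τ 0) (τ i) := by
        intro i hi
        induction i with
        | zero => simp [riemannianEDist_self]
        | succ i ih =>
          refine (riemannianEDist_triangle (y := γ (τ i))).trans ?_
          rw [← pathELength_add (hτ (Nat.zero_le i)) (hτ (Nat.le_succ i))]
          exact add_le_add (ih (by lia)) (riemannianEDist_le_pathELength
            ((contMDiffOn_singleton_iff h).2 (hγ i (by lia))) rfl rfl (hτ (Nat.le_succ i)))
      have h2 := hind n le_rfl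
      rw [h0, h1, pathELength_eq_lintegral_mfderiv_Icc] at h2
      refine h2.trans (lintegral_mono fun t => ?_)
      refine (hN (γ t) _).trans_le ?_
      by_cases hd : MDifferentiableAt 𝓘(ℝ) 𝓘(ℝ, E) γ t
      · have h1 := mfderivWithin_singleton_apply_one (s := univ) h hd.mdifferentiableWithinAt
        rw [mfderivWithin_univ, derivWithin_univ] at h1
        exact (congrArg (fun v : E => ENNReal.ofReal √(G (e (γ t)) v v)) h1).le
      -- At times without derivative `mfderiv` is zero by convention and adds no length.
      · have h1 : (mfderiv 𝓘(ℝ) 𝓘(ℝ, E) γ t (1 : ℝ) : E) = 0 :=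
          congrArg (fun L : ℝ →L[ℝ] E => L 1) (mfderiv_zero_of_not_mdifferentiableAt hd)
        refine (congrArg (fun v : E => ENNReal.ofReal √(G (e (γ t)) v v)) h1).trans_le ?_
        change ENNReal.ofReal √(G (e (γ t)) (0 : E) (0 : E)) ≤ _
        rw [map_zero]
        simp
    refine le_of_forall_gt fun c hc => ?_
    -- The gap between `edist x y` and c is shared among the curve and the two detours at its ends.
    obtain ⟨ε', hε', δ, hδ, hδc'⟩ := ENNReal.exists_add_lt_of_add_lt
      (show edist x y + 0 + 0 < c by simpa using hc)
    obtain ⟨ε, hε, δ', hδ', hεδ⟩ :=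
      ENNReal.exists_add_lt_of_add_lt (show edist x y + 0 < ε' from hε')
    have hδc : ε + δ' + δ < c := lt_of_le_of_lt (by gcongr) hδc'
    obtain ⟨γ, h0, h1, hγ, hlt⟩ := exists_lt x y ε hε
      _ (eventually_riemannianEDist_lt 𝓘(ℝ, E) x hδ')
      _ (eventually_riemannianEDist_lt 𝓘(ℝ, E) y hδ)
    calc riemannianEDist 𝓘(ℝ, E) x y
        ≤ riemannianEDist 𝓘(ℝ, E) x (γ 0) + riemannianEDist 𝓘(ℝ, E) (γ 0) y :=
          riemannianEDist_triangle
      _ ≤ riemannianEDist 𝓘(ℝ, E) x (γ 0) + (riemannianEDist 𝓘(ℝ, E) (γ 0) (γ 1) +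
          riemannianEDist 𝓘(ℝ, E) (γ 1) y) := by gcongr; exact riemannianEDist_triangle
      _ ≤ δ' + (ε + δ) := by
          gcongr
          · exact le_of_lt h0
          · exact (key γ hγ).trans hlt.le
          · rw [riemannianEDist_comm]; exact le_of_lt h1
      _ = ε + δ' + δ := by ring
      _ < c := hδc

end Distance

/-! ### The metric tensor -/

section Metric

variable {E : Type*} [NormedAddCommGroup E] [NormedSpace ℝ E]

/-- The pairing `⟨φ, ι u⟩_μ` as a continuous bilinear map. -/
def pairL (μ : X → ℝ) (ι : E →L[ℝ] X → ℝ) : (X → ℝ) →L[ℝ] E →L[ℝ] ℝ :=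
  ∑ x, μ x • (ContinuousLinearMap.proj (R := ℝ) (φ := fun _ : X => ℝ) x).smulRight
    ((ContinuousLinearMap.proj (R := ℝ) (φ := fun _ : X => ℝ) x) ∘L ι)

theorem pairL_apply (ι : E →L[ℝ] X → ℝ) (φ : X → ℝ) (u : E) :
    pairL μ ι φ u = pair μ φ (ι u) := by
  simp [pairL, pair, sum_apply, smul_apply, mul_assoc]

/-- The metric tensor `⟨v, w⟩ = ⟨B(ρ)⁻¹ v, w⟩_μ` at `ρ = σ + u`, on a space `E` which is mapped by
`ι` to the tangent directions. -/
def tangentMetric (hK : IsReversibleMarkov K μ) (hθ : IsAdmissible θ) {σ : X → ℝ}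
    (hσ : ∀ x, 0 ≤ σ x) (ι : E →L[ℝ] X → ℝ) (u : E) : E →L[ℝ] E →L[ℝ] ℝ :=
  pairL μ ι ∘L invB hK hθ hσ (σ + ι u) ∘L ι

variable (hK : IsReversibleMarkov K μ) (hθ : IsAdmissible θ) {σ : X → ℝ} (hσ : ∀ x, 0 ≤ σ x)
  {ι : E →L[ℝ] X → ℝ} (hι : ∀ v, ι v ∈ tangentDirections K θ σ) {u : E}
  (hu : σ + ι u ∈ sameSupport σ)

include hι hu

theorem tangentMetric_eq_gradInner {v w : E} {φ ψ : X → ℝ}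
    (hφ : B K θ (σ + ι u) φ = ι v) (hψ : B K θ (σ + ι u) ψ = ι w) :
    tangentMetric hK hθ hσ ι u v w = gradInner K μ θ (σ + ι u) φ ψ := by
  have h1 : tangentMetric hK hθ hσ ι u v w =
      pair μ (invB hK hθ hσ (σ + ι u) (ι v)) (ι w) := pairL_apply _ _ _
  rw [h1, ← hψ, pair_B hK hθ hu.1, gradInner_comm, ← pair_B hK hθ hu.1,
    B_invB hK hθ hσ hu (hι v), ← hφ, pair_B hK hθ hu.1, gradInner_comm]

include hK hθ hσ in
theorem exists_B_eq (v : E) : ∃ φ, B K θ (σ + ι u) φ = ι v :=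
  ⟨_, B_invB hK hθ hσ hu (hι v)⟩

theorem tangentMetric_symm (v w : E) :
    tangentMetric hK hθ hσ ι u v w = tangentMetric hK hθ hσ ι u w v := by
  obtain ⟨φ, hφ⟩ := exists_B_eq hK hθ hσ hι hu v
  obtain ⟨ψ, hψ⟩ := exists_B_eq hK hθ hσ hι hu w
  rw [tangentMetric_eq_gradInner hK hθ hσ hι hu hφ hψ,
    tangentMetric_eq_gradInner hK hθ hσ hι hu hψ hφ, gradInner_comm]

theorem pair_sq_le_tangentMetric (v : E) (φ : X → ℝ) :
    pair μ φ (ι v) ^ 2 ≤ tangentMetric hK hθ hσ ι u v v * gradInner K μ θ (σ + ι u) φ φ := by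
  obtain ⟨ψ, hψ⟩ := exists_B_eq hK hθ hσ hι hu v
  rw [tangentMetric_eq_gradInner hK hθ hσ hι hu hψ hψ, ← hψ]
  exact pair_B_sq_le hK hθ hu.1 φ ψ

theorem tangentMetric_nonneg (v : E) : 0 ≤ tangentMetric hK hθ hσ ι u v v := by
  obtain ⟨ψ, hψ⟩ := exists_B_eq hK hθ hσ hι hu v
  rw [tangentMetric_eq_gradInner hK hθ hσ hι hu hψ hψ]
  exact gradInner_self_nonneg hK hθ hu.1 ψ

theorem tangentMetric_le {v : E} {A : ℝ} (hA : 0 ≤ A)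
    (h : ∀ φ, pair μ φ (ι v) ^ 2 ≤ A * gradInner K μ θ (σ + ι u) φ φ) :
    tangentMetric hK hθ hσ ι u v v ≤ A := by
  obtain ⟨ψ, hψ⟩ := exists_B_eq hK hθ hσ hι hu v
  rw [tangentMetric_eq_gradInner hK hθ hσ hι hu hψ hψ]
  exact gradInner_le_of_pair_sq_le hK hθ hu.1 hA (hψ ▸ h ψ)

theorem tangentMetric_pos (hinj : Function.Injective ι) {v : E} (hv : v ≠ 0) :
    0 < tangentMetric hK hθ hσ ι u v v := by
  refine (tangentMetric_nonneg hK hθ hσ hι hu v).lt_of_ne fun h0 => hv ?_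
  have h := pair_sq_le_tangentMetric hK hθ hσ hι hu v (ι v)
  rw [← h0, zero_mul] at h
  exact hinj ((pair_self_eq_zero hK.pos (pow_eq_zero_iff two_ne_zero |>.1
    (le_antisymm h (sq_nonneg _)))).trans (map_zero ι).symm)

/-- Testing with coordinate indicators bounds every coordinate of v by its metric norm. -/
theorem isVonNBounded_tangentMetric (hn : ∀ v, ‖ι v‖ = ‖v‖) :
    Bornology.IsVonNBounded ℝ {v | tangentMetric hK hθ hσ ι u v v < 1} := by
  rw [NormedSpace.isVonNBounded_iff, isBounded_iff_forall_norm_le]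
  have hC : ∀ φ, 0 ≤ gradInner K μ θ (σ + ι u) φ φ := gradInner_self_nonneg hK hθ hu.1
  classical
  have hs : ∀ (x : X) (w : X → ℝ), pair μ (Pi.single x 1) w = μ x * w x := fun x w => by
    rw [pair, Finset.sum_eq_single x (fun y _ hy => by simp [hy]) (by simp)]
    simp
  refine ⟨∑ x, √(gradInner K μ θ (σ + ι u) (Pi.single x 1) (Pi.single x 1)) / μ x, fun v hv => ?_⟩
  have hnn : ∀ x ∈ Finset.univ,
      0 ≤ √(gradInner K μ θ (σ + ι u) (Pi.single x 1) (Pi.single x 1)) / μ x := fun x _ =>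
    div_nonneg (Real.sqrt_nonneg _) (hK.pos x).le
  rw [← hn, pi_norm_le_iff_of_nonneg (Finset.sum_nonneg hnn)]
  intro x
  refine le_trans ?_ (Finset.single_le_sum hnn (Finset.mem_univ x))
  rw [le_div_iff₀ (hK.pos x), Real.norm_eq_abs]
  refine Real.le_sqrt_of_sq_le ?_
  have h := pair_sq_le_tangentMetric hK hθ hσ hι hu v (Pi.single x 1)
  rw [hs] at h
  calc (|ι v x| * μ x) ^ 2 = (μ x * ι v x) ^ 2 := by rw [mul_pow, sq_abs]; ring
    _ ≤ _ := h
    _ ≤ 1 * _ := mul_le_mul_of_nonneg_right (le_of_lt hv) (hC _)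
    _ = _ := one_mul _

omit hι hu in
theorem contDiffOn_tangentMetric {n : ℕ∞ω}
    (h : ContDiffOn ℝ n (fun p : ℝ × ℝ => θ p.1 p.2) (Ioi 0 ×ˢ Ioi 0)) :
    ContDiffOn ℝ n (tangentMetric hK hθ hσ ι) {u | σ + ι u ∈ sameSupport σ} := by
  have h1 : ContDiffOn ℝ n (fun u : E => invB hK hθ hσ (σ + ι u))
      {u | σ + ι u ∈ sameSupport σ} :=
    (contDiffOn_invB hK hθ hσ h).comp
      (contDiff_const.add ι.contDiff).contDiffOn fun u hu => hu
  exact contDiffOn_const.clm_comp (h1.clm_comp contDiffOn_const)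

end Metric

/-! ### The length of a curve -/

/-- A bound by maximal speed times duration on each subinterval becomes, by subdivision, a bound by
the integral of the speed. -/
theorem le_lintegral_of_le_mul {D : ℝ → ℝ → ℝ≥0∞} (tri : ∀ a b c, D a c ≤ D a b + D b c) {N : ℝ → ℝ}
    (hN : ContinuousOn N (Icc 0 1))
    (hD : ∀ a b, 0 ≤ a → a ≤ b → b ≤ 1 → ∀ A, 0 ≤ A → (∀ t ∈ Ioo a b, N t ≤ A) →
      D a b ≤ ENNReal.ofReal ((b - a) * A)) (hN0 : ∀ t ∈ Icc (0 : ℝ) 1, 0 ≤ N t) :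
    D 0 1 ≤ ∫⁻ t in Icc (0 : ℝ) 1, ENNReal.ofReal (N t) := by
  refine ENNReal.le_of_forall_pos_le_add fun ε hε _ => ?_
  obtain ⟨δ, hδ, huc⟩ := Metric.uniformContinuousOn_iff_le.1
    (isCompact_Icc.uniformContinuousOn_of_continuous hN) ε (by exact_mod_cast hε)
  obtain ⟨n, hn⟩ := exists_nat_gt (1 / δ)
  have hn0 : (0 : ℝ) < n := (one_div_pos.2 hδ).trans hn
  have hnδ : (1 : ℝ) / n ≤ δ := by
    rw [div_le_iff₀ hn0]; rw [div_lt_iff₀ hδ] at hn; linarith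
  have hind : ∀ i : ℕ, i ≤ n → D 0 (i / n) ≤
      ∫⁻ t in Ioc (0 : ℝ) (i / n), (ENNReal.ofReal (N t) + ε) := by
    intro i hi
    induction i with
    | zero => simpa using hD 0 0 le_rfl le_rfl zero_le_one 0 le_rfl (by simp)
    | succ i ih =>
      have h0 : (0 : ℝ) ≤ i / n := by positivity
      have hlen : ((i + 1 : ℕ) : ℝ) / n - i / n = 1 / n := by push_cast; ring
      have h1 : (i : ℝ) / n ≤ (i + 1 : ℕ) / n := by
        have : (0 : ℝ) ≤ 1 / n := by positivity
        linarith
      have h2 : ((i + 1 : ℕ) : ℝ) / n ≤ 1 := by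
        rw [div_le_one hn0]; exact_mod_cast hi
      -- The minimum works on both sides: the speed is at most N(s) + ε by uniform continuity, and
      -- the integral is at least N(s) times the duration.
      obtain ⟨s, hs, hmin⟩ := isCompact_Icc.exists_isMinOn (nonempty_Icc.2 h1)
        (hN.mono (Icc_subset_Icc h0 h2))
      have hs' : s ∈ Icc (0 : ℝ) 1 := ⟨h0.trans hs.1, hs.2.trans h2⟩
      refine (tri 0 (i / n) _).trans ?_
      rw [← Ioc_union_Ioc_eq_Ioc h0 h1, lintegral_union measurableSet_Ioc
        (Ioc_disjoint_Ioc_of_le le_rfl)]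
      refine add_le_add (ih (by lia)) ?_
      refine (hD _ _ h0 h1 h2 (N s + ε) (add_nonneg (hN0 s hs') ε.2) fun t ht => ?_).trans ?_
      · have := huc t ⟨h0.trans ht.1.le, ht.2.le.trans h2⟩ s hs' (by
          rw [Real.dist_eq, abs_le]
          constructor <;> linarith [hs.1, hs.2, ht.1, ht.2])
        rw [Real.dist_eq] at this
        linarith [le_abs_self (N t - N s)]
      · calc ENNReal.ofReal ((((i + 1 : ℕ) : ℝ) / n - i / n) * (N s + ε))
            = ∫⁻ t in Ioc ((i : ℝ) / n) ((i + 1 : ℕ) / n), (ENNReal.ofReal (N s) + ε) := by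
              rw [setLIntegral_const, Real.volume_Ioc, mul_comm (_ - _),
                ENNReal.ofReal_mul (add_nonneg (hN0 s hs') ε.coe_nonneg),
                ENNReal.ofReal_add (hN0 s hs') ε.coe_nonneg, ENNReal.ofReal_coe_nnreal]
          _ ≤ _ := setLIntegral_mono' measurableSet_Ioc fun t ht => by
              gcongr
              exact hmin ⟨ht.1.le, ht.2⟩
  have := hind n le_rfl
  rw [div_self hn0.ne'] at this
  refine this.trans ?_
  rw [lintegral_add_right _ measurable_const, setLIntegral_const, restrict_Ioc_eq_restrict_Icc]
  simp

/-! ### The Riemannian structure on a component -/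

theorem W_lt_top_of_mem_component_of_mem_component (hK : IsReversibleMarkov K μ)
    (hθ : IsAdmissible θ) {σ : Density μ} : ∀ a ∈ component K μ θ σ, ∀ b ∈ component K μ θ σ,
      W K μ θ a b < ⊤ := fun a ha b hb =>
  (W_triangle a σ b).trans_lt (ENNReal.add_lt_top.2
    ⟨(W_comm a σ).trans_lt (W_lt_top_of_mem_component hK hθ ha),
      W_lt_top_of_mem_component hK hθ hb⟩)

section Chart

variable {E : Type*} [NormedAddCommGroup E] [NormedSpace ℝ E] {σ : Density μ}
  {S : Set (Density μ)} {ι : E →L[ℝ] X → ℝ} {e : S → E}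

theorem add_chart (he : ∀ ρ : S, ι (e ρ) = ρ.1.val - σ.val) (ρ : S) :
    σ.val + ι (e ρ) = ρ.1.val := by
  rw [he]; abel

theorem isDensity_add (hK : IsReversibleMarkov K μ) (hθ : IsAdmissible θ) {u : X → ℝ}
    (hu : u ∈ tangentDirections K θ σ) (h : ∀ x, 0 < σ x → 0 < σ x + u x) :
    IsDensity μ (σ.val + u) ∧ σ.val + u ∈ sameSupport σ.val := by
  have h0 : ∀ x, ¬ 0 < σ x → σ x + u x = 0 := fun x hx => by
    rw [eq_zero_of_mem_range_B hθ σ.isDensity.1 hu hx,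
      le_antisymm (not_lt.1 hx) (σ.isDensity.1 x), add_zero]
  have hnn : ∀ x, 0 ≤ σ x + u x := fun x => by
    by_cases hx : 0 < σ x
    · exact (h x hx).le
    · exact (h0 x hx).ge
  refine ⟨⟨hnn, ?_⟩, hnn, fun x => ⟨fun hx => ?_, h x⟩⟩
  · have h1 := (mem_range_B_iff hK hθ σ.isDensity.1).1 hu 1
      ((B_eq_zero_iff hK hθ σ.isDensity.1 1).2 fun _ _ _ _ _ => rfl)
    simp only [pair, Pi.one_apply, mul_one] at h1
    simp only [Pi.add_apply, mul_add, Finset.sum_add_distrib, h1, σ.isDensity.2, add_zero]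
  · by_contra hx'
    exact absurd hx (by rw [Pi.add_apply, h0 x hx']; exact lt_irrefl 0)

/-- The image is cut out by finitely many strict inequalities σ(x) + u(x) > 0, one for each x in the
support; off the support u vanishes automatically. -/
theorem isOpenEmbedding_chart (hK : IsReversibleMarkov K μ) (hθ : IsAdmissible θ)
    (hS : S = component K μ θ σ) (hι : ∀ v, ι v ∈ tangentDirections K θ σ) (hi : IsEmbedding ι)
    (he : ∀ ρ : S, ι (e ρ) = ρ.1.val - σ.val) (m : EMetricSpace S)
    (hm : ∀ a b : S, edist a b = W K μ θ a b) : IsOpenEmbedding e := by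
  have htop := W_topology_eq hK hθ (hS ▸ W_lt_top_of_mem_component_of_mem_component hK hθ) m hm
  have hcomp : IsInducing (ι ∘ e) := by
    have h1 : ι ∘ e = (Homeomorph.subRight σ.val) ∘ (Density.val ∘ (Subtype.val : S → Density μ)) :=
      funext he
    rw [h1]
    refine (Homeomorph.subRight σ.val).isInducing.comp ⟨?_⟩
    rw [htop, induced_compose]
  have hind : IsInducing e := hi.isInducing.of_comp_iff.1 hcomp
  refine ⟨⟨hind, fun a b hab => Subtype.ext ?_⟩, ?_⟩
  · have h1 := add_chart he a
    rw [hab, add_chart he b] at h1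
    cases ha : a.1; cases hb : b.1
    simp_all
  · have hrange : range e = ⋂ x : {x // 0 < σ x}, {u | 0 < σ x.1 + ι u x.1} := by
      ext u
      simp only [mem_range, mem_iInter, Subtype.forall, Set.mem_ofPred_eq]
      constructor
      · rintro ⟨ρ, rfl⟩ x hx
        have h1 : ρ.1 ∈ component K μ θ σ := hS ▸ ρ.2
        have := congrFun (add_chart he ρ) x
        rw [Pi.add_apply] at this
        rw [this]
        exact (h1.1.2 x).2 hx
      · intro h
        obtain ⟨h1, h2⟩ := isDensity_add hK hθ (hι u) h
        have h3 : (⟨σ.val + ι u, h1⟩ : Density μ) ∈ S := by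
          rw [hS]
          exact ⟨h2, by simpa using hι u⟩
        refine ⟨⟨_, h3⟩, hi.injective ?_⟩
        rw [he]; simp
    rw [hrange]
    exact isOpen_iInter_of_finite fun x => isOpen_lt continuous_const
      (continuous_const.add ((continuous_apply x.1).comp ι.continuous))

theorem add_mem_sameSupport (hS : S = component K μ θ σ)
    (he : ∀ ρ : S, ι (e ρ) = ρ.1.val - σ.val) (ρ : S) : σ.val + ι (e ρ) ∈ sameSupport σ.val := by
  rw [add_chart he]
  have h1 : ρ.1 ∈ component K μ θ σ := hS ▸ ρ.2
  exact h1.1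

/-- On each short piece `W_le_of_curve` applies with A a bound for the metric speed, by duality. -/
theorem W_le_lintegral_tangentMetric (hK : IsReversibleMarkov K μ) (hθ : IsAdmissible θ)
    (hS : S = component K μ θ σ) (hι : ∀ v, ι v ∈ tangentDirections K θ σ)
    (he : ∀ ρ : S, ι (e ρ) = ρ.1.val - σ.val) {γ : ℝ → S}
    (hγ : ContDiffOn ℝ 1 (e ∘ γ) (Icc 0 1)) :
    W K μ θ (γ 0).1 (γ 1).1 ≤ ∫⁻ t in Icc (0 : ℝ) 1, ENNReal.ofReal
      √(tangentMetric hK hθ σ.isDensity.1 ι (e (γ t)) (derivWithin (e ∘ γ) (Icc 0 1) t)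
        (derivWithin (e ∘ γ) (Icc 0 1) t)) := by
  have hsup : ∀ t, σ.val + ι (e (γ t)) ∈ sameSupport σ.val := fun t =>
    add_mem_sameSupport hS he (γ t)
  have hdc : ContinuousOn (derivWithin (e ∘ γ) (Icc 0 1)) (Icc 0 1) :=
    hγ.continuousOn_derivWithin (uniqueDiffOn_Icc zero_lt_one) le_rfl
  have hG : ContinuousOn (fun t => tangentMetric hK hθ σ.isDensity.1 ι (e (γ t))) (Icc 0 1) :=
    (contDiffOn_tangentMetric hK hθ σ.isDensity.1 hθ.contDiffOn).continuousOn.comp hγ.continuousOn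
      fun t _ => hsup t
  have hN : ContinuousOn (fun t => √(tangentMetric hK hθ σ.isDensity.1 ι (e (γ t))
      (derivWithin (e ∘ γ) (Icc 0 1) t) (derivWithin (e ∘ γ) (Icc 0 1) t))) (Icc 0 1) :=
    ((hG.clm_apply hdc).clm_apply hdc).sqrt
  have hval : (fun t => (γ t).1.val) = fun t => σ.val + ι ((e ∘ γ) t) :=
    funext fun t => (add_chart he (γ t)).symm
  refine le_lintegral_of_le_mul (D := fun a b => W K μ θ (γ a).1 (γ b).1)
    (fun a b c => W_triangle _ _ _) hN ?_ fun t _ => Real.sqrt_nonneg _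
  intro a b ha hab hb A hA hle
  have hsub : Icc a b ⊆ Icc (0 : ℝ) 1 := Icc_subset_Icc ha hb
  refine W_le_of_curve hK hθ σ.isDensity.1 hab (ρ := fun t => (γ t).1.val) ?_ rfl rfl
    (fun t _ => (γ t).1.isDensity) (fun t _ => ?_) hA fun t ht φ => ?_
  · rw [hval]
    exact contDiffOn_const.add (ι.contDiff.comp_contDiffOn (hγ.mono hsub))
  · have := hsup t
    rwa [add_chart he] at this
  · have ht' : Icc (0 : ℝ) 1 ∈ 𝓝 t := Icc_mem_nhds (ha.trans_lt ht.1) (ht.2.trans_le hb)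
    have hd : HasDerivAt (e ∘ γ) (derivWithin (e ∘ γ) (Icc 0 1) t) t :=
      ((hγ.differentiableOn one_ne_zero t (mem_of_mem_nhds ht')).hasDerivWithinAt).hasDerivAt ht'
    have hd' : HasDerivAt (fun t => (γ t).1.val) (ι (derivWithin (e ∘ γ) (Icc 0 1) t)) t := by
      rw [hval]
      exact (ι.hasFDerivAt.comp_hasDerivAt t hd).const_add _
    rw [hd'.deriv, ← add_chart he]
    refine (pair_sq_le_tangentMetric hK hθ σ.isDensity.1 hι (hsup t) _ φ).trans ?_
    refine mul_le_mul_of_nonneg_right ?_ (gradInner_self_nonneg hK hθ (hsup t).1 φ)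
    exact (Real.sqrt_le_left hA).1 (hle t ht)

/-- Between any two points there are curves inside of a component which start and end close to
these points, and whose length is close to the distance. -/
def HasNearCurves (K : Matrix X X ℝ) (μ : X → ℝ) (θ : ℝ → ℝ → ℝ) (σ : Density μ) : Prop :=
  ∀ a ∈ component K μ θ σ, ∀ b ∈ component K μ θ σ, ∀ c, W K μ θ a b < c →
    ∀ U ∈ 𝓝 a.val, ∀ V ∈ 𝓝 b.val, ∃ ρ : ℝ → X → ℝ, PiecewiseC1 ρ ∧
      (∀ t ∈ Icc (0 : ℝ) 1, IsDensity μ (ρ t) ∧ ρ t ∈ sameSupport σ.val ∧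
        ρ t - σ.val ∈ tangentDirections K θ σ) ∧ ρ 0 ∈ U ∧ ρ 1 ∈ V ∧
      ∃ N : ℝ → ℝ, (∀ t, 0 ≤ N t) ∧ (∀ᵐ t ∂volume.restrict (Ioo (0 : ℝ) 1), ∃ v, HasDerivAt ρ v t ∧
        ∀ φ, pair μ φ v ^ 2 ≤ N t ^ 2 * gradInner K μ θ (ρ t) φ φ) ∧
      ∫⁻ t in Icc (0 : ℝ) 1, ENNReal.ofReal (N t) < c

theorem HasNearCurves.exists_curve (hK : IsReversibleMarkov K μ) (hθ : IsAdmissible θ)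
    (hnear : HasNearCurves K μ θ σ)
    (hS : S = component K μ θ σ) (hι : ∀ v, ι v ∈ tangentDirections K θ σ)
    {P : (X → ℝ) →L[ℝ] E} (hP : ∀ v, P (ι v) = v) (hP' : ∀ v ∈ tangentDirections K θ σ, ι (P v) = v)
    (he : ∀ ρ : S, ι (e ρ) = ρ.1.val - σ.val) {a b : S} {c : ℝ≥0∞} (hc : W K μ θ a.1 b.1 < c)
    {U V : Set (X → ℝ)} (hU : U ∈ 𝓝 a.1.val) (hV : V ∈ 𝓝 b.1.val) :
    ∃ γ : ℝ → S, (γ 0).1.val ∈ U ∧ (γ 1).1.val ∈ V ∧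
      (∃ (n : ℕ) (τ : ℕ → ℝ), Monotone τ ∧ τ 0 = 0 ∧ τ n = 1 ∧
        ∀ i < n, ContDiffOn ℝ 1 (e ∘ γ) (Icc (τ i) (τ (i + 1)))) ∧
      ∫⁻ t in Icc (0 : ℝ) 1, ENNReal.ofReal √(tangentMetric hK hθ σ.isDensity.1 ι (e (γ t))
        (deriv (e ∘ γ) t) (deriv (e ∘ γ) t)) < c := by
  classical
  obtain ⟨ρ, hρ, hmem, h0, h1, N, hN0, hN, hlt⟩ :=
    hnear a.1 (hS ▸ a.2) b.1 (hS ▸ b.2) c hc U hU V hV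
  let γ : ℝ → S := fun t => if ht : t ∈ Icc (0 : ℝ) 1 then
    ⟨⟨ρ t, (hmem t ht).1⟩, hS ▸ (hmem t ht).2⟩ else a
  have hγ : ∀ t ∈ Icc (0 : ℝ) 1, (γ t).1.val = ρ t := fun t ht => by
    simp only [γ, dif_pos ht]
  have heγ : ∀ t ∈ Icc (0 : ℝ) 1, (e ∘ γ) t = P (ρ t - σ.val) := fun t ht => by
    rw [← hγ t ht, ← he, hP]; rfl
  obtain ⟨n, τ, hτ, hτ0, hτ1, hC1⟩ := hρ
  refine ⟨γ, by rwa [hγ 0 (by simp)], by rwa [hγ 1 (by simp)],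
    ⟨n, τ, hτ, hτ0, hτ1, fun i hi => ?_⟩, lt_of_le_of_lt ?_ hlt⟩
  · refine (P.contDiff.comp_contDiffOn ((hC1 i hi).sub (contDiffOn_const (c := σ.val)))).congr
      fun t ht => ?_
    exact heγ t ⟨(hτ0.ge.trans (hτ (Nat.zero_le i))).trans ht.1, ht.2.trans ((hτ hi).trans hτ1.le)⟩
  · rw [← restrict_Ioo_eq_restrict_Icc]
    refine lintegral_mono_ae ?_
    filter_upwards [hN, ae_restrict_mem measurableSet_Ioo] with t ⟨v, hv, hvN⟩ ht
    have hnhds : Icc (0 : ℝ) 1 ∈ 𝓝 t := Icc_mem_nhds ht.1 ht.2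
    have hd : HasDerivAt (e ∘ γ) (P v) t :=
      (P.hasFDerivAt.comp_hasDerivAt t (hv.sub_const σ.val)).congr_of_eventuallyEq
        (Filter.mem_of_superset hnhds heγ)
    -- The velocity is tangent because ρ - σ stays among the tangent directions, where ι ∘ P is the
    -- identity.
    have hιP : ι (P v) = v := by
      have h2 : HasDerivAt (fun s => ρ s - σ.val) (ι (P v)) t :=
        (ι.hasFDerivAt.comp_hasDerivAt t hd).congr_of_eventuallyEq
          (Filter.mem_of_superset hnhds fun s hs => by
            change ρ s - σ.val = ι ((e ∘ γ) s)
            rw [heγ s hs, hP' _ (hmem s hs).2.2])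
      exact h2.unique (hv.sub_const σ.val)
    rw [hd.deriv]
    refine ENNReal.ofReal_le_ofReal ((Real.sqrt_le_left (hN0 t)).2 ?_)
    refine tangentMetric_le hK hθ σ.isDensity.1 hι (add_mem_sameSupport hS he _) (sq_nonneg _)
      fun φ => ?_
    rw [hιP, add_chart he, hγ t (mem_of_mem_nhds hnhds)]
    exact hvN φ

end Chart

theorem isRiemannianOn_of_hasNearCurves (hK : IsReversibleMarkov K μ) (hθ : IsAdmissible θ)
    {σ : Density μ} {S : Set (Density μ)} (hS : S = component K μ θ σ)
    (hnear : HasNearCurves K μ θ σ) (m : EMetricSpace S)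
    (hm : ∀ a b : S, edist a b = W K μ θ a b) {k : ℕ∞}
    (hk : ContDiffOn ℝ k (fun p : ℝ × ℝ => θ p.1 p.2) (Ioi 0 ×ˢ Ioi 0)) :
    IsRiemannianOn K μ θ k σ S m := by
  have hcomp : ∀ ρ : S, ρ.1 ∈ component K μ θ σ := fun ρ => hS ▸ ρ.2
  refine ⟨fun ρ hρ => range_B_eq hK hθ σ.isDensity.1 (hcomp ⟨ρ, hρ⟩).1, ?_⟩
  let e : S → tangentDirections K θ σ := fun ρ => ⟨ρ.1.val - σ.val, (hcomp ρ).2⟩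
  let ι : tangentDirections K θ σ →L[ℝ] X → ℝ :=
    (tangentDirections K θ σ).subtype.mkContinuous 1 fun v => by simp
  have hι : ∀ v, ι v ∈ tangentDirections K θ σ := fun v => v.2
  have he : ∀ ρ : S, ι (e ρ) = ρ.1.val - σ.val := fun ρ => rfl
  have hn : ∀ v, ‖ι v‖ = ‖v‖ := fun v => rfl
  have hinj : Function.Injective ι := fun a b h => Subtype.ext h
  have hemb : IsEmbedding ι := IsEmbedding.subtypeVal
  have hopen : IsOpenEmbedding e := isOpenEmbedding_chart hK hθ hS hι hemb he m hm
  have hsup := add_mem_sameSupport hS he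
  have : Nonempty S := ⟨⟨σ, hS ▸ ⟨sameSupport_self σ.isDensity.1, by simp⟩⟩⟩
  obtain ⟨P₀, hP₀⟩ := (tangentDirections K θ σ).subtype.exists_leftInverse_of_injective
    (LinearMap.ker_eq_bot.2 (Submodule.subtype_injective _))
  let P : (X → ℝ) →L[ℝ] tangentDirections K θ σ := LinearMap.toContinuousLinearMap P₀
  have hP : ∀ v, P (ι v) = v := fun v => LinearMap.congr_fun hP₀ v
  have hP' : ∀ v ∈ tangentDirections K θ σ, ι (P v) = v := fun v hv =>
    congrArg ι (hP ⟨v, hv⟩)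
  have hsm := (contDiffOn_tangentMetric hK hθ σ.isDensity.1 (ι := ι) hk).mono
    (range_subset_iff.2 hsup)
  let g := metricOfChart hopen (tangentMetric hK hθ σ.isDensity.1 ι)
    (fun ρ => tangentMetric_symm hK hθ σ.isDensity.1 hι (hsup ρ))
    (fun ρ v hv => tangentMetric_pos hK hθ σ.isDensity.1 hι (hsup ρ) hinj hv)
    (fun ρ => isVonNBounded_tangentMetric hK hθ σ.isDensity.1 hι (hsup ρ) hn) hsm
  refine ⟨e, fun ρ x => rfl, this, hopen, hopen.isManifold_singleton, g, ?_, ?_⟩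
  · intro ρ u v φ ψ hφ hψ
    have h1 := add_chart he ρ
    rw [← h1] at hφ hψ ⊢
    exact tangentMetric_eq_gradInner hK hθ σ.isDensity.1 hι (hsup ρ) hφ hψ
  · refine isRiemannianManifold_metricOfChart hopen ?_ ?_
    · intro γ hγ
      rw [hm]
      exact W_le_lintegral_tangentMetric hK hθ hS hι he hγ
    · intro a b c hc U hU V hV
      rw [hm] at hc
      have htop := W_topology_eq hK hθ (hS ▸ W_lt_top_of_mem_component_of_mem_component hK hθ) m hm
      rw [htop, induced_compose, nhds_induced, Filter.mem_comap] at hU hV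
      obtain ⟨U', hU', hUU⟩ := hU
      obtain ⟨V', hV', hVV⟩ := hV
      obtain ⟨γ, h0, h1, h2, h3⟩ := hnear.exists_curve hK hθ hS hι hP hP' he hc hU' hV'
      exact ⟨γ, hUU h0, hVV h1, h2, h3⟩

/-! ### Curves whose length is close to the distance -/

theorem exists_isCE_length_lt (hK : IsReversibleMarkov K μ) (hθ : IsAdmissible θ)
    {ρ₀ ρ₁ : Density μ} {c : ℝ≥0∞} (h : W K μ θ ρ₀ ρ₁ < c) :
    ∃ ρ ψ, IsCE K μ θ ρ₀ ρ₁ ρ ψ ∧ action K μ θ ρ ψ < ⊤ ∧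
      ∫⁻ t in Icc (0 : ℝ) 1, ENNReal.ofReal √(gradInner K μ θ (ρ t) (ψ t) (ψ t)) < c := by
  obtain ⟨ρ, ψ, hρ, hA⟩ := exists_isCE_of_W_lt h
  refine ⟨ρ, ψ, hρ, hA.trans_le le_top, (lintegral_Icc_le_sqrt _).trans_lt ?_⟩
  have h1 : ∫⁻ t in Icc (0 : ℝ) 1, ENNReal.ofReal √(gradInner K μ θ (ρ t) (ψ t) (ψ t)) ^ 2 =
      action K μ θ ρ ψ := by
    refine setLIntegral_congr_fun measurableSet_Icc fun t ht => ?_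
    rw [← ENNReal.ofReal_pow (Real.sqrt_nonneg _),
      Real.sq_sqrt (gradInner_self_nonneg hK hθ (hρ.density t ht).1 _)]
  rw [h1]
  refine (ENNReal.rpow_lt_rpow hA (by norm_num : (0 : ℝ) < 1 / 2)).trans_eq ?_
  rw [← ENNReal.rpow_natCast, ← ENNReal.rpow_mul]
  norm_num

/-- No approximation is needed: by the barrier and the conservation laws, a curve of finite action
never leaves its component. -/
theorem hasNearCurves_of_Cθ_eq_top (hK : IsReversibleMarkov K μ) (hθ : IsAdmissible θ)
    (hC : Cθ θ = ⊤) (σ : Density μ) : HasNearCurves K μ θ σ := by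
  intro a ha b hb c hc U hU V hV
  obtain ⟨ρ, ψ, hρ, hA, hlt⟩ := exists_isCE_length_lt hK hθ hc
  have hs : ∀ t ∈ Icc (0 : ℝ) 1, ρ t ∈ sameSupport σ.val := fun t ht => by
    have h1 := hρ.mem_sameSupport hK hθ hC hA ht (left_mem_Icc.2 zero_le_one)
    rw [hρ.init] at h1
    exact ⟨h1.1, fun x => (h1.2 x).trans (ha.1.2 x)⟩
  refine ⟨ρ, hρ.piecewiseC1, fun t ht => ⟨hρ.density t ht, hs t ht, ?_⟩, ?_, ?_, _,
    fun t => Real.sqrt_nonneg _, ?_, hlt⟩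
  · have h1 := hρ.sub_mem_range hK hθ σ.isDensity.1 (fun t ht => hs t (Ioo_subset_Icc_self ht))
      le_rfl ht.1 ht.2
    rw [hρ.init] at h1
    have := Submodule.add_mem _ h1 ha.2
    rwa [sub_add_sub_cancel] at this
  · rw [hρ.init]; exact mem_of_mem_nhds hU
  · rw [hρ.final]; exact mem_of_mem_nhds hV
  · filter_upwards [hρ.ae_hasDerivAt, ae_restrict_mem measurableSet_Ioo] with t hd ht
    have hnn := (hρ.density t (Ioo_subset_Icc_self ht)).1
    refine ⟨_, hd, fun φ => ?_⟩
    rw [Real.sq_sqrt (gradInner_self_nonneg hK hθ hnn _)]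
    exact pair_B_sq_le hK hθ hnn φ _

/-- Concavity on the segment from (s, t) to (1, 1), after dropping the nonnegative term εθ(1, 1). -/
theorem IsConcave.mul_le (hc : IsConcave θ) (hθ : IsAdmissible θ) {s t ε : ℝ} (hs : 0 ≤ s)
    (ht : 0 ≤ t) (h0 : 0 ≤ ε) (h1 : ε ≤ 1) :
    (1 - ε) * θ s t ≤ θ (s + ε * (1 - s)) (t + ε * (1 - t)) := by
  have hc' : ConcaveOn ℝ (Ici (0 : ℝ) ×ˢ Ici (0 : ℝ)) (fun p : ℝ × ℝ => θ p.1 p.2) := hc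
  have h := @hc'.2 (s, t) ⟨hs, ht⟩ (1, 1) ⟨zero_le_one (α := ℝ), zero_le_one (α := ℝ)⟩
    (1 - ε) ε (by linarith) h0 (by ring)
  have h2 := mul_nonneg h0 (hθ.nonneg 1 1 zero_le_one zero_le_one)
  simp only [smul_eq_mul, Prod.smul_mk, Prod.mk_add_mk, mul_one] at h
  have e1 : s + ε * (1 - s) = (1 - ε) * s + ε := by ring
  have e2 : t + ε * (1 - t) = (1 - ε) * t + ε := by ring
  rw [e1, e2]
  linarith

/-- Contraction towards 1 multiplies the velocity by 1 - ε, and by concavity the edge weights shrink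
by a factor of at least 1 - ε. The squared speed thus changes by a factor of at most (1 - ε)²/(1 -
ε) ≤ 1. -/
theorem hasNearCurves_of_isConcave (hK : IsReversibleMarkov K μ) (hθ : IsAdmissible θ)
    (hc : IsConcave θ) {σ : Density μ} (hσ : ∀ x, 0 < σ x) : HasNearCurves K μ θ σ := by
  intro a ha b hb c hc U hU V hV
  obtain ⟨ρ, ψ, hρ, hA, hlt⟩ := exists_isCE_length_lt hK hθ hc
  have hlim : ∀ v : X → ℝ, ∀ U ∈ 𝓝 v, ∀ᶠ ε in 𝓝[>] (0 : ℝ), v + ε • (1 - v) ∈ U := by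
    intro v U hU
    have h1 : Filter.Tendsto (fun ε : ℝ => v + ε • (1 - v)) (𝓝 0) (𝓝 (v + (0 : ℝ) • (1 - v))) :=
      Continuous.tendsto (by fun_prop) 0
    rw [zero_smul, add_zero] at h1
    exact (h1.mono_left nhdsWithin_le_nhds) hU
  obtain ⟨ε, ⟨h0, h1⟩, ⟨hε0, hε1⟩⟩ := ((hlim _ U hU).and (hlim _ V hV)).and
    (Ioo_mem_nhdsGT (zero_lt_one' ℝ)) |>.exists
  have hd : ∀ t ∈ Icc (0 : ℝ) 1, IsDensity μ (ρ t + ε • (1 - ρ t)) := fun t ht =>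
    (hρ.density t ht).convex (unitDensity hK).isDensity ⟨hε0.le, hε1.le⟩
  have hpos : ∀ t ∈ Icc (0 : ℝ) 1, ∀ x, 0 < (ρ t + ε • (1 - ρ t)) x := fun t ht x => by
    have := mul_nonneg (sub_nonneg.2 hε1.le) ((hρ.density t ht).1 x)
    simp only [Pi.add_apply, Pi.smul_apply, Pi.sub_apply, Pi.one_apply, smul_eq_mul]
    linarith
  refine ⟨fun t => ρ t + ε • (1 - ρ t), ?_, fun t ht => ?_, ?_, ?_, _,
    fun t => Real.sqrt_nonneg _, ?_, hlt⟩
  · obtain ⟨n, τ, hτ, hτ0, hτ1, h⟩ := hρ.piecewiseC1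
    exact ⟨n, τ, hτ, hτ0, hτ1, fun i hi =>
      (h i hi).add ((contDiffOn_const.sub (h i hi)).const_smul ε)⟩
  · have := mem_component_of_pos hK hθ (ρ := ⟨_, hd t ht⟩) (hpos t ht) hσ
    exact ⟨hd t ht, this.1, this.2⟩
  · simpa only [hρ.init] using h0
  · simpa only [hρ.final] using h1
  · filter_upwards [hρ.ae_hasDerivAt, ae_restrict_mem measurableSet_Ioo] with t hdt ht
    have hnn := (hρ.density t (Ioo_subset_Icc_self ht)).1
    refine ⟨_, hdt.add ((hdt.const_sub 1).const_smul ε), fun φ => ?_⟩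
    have hQ := gradInner_self_nonneg hK hθ hnn (ψ t)
    rw [Real.sq_sqrt hQ, smul_neg, ← sub_eq_add_neg, pair_sub_right, pair_smul_right]
    have hle := gradInner_le_mul hK (ρ := ρ t) (ρ' := ρ t + ε • (1 - ρ t)) (C := (1 - ε)⁻¹)
      (fun x y => by
        rw [inv_mul_eq_div, le_div_iff₀ (sub_pos.2 hε1), mul_comm]
        exact IsConcave.mul_le ‹_› hθ (hnn x) (hnn y) hε0.le hε1.le) φ
    rw [inv_mul_eq_div, le_div_iff₀ (sub_pos.2 hε1), mul_comm] at hle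
    have h2 := pair_B_sq_le hK hθ hnn φ (ψ t)
    have h3 := gradInner_self_nonneg hK hθ hnn φ
    set p := pair μ φ (B K θ (ρ t) (ψ t))
    set q := gradInner K μ θ (ρ t) φ φ
    set Q := gradInner K μ θ (ρ t) (ψ t) (ψ t)
    have h4 : (1 - ε) ^ 2 * p ^ 2 ≤ (1 - ε) * p ^ 2 :=
      mul_le_mul_of_nonneg_right (by nlinarith) (sq_nonneg p)
    calc (p - ε * p) ^ 2 = (1 - ε) ^ 2 * p ^ 2 := by ring
      _ ≤ (1 - ε) * p ^ 2 := h4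
      _ ≤ (1 - ε) * (Q * q) := mul_le_mul_of_nonneg_left h2 (by linarith)
      _ = Q * ((1 - ε) * q) := by ring
      _ ≤ _ := mul_le_mul_of_nonneg_left hle hQ

/-! ### Completeness -/

/-- If the limit were not positive, each interval from 1/(k+1) to c would eventually lie in those
from u(n) to c; by exhaustion the infinite cost from 0 to c would be at most A. -/
theorem pos_of_tendsto_of_cost_le (hθ : IsAdmissible θ) (hC : Cθ θ = ⊤) {M c : ℝ} (hM : 0 < M)
    (hc : 0 < c) {u : ℕ → ℝ} {l : ℝ} (hu : Filter.Tendsto u Filter.atTop (𝓝 l)) {A : ℝ≥0∞}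
    (hA : A < ⊤) (hcost : ∀ᶠ n in Filter.atTop, cost θ M (u n) c ≤ A) : 0 < l := by
  by_contra hl
  have h1 : ∀ k : ℕ, ∫⁻ r in Ioc ((1 : ℝ) / (k + 1)) c, ENNReal.ofReal (1 / √(θ r M)) ≤ A := by
    intro k
    have hk : l < 1 / ((k : ℝ) + 1) := (not_lt.1 hl).trans_lt (by positivity)
    obtain ⟨n, hn, hn'⟩ := (hcost.and (hu.eventually_lt_const hk)).exists
    refine (lintegral_mono_set ?_).trans hn
    exact Ioc_subset_Ioc_left hn'.le
  have h2 : cost θ M 0 c ≤ A := by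
    have hU : ⋃ k : ℕ, Ioc ((1 : ℝ) / (k + 1)) c = Ioc 0 c := by
      ext r
      simp only [mem_iUnion, mem_Ioc]
      constructor
      · rintro ⟨k, hk, hr⟩
        exact ⟨lt_trans (by positivity) hk, hr⟩
      · rintro ⟨h, hr⟩
        obtain ⟨k, hk⟩ := exists_nat_one_div_lt h
        exact ⟨k, hk, hr⟩
    rw [cost, ← hU, setLIntegral_iUnion_of_directed]
    · exact iSup_le h1
    · exact Monotone.directed_le fun i j hij => Ioc_subset_Ioc_left (by
        apply one_div_le_one_div_of_le (by positivity)
        gcongr)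
  rw [cost_eq_top hθ hC hM hc] at h2
  exact absurd hA (not_lt.2 h2)

theorem completeSpace_of_Cθ_eq_top (hK : IsReversibleMarkov K μ) (hθ : IsAdmissible θ)
    (hC : Cθ θ = ⊤) {σ : Density μ} {S : Set (Density μ)} (hS : S = component K μ θ σ)
    (m : EMetricSpace S) (hm : ∀ a b : S, edist a b = W K μ θ a b) : CompleteSpace S := by
  have hcomp : ∀ ρ : S, ρ.1 ∈ component K μ θ σ := fun ρ => hS ▸ ρ.2
  obtain ⟨C, hCtop, hCle⟩ := exists_enorm_apply_sub_le_W hK hθ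
  refine EMetric.complete_of_cauchySeq_tendsto fun u hu => ?_
  rw [EMetric.cauchySeq_iff] at hu
  have hcx : ∀ x, CauchySeq fun n => (u n).1 x := by
    intro x
    rw [EMetric.cauchySeq_iff]
    intro ε hε
    obtain ⟨δ, hδ, hδε⟩ := ENNReal.exists_nnreal_pos_mul_lt hCtop hε.ne'
    rw [mul_comm] at hδε
    obtain ⟨N, hN⟩ := hu δ (by exact_mod_cast hδ)
    refine ⟨N, fun i hi j hj => ?_⟩
    rw [edist_eq_enorm_sub]
    refine (hCle (u j).1 (u i).1 x).trans_lt (lt_of_le_of_lt ?_ hδε)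
    gcongr
    rw [← hm]
    exact (hN j hj i hi).le
  choose v hv using fun x => cauchySeq_tendsto_of_complete (hcx x)
  have hlim : Filter.Tendsto (fun n => (u n).1.val) Filter.atTop (𝓝 v) := tendsto_pi_nhds.2 hv
  have hd : IsDensity μ v := by
    refine ⟨fun x => ge_of_tendsto' (hv x) fun n => (u n).1.isDensity.1 x, ?_⟩
    refine tendsto_nhds_unique (tendsto_finsetSum _ fun x _ => (hv x).const_mul (μ x))
      (tendsto_const_nhds.congr fun n => ((u n).1.isDensity.2).symm)
  have hsupp : ∀ x, 0 < v x ↔ 0 < σ x := by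
    intro x
    constructor
    · intro hx
      obtain ⟨n, hn⟩ := ((hv x).eventually_const_lt hx).exists
      exact ((hcomp (u n)).1.2 x).1 hn
    · intro hx
      -- From N on all distances are below 1, so the cost from the n-th value at x up to the N-th
      -- one is bounded uniformly in n.
      obtain ⟨N, hN⟩ := hu 1 one_pos
      have hNx := ((hcomp (u N)).1.2 x).2 hx
      refine pos_of_tendsto_of_cost_le hθ hC (densityBound_pos hK) hNx (hv x)
        (A := ENNReal.ofReal |√(μ x)⁻¹|) ENNReal.ofReal_lt_top ?_
      filter_upwards [Filter.eventually_ge_atTop N] with n hn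
      have h1 := hN n hn N le_rfl
      rw [hm] at h1
      obtain ⟨ρ, ψ, hρ, hA⟩ := exists_isCE_of_W_lt h1
      have h2 := hρ.cost_le hK hθ x (left_mem_Icc.2 zero_le_one) (right_mem_Icc.2 zero_le_one)
      rw [hρ.init, hρ.final] at h2
      refine h2.trans (mul_le_of_le_one_right zero_le ?_)
      exact ENNReal.rpow_le_one (by simpa using hA.le) (by norm_num)
  have hvS : (⟨v, hd⟩ : Density μ) ∈ S := by
    rw [hS]
    refine ⟨⟨hd.1, hsupp⟩, ?_⟩
    -- The conserved quantities pass to the limit since Ran `B(σ)` is closed.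
    exact (Submodule.closed_of_finiteDimensional (tangentDirections K θ σ)).mem_of_tendsto
      (hlim.sub_const σ.val) (.of_forall fun n => (hcomp (u n)).2)
  refine ⟨⟨_, hvS⟩, ?_⟩
  have htop := W_topology_eq hK hθ (hS ▸ W_lt_top_of_mem_component_of_mem_component hK hθ) m hm
  rw [htop, induced_compose, nhds_induced, Filter.tendsto_comap_iff]
  exact hlim

theorem finiteDist_eq_component (hK : IsReversibleMarkov K μ) (hθ : IsAdmissible θ)
    (hC : Cθ θ = ⊤) (σ : Density μ) : finiteDist K μ θ σ = component K μ θ σ :=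
  Set.ext fun _ => W_lt_top_iff_mem_component hK hθ hC

theorem positiveDensities_eq_component (hK : IsReversibleMarkov K μ) (hθ : IsAdmissible θ)
    {σ : Density μ} (hσ : σ ∈ positiveDensities μ) :
    positiveDensities μ = component K μ θ σ :=
  Set.ext fun _ => ⟨fun h => mem_component_of_pos hK hθ h hσ, fun h x => (h.1.2 x).2 (hσ x)⟩

end

end DiscreteTransport

/-! ### Assembly of the theorem -/

theorem theorem1p1 {X : Type*} [Fintype X] (K : Matrix X X ℝ) (μ : X → ℝ) (θ : ℝ → ℝ → ℝ)
    (hK : IsReversibleMarkov K μ) (hθ : IsAdmissible θ) :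
    IsExtendedMetric (W K μ θ) ∧
    ((Cθ θ < ⊤ → ∀ ρ₀ ρ₁ : Density μ, W K μ θ ρ₀ ρ₁ < ⊤) ∧
      (Cθ θ = ⊤ → ∀ ρ₀ ρ₁ : Density μ,
        W K μ θ ρ₀ ρ₁ < ⊤ ↔ ∀ x, classMass K μ θ ρ₀ x = classMass K μ θ ρ₁ x)) ∧
    (∀ σ : Density μ,
      MetrizesOn (W K μ θ) (finiteDist K μ θ σ) (weakTopology μ) ∧
      MetrizesOn (dTV μ) (finiteDist K μ θ σ) (weakTopology μ)) ∧
    (∀ k : ℕ∞, 1 ≤ k →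
      ContDiffOn ℝ k (fun p : ℝ × ℝ => θ p.1 p.2) (Ioi 0 ×ˢ Ioi 0) →
      (Cθ θ < ⊤ → IsConcave θ →
        ∃ m : EMetricSpace (positiveDensities μ),
          (∀ a b : positiveDensities μ, edist a b = W K μ θ a b) ∧
          ∀ σ ∈ positiveDensities μ, IsRiemannianOn K μ θ k σ (positiveDensities μ) m) ∧
      (Cθ θ = ⊤ → ∀ σ : Density μ,
        ∃ m : EMetricSpace (finiteDist K μ θ σ),
          (∀ a b : finiteDist K μ θ σ, edist a b = W K μ θ a b) ∧
          IsRiemannianOn K μ θ k σ (finiteDist K μ θ σ) m ∧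
          CompleteSpace (finiteDist K μ θ σ))) := by
  refine ⟨isExtendedMetric_W hK hθ, ⟨fun hC => W_lt_top_of_Cθ_lt_top hK hθ hC,
    fun hC => W_lt_top_iff_classMass hK hθ hC⟩,
    fun σ => ⟨metrizesOn_W hK hθ σ, metrizesOn_dTV hK _⟩,
    fun k _ hk => ⟨fun _ hc => ?_, fun hC σ => ?_⟩⟩
  · refine ⟨(isExtendedMetric_W hK hθ).toEMetricSpace _, fun _ _ => rfl, fun σ hσ => ?_⟩
    exact isRiemannianOn_of_hasNearCurves hK hθ (positiveDensities_eq_component hK hθ hσ)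
      (hasNearCurves_of_isConcave hK hθ hc hσ) _ (fun _ _ => rfl) hk
  · have hS := finiteDist_eq_component hK hθ hC σ
    refine ⟨(isExtendedMetric_W hK hθ).toEMetricSpace _, fun _ _ => rfl, ?_, ?_⟩
    · exact isRiemannianOn_of_hasNearCurves hK hθ hS (hasNearCurves_of_Cθ_eq_top hK hθ hC σ) _
        (fun _ _ => rfl) hk
    · exact completeSpace_of_Cθ_eq_top hK hθ hC hS _ fun _ _ => rfl
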